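/- Let $\mathbb D$ be the open unit disc and $dA$ the Lebesgue measure. Let $\omega:\mathbb D\to(0,\infty)$ be integrable with respect to $dA$ and bounded below by a positive constant on each compact subset of $\mathbb D$. Put $L^2_\omega=L^2(\mathbb D,\omega\,dA)$, and let $A^2_\omega$ be the weighted Bergman space of holomorphic functions in $L^2_\omega$, which is a reproducing kernel Hilbert space. Denote by $K(\zeta,z)=K_z(\zeta)$ its kernel, by $P_\omega:L^2_\omega\to A^2_\omega$ the orthogonal projection, and put $$\tau_\omega(z)=\frac1{\omega(z)^{1/2}\,\|K_z\|},\qquad z\in\mathbb D .$$ We say that $\omega\in\mathcal W$ if the following hold: 1. $\lim_{|z|\to1^-}\|K_z\|=\infty$ and, for every $\zeta\in\mathbb D$, $|K(\zeta,z)|=o(\|K_z\|)$ as $|z|\to1^-$; 2. $\tau_\omega(z)=O(1-|z|)$ on $\mathbb D$; 3. there are constants $\eta>0$ and $C>0$ such that, for all $z,\zeta\in\mathbb D$ with $|z-\zeta|\le\eta\,\tau_\omega(z)$, one has $C^{-1}\tau_\omega(\zeta)\le\tau_\omega(z)\le C\,\tau_\omega(\zeta)$ and $\|K_z\|\,\|K_\zeta\|\le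 C\,|K(\zeta,z)|$. Write $\Delta=\partial\bar\partial$ (a quarter of the usual Laplacian) and $\partial=\frac12(\partial_x-i\partial_y)$. We say that $\omega\in\mathcal W^*$ if $\omega=e^{-\varphi}\in\mathcal W$ with $\varphi\in C^2(\mathbb D)$ and at least one of the following holds: * there is $c>0$ such that $\tau_\omega^2\,\Delta\varphi\ge c$ on $\mathbb D$; * there are a subharmonic function $\psi:\mathbb D\to[0,\infty)$ of class $C^2$ and constants $\delta>0$, $t\in(-1,0)$ such that, on $\mathbb D$, $\tau_\omega^2\,\Delta\psi\ge\delta$, $\ \Delta\varphi\ge t\,\Delta\psi$ and $|\partial\psi|^2\le\Delta\psi$. For $\phi$ holomorphic on $\mathbb D$ with $\overline\phi K_z\in L^2_\omega$ for all $z\in\mathbb D$, the Hankel operator is the densely defined operator $$H_{\overline\phi}f=\overline\phi f-P_\omega(\overline\phi f),\qquad f\in\operatorname{span}\{K_z:z\in\mathbb D\},$$ from $A^2_\omega$ to $L^2_\omega$. We say that $H_{\overline\phi}$ is compact on $A^2_\omega$ if it is well defined (that is, $\overline\phi K_z\in L^2_\omega$ for all $z\in\mathbb D$) and extends to a compact operator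 from $A^2_\omega$ to $L^2_\omega$. **Theorem.** Let $\omega\in\mathcal W^*$ and let $\phi$ be holomorphic on $\mathbb D$. Then $H_{\overline\phi}$ is compact on $A^2_\omega$ if and only if $\phi\in\mathcal B^\omega_0$, that is, $$\lim_{|z|\to1^-}\tau_\omega(z)\,|\phi'(z)|=0 .$$ -/

import Mathlib

open Metric MeasureTheory Filter Topology Asymptotics Complex.UnitDisc
open scoped ENNReal NNReal ComplexConjugate InnerProductSpace

noncomputable section

/-- A weight on the unit disc: a positive function, integrable with respect to the Lebesgue
(area) measure of the disc, and bounded below by a positive constant on each compact subset of the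
disc. Only the values on the open unit disc `ball 0 1` are ever used. -/
structure BergmanWeight where
  toFun : ℂ → ℝ
  pos : ∀ z ∈ ball (0 : ℂ) 1, 0 < toFun z
  integrable : IntegrableOn toFun (ball (0 : ℂ) 1) volume
  bddBelow : ∀ S : Set ℂ, IsCompact S → S ⊆ ball (0 : ℂ) 1 →
    ∃ c : ℝ, 0 < c ∧ ∀ z ∈ S, c ≤ toFun z

namespace BergmanWeight

/-! ### Auxiliary estimates: point evaluations are bounded, locally uniformly -/

/-- The sub-mean value property on circles. -/
theorem norm_le_lintegral_circle (G : ℂ → ℂ) (a : ℂ) (r ρ : ℝ) (h0 : 0 < ρ) (hr : ρ < r)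
    (hG : DifferentiableOn ℂ G (ball a r)) :
    ‖G a‖ₑ * ENNReal.ofReal (2 * Real.pi) ≤
      ∫⁻ θ in Set.Ioo (-Real.pi) Real.pi, ‖G (circleMap a ρ θ)‖ₑ := by
  have hd : DiffContOnCl ℂ G (ball a |ρ|) := by
    rw [abs_of_pos h0]
    exact (hG.mono (closedBall_subset_ball hr)).diffContOnCl_ball subset_rfl
  have h := hd.circleAverage
  have hp : Function.Periodic (fun θ => G (circleMap a ρ θ)) (2 * Real.pi) := by
    intro θ; simp only [periodic_circleMap a ρ θ]
  have h2 : (∫ θ in (0:ℝ)..2 * Real.pi, G (circleMap a ρ θ)) =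
      ∫ θ in (-Real.pi)..Real.pi, G (circleMap a ρ θ) := by
    have := hp.intervalIntegral_add_eq 0 (-Real.pi)
    rw [zero_add, show -Real.pi + 2 * Real.pi = Real.pi by ring] at this
    exact this
  rw [Real.circleAverage_def, h2, intervalIntegral.integral_of_le (by linarith [Real.pi_pos])] at h
  have h3 : ‖∫ θ in Set.Ioo (-Real.pi) Real.pi, G (circleMap a ρ θ)‖ₑ ≤
      ∫⁻ θ in Set.Ioo (-Real.pi) Real.pi, ‖G (circleMap a ρ θ)‖ₑ :=
    enorm_integral_le_lintegral_enorm _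
  refine le_trans (le_of_eq ?_) h3
  rw [integral_Ioc_eq_integral_Ioo] at h
  have hpi : (2 * Real.pi) ≠ 0 := by positivity
  rw [← h, ← ofReal_norm, ← ofReal_norm, ← ENNReal.ofReal_mul (norm_nonneg _),
    norm_smul, norm_inv, Real.norm_of_nonneg (by positivity : (0:ℝ) ≤ 2 * Real.pi)]
  congr 1
  field_simp

/-- The sub-mean value property on discs. -/
theorem norm_le_lintegral_ball (G : ℂ → ℂ) (a : ℂ) (r : ℝ) (hr : 0 < r)
    (hG : DifferentiableOn ℂ G (ball a r)) :
    ENNReal.ofReal (r ^ 2 * Real.pi) * ‖G a‖ₑ ≤ ∫⁻ z in ball a r, ‖G z‖ₑ := by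
  classical
  set f : ℂ → ℝ≥0∞ := (ball a r).indicator fun z => ‖G z‖ₑ with hf
  have hfm : Measurable f := by
    have := ContinuousOn.measurable_piecewise (f := fun z => ‖G z‖ₑ) (g := fun _ => (0:ℝ≥0∞))
      (s := ball a r) hG.continuousOn.enorm continuousOn_const measurableSet_ball
    rw [hf, ← Set.piecewise_eq_indicator]; exact this
  have h1 : ∫⁻ z in ball a r, ‖G z‖ₑ = ∫⁻ z, f (a + z) := by
    rw [← lintegral_indicator measurableSet_ball, lintegral_add_left_eq_self f a]
  have hsm : Measurable Complex.polarCoord.symm := by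
    have : (Complex.polarCoord.symm : ℝ × ℝ → ℂ) =
      fun p => p.1 * (Real.cos p.2 + Real.sin p.2 * Complex.I) := by
      ext p; exact Complex.polarCoord_symm_apply p
    rw [this]; fun_prop
  rw [h1, ← Complex.lintegral_comp_polarCoord_symm, polarCoord_target,
    Measure.volume_eq_prod, ← Measure.prod_restrict, lintegral_prod _ (by
      apply Measurable.aemeasurable
      simp only [smul_eq_mul]
      fun_prop)]
  have key : ∀ ρ ∈ Set.Ioo (0:ℝ) r, ENNReal.ofReal ρ * (‖G a‖ₑ * ENNReal.ofReal (2 * Real.pi)) ≤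
      ∫⁻ θ in Set.Ioo (-Real.pi) Real.pi, ENNReal.ofReal ρ •
        f (a + Complex.polarCoord.symm (ρ, θ)) := by
    intro ρ hρ
    simp only [smul_eq_mul]
    rw [lintegral_const_mul' _ _ ENNReal.ofReal_ne_top]
    gcongr
    refine (norm_le_lintegral_circle G a r ρ hρ.1 hρ.2 hG).trans (le_of_eq ?_)
    refine lintegral_congr fun θ => ?_
    have e : a + Complex.polarCoord.symm (ρ, θ) = circleMap a ρ θ := by
      rw [Complex.polarCoord_symm_apply, circleMap, Complex.exp_mul_I]
      push_cast; rfl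
    rw [e, hf, Set.indicator_of_mem]
    have := circleMap_mem_sphere a hρ.1.le θ
    rw [mem_ball, mem_sphere.1 this]; exact hρ.2
  calc ENNReal.ofReal (r ^ 2 * Real.pi) * ‖G a‖ₑ
      = ∫⁻ ρ in Set.Ioo (0:ℝ) r, ENNReal.ofReal ρ * (‖G a‖ₑ * ENNReal.ofReal (2 * Real.pi)) := by
        rw [lintegral_mul_const _ (by fun_prop)]
        have : ∫⁻ ρ in Set.Ioo (0:ℝ) r, ENNReal.ofReal ρ = ENNReal.ofReal (r ^ 2 / 2) := by
          rw [← ofReal_integral_eq_lintegral_ofReal]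
          · rw [← integral_Ioc_eq_integral_Ioo, ← intervalIntegral.integral_of_le hr.le]
            simp
          · exact (continuous_id.integrableOn_Icc).mono_set Set.Ioo_subset_Icc_self
          · filter_upwards [ae_restrict_mem measurableSet_Ioo] with x hx using hx.1.le
        rw [this, show r ^ 2 * Real.pi = (r^2/2) * (2 * Real.pi) by ring,
          ENNReal.ofReal_mul (by positivity)]
        ring
    _ ≤ ∫⁻ ρ in Set.Ioo (0:ℝ) r, ∫⁻ θ in Set.Ioo (-Real.pi) Real.pi, ENNReal.ofReal ρ •
        f (a + Complex.polarCoord.symm (ρ, θ)) :=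
        setLIntegral_mono' measurableSet_Ioo key
    _ ≤ _ := lintegral_mono_set Set.Ioo_subset_Ioi_self

variable (ω : BergmanWeight)

/-- The measure `dA_ω = ω dA` on the unit disc. -/
def measure : Measure ℂ :=
  (volume.restrict (ball (0 : ℂ) 1)).withDensity fun z => ENNReal.ofReal (ω.toFun z)

/-- The space `L²_ω = L²(𝔻, ω dA)`. -/
abbrev L2 : Type := Lp ℂ 2 ω.measure

theorem lintegral_measure (g : ℂ → ℝ≥0∞) :
    ∫⁻ z, g z ∂ω.measure = ∫⁻ z in ball (0 : ℂ) 1, ENNReal.ofReal (ω.toFun z) * g z := by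
  unfold measure
  rw [lintegral_withDensity_eq_lintegral_mul_non_measurable₀]
  · rfl
  · exact ω.integrable.aemeasurable.ennreal_ofReal
  · exact Eventually.of_forall fun _ => ENNReal.ofReal_lt_top

theorem exists_enorm_le (ρ : ℝ) (h1 : ρ < 1) : ∃ C : ℝ≥0, ∀ F : ℂ → ℂ,
    DifferentiableOn ℂ F (ball 0 1) → ∀ a ∈ closedBall (0 : ℂ) ρ,
      ‖F a‖ₑ ≤ C * eLpNorm F 2 ω.measure := by
  obtain ⟨c, hc, hcω⟩ := ω.bddBelow (closedBall 0 ((1 + ρ) / 2)) (isCompact_closedBall _ _)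
    (closedBall_subset_ball (by linarith))
  set r := (1 - ρ) / 2 with hr
  have hr0 : 0 < r := by linarith
  set m : ℝ := c * (r ^ 2 * Real.pi) with hm
  have hm0 : 0 < m := by positivity
  refine ⟨Real.toNNReal (√m)⁻¹, fun F hF a ha => ?_⟩
  have hsub : ball a r ⊆ closedBall (0 : ℂ) ((1 + ρ) / 2) := by
    refine ball_subset_closedBall.trans (closedBall_subset_closedBall' ?_)
    have := mem_closedBall.1 ha
    linarith
  have hsub1 : ball a r ⊆ ball (0 : ℂ) 1 := hsub.trans (closedBall_subset_ball (by linarith))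
  have k1 := norm_le_lintegral_ball (fun z => F z ^ 2) a r hr0 ((hF.mono hsub1).pow 2)
  have k2 : ENNReal.ofReal c * ∫⁻ z in ball a r, ‖F z ^ 2‖ₑ ≤ eLpNorm F 2 ω.measure ^ 2 := by
    have e : eLpNorm F 2 ω.measure ^ 2 = ∫⁻ z, ‖F z ^ 2‖ₑ ∂ω.measure := by
      have := eLpNorm_nnreal_pow_eq_lintegral (f := F) (μ := ω.measure) (p := 2) (by norm_num)
      simpa [enorm_pow] using this
    rw [e, lintegral_measure, ← lintegral_const_mul' _ _ ENNReal.ofReal_ne_top]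
    refine le_trans (setLIntegral_mono' measurableSet_ball fun z hz => ?_)
      (lintegral_mono_set hsub1)
    gcongr
    exact hcω z (hsub hz)
  have k3 : ENNReal.ofReal m * ‖F a‖ₑ ^ 2 ≤ eLpNorm F 2 ω.measure ^ 2 := by
    refine le_trans ?_ k2
    rw [hm, ENNReal.ofReal_mul hc.le, mul_assoc, ← enorm_pow]
    gcongr
  have k4 : ENNReal.ofReal √m * ‖F a‖ₑ ≤ eLpNorm F 2 ω.measure := by
    refine (ENNReal.pow_le_pow_left_iff two_ne_zero).1 (le_trans (le_of_eq ?_) k3)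
    rw [mul_pow, ← ENNReal.ofReal_pow (Real.sqrt_nonneg _), Real.sq_sqrt hm0.le]
  have hs : 0 < √m := Real.sqrt_pos.2 hm0
  have e2 : (Real.toNNReal (√m)⁻¹ : ℝ≥0∞) = (ENNReal.ofReal √m)⁻¹ :=
    ENNReal.ofReal_inv_of_pos hs
  rw [e2, mul_comm, ← div_eq_mul_inv, ENNReal.le_div_iff_mul_le]
  · rwa [mul_comm]
  · left; simpa using hs
  · left; exact ENNReal.ofReal_ne_top

theorem eqOn_of_ae_eq {F G : ℂ → ℂ} (hF : DifferentiableOn ℂ F (ball 0 1))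
    (hG : DifferentiableOn ℂ G (ball 0 1)) (h : F =ᵐ[ω.measure] G) :
    Set.EqOn F G (ball 0 1) := by
  intro a ha
  obtain ⟨C, hC⟩ := ω.exists_enorm_le ‖a‖ (by simpa using ha)
  have := hC (F - G) (hF.sub hG) a (by simp)
  have h0 : F - G =ᵐ[ω.measure] 0 := by
    filter_upwards [h] with z hz
    simp [hz]
  rw [eLpNorm_congr_ae h0, eLpNorm_zero, mul_zero] at this
  have h2 : (F - G) a = 0 := by simpa using this
  exact sub_eq_zero.1 h2

/-! ### The weighted Bergman space -/

/-- The weighted Bergman space `A²_ω`: the elements of `L²_ω` with a representative that is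
holomorphic on the unit disc. -/
def A2 : Submodule ℂ ω.L2 where
  carrier := {f | ∃ F : ℂ → ℂ, DifferentiableOn ℂ F (ball 0 1) ∧ f =ᵐ[ω.measure] F}
  zero_mem' := ⟨0, differentiableOn_const 0, Lp.coeFn_zero _ _ _⟩
  add_mem' := by
    rintro f g ⟨F, hF, hf⟩ ⟨G, hG, hg⟩
    exact ⟨F + G, hF.add hG, (Lp.coeFn_add f g).trans (hf.add hg)⟩
  smul_mem' := by
    rintro c f ⟨F, hF, hf⟩
    exact ⟨c • F, hF.const_smul c, (Lp.coeFn_smul c f).trans (hf.const_smul c)⟩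

/-- The holomorphic representative of an element of `A²_ω` (unique on the disc). -/
def rep (f : ω.A2) : ℂ → ℂ := f.2.choose

theorem rep_differentiableOn (f : ω.A2) : DifferentiableOn ℂ (ω.rep f) (ball 0 1) :=
  f.2.choose_spec.1

theorem coe_ae_eq_rep (f : ω.A2) : (f : ω.L2) =ᵐ[ω.measure] ω.rep f :=
  f.2.choose_spec.2

theorem rep_eqOn (f : ω.A2) {F : ℂ → ℂ} (hF : DifferentiableOn ℂ F (ball 0 1))
    (h : (f : ω.L2) =ᵐ[ω.measure] F) : Set.EqOn (ω.rep f) F (ball 0 1) :=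
  ω.eqOn_of_ae_eq (ω.rep_differentiableOn f) hF ((ω.coe_ae_eq_rep f).symm.trans h)

theorem exists_norm_rep_le (ρ : ℝ) (h1 : ρ < 1) : ∃ C : ℝ, 0 ≤ C ∧ ∀ f : ω.A2,
    ∀ a ∈ closedBall (0 : ℂ) ρ, ‖ω.rep f a‖ ≤ C * ‖f‖ := by
  obtain ⟨C, hC⟩ := ω.exists_enorm_le ρ h1
  refine ⟨C, C.2, fun f a ha => ?_⟩
  have h := hC _ (ω.rep_differentiableOn f) a ha
  rw [← eLpNorm_congr_ae (ω.coe_ae_eq_rep f), ← Lp.enorm_def] at h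
  have := ENNReal.toReal_mono (by finiteness) h
  simpa using this

theorem mem_ball_coe (z : 𝔻) : (z : ℂ) ∈ ball (0 : ℂ) 1 := mem_ball_zero_iff.2 z.norm_lt_one

/-- Evaluation at a point of the disc, as a continuous linear functional on `A²_ω`. -/
def evalCLM (z : 𝔻) : ω.A2 →L[ℂ] ℂ :=
  LinearMap.mkContinuousOfExistsBound
    { toFun := fun f => ω.rep f z
      map_add' := fun f g => ω.rep_eqOn (f + g)
        ((ω.rep_differentiableOn f).add (ω.rep_differentiableOn g))
        ((Lp.coeFn_add (f : ω.L2) (g : ω.L2)).trans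
          ((ω.coe_ae_eq_rep f).add (ω.coe_ae_eq_rep g))) (mem_ball_coe z)
      map_smul' := fun c f => ω.rep_eqOn (c • f)
        ((ω.rep_differentiableOn f).const_smul c)
        ((Lp.coeFn_smul c (f : ω.L2)).trans
          ((ω.coe_ae_eq_rep f).const_smul c)) (mem_ball_coe z) }
    (by
      obtain ⟨C, -, hC⟩ := ω.exists_norm_rep_le ‖(z : ℂ)‖ z.norm_lt_one
      exact ⟨C, fun f => hC f z (by simp)⟩)

theorem evalCLM_apply (z : 𝔻) (f : ω.A2) : ω.evalCLM z f = ω.rep f z := rfl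

theorem isClosed_A2 : IsClosed (ω.A2 : Set ω.L2) := by
  rw [← isSeqClosed_iff_isClosed]
  intro f g hf hg
  set u : ℕ → ω.A2 := fun n => ⟨f n, hf n⟩ with hu
  have hcau : CauchySeq u := by
    have := hg.cauchySeq
    rw [Metric.cauchySeq_iff] at this ⊢
    exact this
  have hU : ∀ ρ : ℝ, ρ < 1 →
      UniformCauchySeqOn (fun n => ω.rep (u n)) atTop (closedBall (0 : ℂ) ρ) := by
    intro ρ h1
    obtain ⟨C, hC0, hC⟩ := ω.exists_norm_rep_le ρ h1
    rw [Metric.uniformCauchySeqOn_iff]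
    intro ε hε
    obtain ⟨N, hN⟩ := Metric.cauchySeq_iff.1 hcau (ε / (C + 1)) (by positivity)
    refine ⟨N, fun m hm n hn a ha => ?_⟩
    have h2 : ω.rep (u m) a - ω.rep (u n) a = ω.rep (u m - u n) a := by
      have ha1 : ‖a‖ < 1 := lt_of_le_of_lt (by simpa using ha) h1
      exact (map_sub (ω.evalCLM (Complex.UnitDisc.mk a ha1)) (u m) (u n)).symm
    rw [dist_eq_norm, h2]
    have h3 := hN m hm n hn
    rw [dist_eq_norm, lt_div_iff₀ (by positivity)] at h3
    have h4 := hC (u m - u n) a ha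
    nlinarith [norm_nonneg (u m - u n)]
  have hlim : ∀ a ∈ ball (0 : ℂ) 1, ∃ l, Tendsto (fun n => ω.rep (u n) a) atTop (𝓝 l) := by
    intro a ha
    exact cauchySeq_tendsto_of_complete
      ((hU ‖a‖ (by simpa using ha)).cauchySeq (by simp))
  choose! F hF using hlim
  have hloc : TendstoLocallyUniformlyOn (fun n => ω.rep (u n)) F atTop (ball 0 1) := by
    rw [tendstoLocallyUniformlyOn_iff_forall_isCompact isOpen_ball]
    intro S hS hSc
    obtain ⟨ρ, hρ, hSρ⟩ : ∃ ρ ∈ Set.Ico (0 : ℝ) 1, S ⊆ closedBall (0 : ℂ) ρ := by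
      rcases S.eq_empty_or_nonempty with rfl | hne
      · exact ⟨0, by simp, by simp⟩
      · obtain ⟨x, hx, hmax⟩ := hSc.exists_isMaxOn hne continuous_norm.continuousOn
        exact ⟨‖x‖, ⟨norm_nonneg _, by simpa using hS hx⟩, fun y hy => by simpa using hmax hy⟩
    exact ((hU ρ hρ.2).tendstoUniformlyOn_of_tendsto fun a ha =>
      hF a (closedBall_subset_ball hρ.2 ha)).mono hSρ
  refine ⟨F, hloc.differentiableOn
    (Eventually.of_forall fun n => ω.rep_differentiableOn (u n)) isOpen_ball, ?_⟩
  obtain ⟨ns, hns, hae⟩ := (tendstoInMeasure_of_tendsto_Lp hg).exists_seq_tendsto_ae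
  have hall : ∀ᵐ z ∂ω.measure, ∀ n, f n z = ω.rep (u n) z :=
    ae_all_iff.2 fun n => ω.coe_ae_eq_rep (u n)
  have hdisc : ∀ᵐ z ∂ω.measure, z ∈ ball (0 : ℂ) 1 :=
    (withDensity_absolutelyContinuous _ _).ae_le (ae_restrict_mem measurableSet_ball)
  filter_upwards [hae, hall, hdisc] with z h1 h2 h3
  refine tendsto_nhds_unique h1 ?_
  simp only [h2]
  exact (hF z h3).comp hns.tendsto_atTop

instance : CompleteSpace ω.A2 := ω.isClosed_A2.completeSpace_coe

/-- `A²_ω` is a reproducing kernel Hilbert space of functions on the unit disc: an element is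
evaluated through its holomorphic representative. -/
instance : RKHS ℂ ω.A2 𝔻 ℂ where
  coeCLM := ContinuousLinearMap.pi ω.evalCLM
  coeCLM_injective := by
    intro f g h
    have h1 : ∀ z : 𝔻, ω.rep f z = ω.rep g z := fun z => congrFun h z
    have hdisc : ∀ᵐ z ∂ω.measure, z ∈ ball (0 : ℂ) 1 :=
      (withDensity_absolutelyContinuous _ _).ae_le (ae_restrict_mem measurableSet_ball)
    refine Subtype.ext (Lp.ext ?_)
    filter_upwards [ω.coe_ae_eq_rep f, ω.coe_ae_eq_rep g, hdisc] with z hf hg hz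
    rw [hf, hg]
    exact h1 (Complex.UnitDisc.mk z (by simpa using hz))

/-- The reproducing kernel function `K_z ∈ A²_ω`, so that `f z = ⟪K_z, f⟫` for `f ∈ A²_ω`. The
value `K(ζ, z)` of the reproducing kernel is `ω.kernelFun z ζ`. -/
def kernelFun (z : 𝔻) : ω.A2 := RKHS.kerFun ω.A2 z 1

/-- `τ_ω(z) = 1 / (ω(z)^{1/2} ‖K_z‖)`. -/
def tau (z : 𝔻) : ℝ := 1 / (√(ω.toFun z) * ‖ω.kernelFun z‖)

/-- The filter `|z| → 1⁻` on the unit disc. -/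
def toBoundary : Filter 𝔻 := comap (fun z : 𝔻 => ‖(z : ℂ)‖) (𝓝 1)

/-! ### The classes of weights -/

/-- The class `𝓦` of weights. -/
structure ClassW : Prop where
  tendsto_norm_kernel : Tendsto (fun z : 𝔻 => ‖ω.kernelFun z‖) toBoundary atTop
  kernel_isLittleO : ∀ ζ : 𝔻,
    (fun z : 𝔻 => ω.kernelFun z ζ) =o[toBoundary] fun z : 𝔻 => ‖ω.kernelFun z‖
  tau_le : ∃ C : ℝ, ∀ z : 𝔻, ω.tau z ≤ C * (1 - ‖(z : ℂ)‖)
  local_comparison : ∃ η > (0 : ℝ), ∃ C : ℝ, ∀ z ζ : 𝔻, ‖(z : ℂ) - ζ‖ ≤ η * ω.tau z →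
    ω.tau z ≤ C * ω.tau ζ ∧ ω.tau ζ ≤ C * ω.tau z ∧
      ‖ω.kernelFun z‖ * ‖ω.kernelFun ζ‖ ≤ C * ‖ω.kernelFun z ζ‖

/-- The Laplacian `∂∂̄`, a quarter of the usual Laplacian `∂²/∂x² + ∂²/∂y²`. -/
def ddbar (ψ : ℂ → ℝ) (z : ℂ) : ℝ := (1 / 4) * Laplacian.laplacian ψ z

/-- The Wirtinger derivative `∂ψ = (1/2) (∂ψ/∂x - i ∂ψ/∂y)` of a real valued function. -/
def wirtinger (ψ : ℂ → ℝ) (z : ℂ) : ℂ :=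
  (1 / 2) * ((fderiv ℝ ψ z 1 : ℂ) - Complex.I * (fderiv ℝ ψ z Complex.I : ℂ))

/-- The potential `φ` of the weight `ω = e^{-φ}`. -/
def potential (z : ℂ) : ℝ := -Real.log (ω.toFun z)

/-- First alternative: `τ_ω² Δφ` is bounded below by a positive constant. -/
def LaplacianBound : Prop :=
  ∃ c > (0 : ℝ), ∀ z : 𝔻, c ≤ ω.tau z ^ 2 * ddbar ω.potential z

/-- Second alternative: there are a subharmonic `ψ : 𝔻 → ℝ⁺` of class `C²` (so subharmonic means
`Δψ ≥ 0`) and constants `δ > 0`, `t ∈ (-1, 0)` with `τ_ω² Δψ ≥ δ`, `Δφ ≥ t Δψ` and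
`|∂ψ|² ≤ Δψ` on the disc. -/
def AuxiliarySubharmonic : Prop :=
  ∃ ψ : ℂ → ℝ, ContDiffOn ℝ 2 ψ (ball 0 1) ∧ (∀ z : 𝔻, 0 ≤ ψ z) ∧ (∀ z : 𝔻, 0 ≤ ddbar ψ z) ∧
    ∃ δ > (0 : ℝ), ∃ t ∈ Set.Ioo (-1 : ℝ) 0, ∀ z : 𝔻,
      δ ≤ ω.tau z ^ 2 * ddbar ψ z ∧ t * ddbar ψ z ≤ ddbar ω.potential z ∧
        ‖wirtinger ψ z‖ ^ 2 ≤ ddbar ψ z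

/-- The class `𝓦*` of weights. -/
structure ClassWStar : Prop extends ω.ClassW where
  contDiffOn_potential : ContDiffOn ℝ 2 ω.potential (ball 0 1)
  laplacian_condition : ω.LaplacianBound ∨ ω.AuxiliarySubharmonic

/-! ### Hankel operators with anti-analytic symbol -/

/-- The elements `f` of `A²_ω` with `φ̄ f ∈ L²_ω`. -/
def mulDomain (φ : ℂ → ℂ) : Submodule ℂ ω.A2 where
  carrier := {f | MemLp (fun z => conj (φ z) * (f : ω.L2) z) 2 ω.measure}
  zero_mem' := by
    refine (MemLp.zero (ε := ℂ)).ae_eq (p := 2) (μ := ω.measure) ?_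
    filter_upwards [Lp.coeFn_zero ℂ 2 ω.measure] with z hz
    rw [Submodule.coe_zero, hz]
    exact (mul_zero _).symm
  add_mem' := by
    intro f g hf hg
    refine (MemLp.add hf hg).ae_eq ?_
    filter_upwards [Lp.coeFn_add (f : ω.L2) (g : ω.L2)] with z hz
    simp only [Pi.add_apply, Submodule.coe_add, hz]
    ring
  smul_mem' := by
    intro c f hf
    refine (MemLp.const_smul hf c).ae_eq ?_
    filter_upwards [Lp.coeFn_smul c (f : ω.L2)] with z hz
    simp only [Pi.smul_apply, Submodule.coe_smul, hz, smul_eq_mul]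
    ring

theorem memLp_of_mem {ω : BergmanWeight} {φ : ℂ → ℂ} {f : ω.A2} (hf : f ∈ ω.mulDomain φ) :
    MemLp (fun z => conj (φ z) * (f : ω.L2) z) 2 ω.measure := hf

/-- Multiplication by `φ̄`, as a linear map from `{f ∈ A²_ω | φ̄ f ∈ L²_ω}` to `L²_ω`. -/
def mulConj (φ : ℂ → ℂ) : ω.mulDomain φ →ₗ[ℂ] ω.L2 where
  toFun f := (memLp_of_mem f.2).toLp
  map_add' f g := by
    refine Eq.trans ?_ (MemLp.toLp_add (memLp_of_mem f.2) (memLp_of_mem g.2))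
    refine MemLp.toLp_congr _ _ ?_
    filter_upwards [Lp.coeFn_add ((f : ω.A2) : ω.L2) ((g : ω.A2) : ω.L2)] with z hz
    simp only [Pi.add_apply, Submodule.coe_add, hz]
    ring
  map_smul' c f := by
    refine Eq.trans ?_ (MemLp.toLp_const_smul c (memLp_of_mem f.2))
    refine MemLp.toLp_congr _ _ ?_
    filter_upwards [Lp.coeFn_smul c ((f : ω.A2) : ω.L2)] with z hz
    simp only [Pi.smul_apply, Submodule.coe_smul, hz, smul_eq_mul]
    ring

/-- The finite linear combinations of the kernel functions, a dense subspace of `A²_ω`. -/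
def kernelSpan : Submodule ℂ ω.A2 := Submodule.span ℂ (Set.range ω.kernelFun)

/-- The symbol `φ̄` is admissible: `φ̄ K_z ∈ L²_ω` for all `z ∈ 𝔻`. This is what the definition of
the Hankel operator on `kernelSpan` requires. -/
def Admissible (φ : ℂ → ℂ) : Prop := ∀ z : 𝔻, ω.kernelFun z ∈ ω.mulDomain φ

theorem Admissible.kernelSpan_le {ω : BergmanWeight} {φ : ℂ → ℂ} (h : ω.Admissible φ) :
    ω.kernelSpan ≤ ω.mulDomain φ :=
  Submodule.span_le.2 (by rintro _ ⟨z, rfl⟩; exact h z)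

/-- The Hankel operator `H_{φ̄} f = φ̄ f - P_ω (φ̄ f)`, densely defined on `A²_ω` with domain
`kernelSpan`, where `P_ω` is the orthogonal projection of `L²_ω` onto `A²_ω`. -/
def hankel (φ : ℂ → ℂ) (h : ω.Admissible φ) : ω.A2 →ₗ.[ℂ] ω.L2 where
  domain := ω.kernelSpan
  toFun := (LinearMap.id - (ω.A2.starProjection : ω.L2 →ₗ[ℂ] ω.L2)) ∘ₗ ω.mulConj φ ∘ₗ
    Submodule.inclusion h.kernelSpan_le

/-- The Hankel operator `H_{φ̄}` is (well defined and) compact on `A²_ω`: it extends to a compact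
operator from `A²_ω` to `L²_ω`. -/
def HankelCompact (φ : ℂ → ℂ) : Prop :=
  ∃ h : ω.Admissible φ, ∃ T : ω.A2 →L[ℂ] ω.L2, IsCompactOperator T ∧
    ∀ f : (ω.hankel φ h).domain, T f = ω.hankel φ h f

/-- The little Bloch type space `𝓑^ω_0`: analytic functions on the disc with
`τ_ω(z) |φ'(z)| → 0` as `|z| → 1⁻`. -/
def LittleBloch : Set (ℂ → ℂ) :=
  {φ | DifferentiableOn ℂ φ (ball 0 1) ∧
    Tendsto (fun z : 𝔻 => ω.tau z * ‖deriv φ z‖) toBoundary (𝓝 0)}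

end BergmanWeight

end

/-! Let `p = -log ω` be the potential, and let `D α = -∂α + α ∂p` (`dstar`) be the formal adjoint of
`∂̄` in `L²_ω`. Both implications use that `u = H_{φ̄} f` is the component of `φ̄ f` orthogonal to
`A²_ω`, that is, the minimal solution of `∂̄u = conj(φ') f`.

Sufficiency is an `L²` estimate of Hörmander type. The Bochner–Kodaira identity, twisted by `e^ψ`
under the second alternative of `𝓦*`, gives `∫ M |α|² ω ≤ A ∫ |D α|² ω` for test functions, where
`M` is `Δp` or `Δψ` and `M ≥ δ τ_ω⁻²` (`exists_apriori`). By Weyl's lemma the functions `D α` are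
dense in the orthogonal complement of `A²_ω` (`orthogonal_A2_le`), so duality yields `‖H_{φ̄} f‖² ≤
A ∫ (|φ'|²/M) |f|² ω` (`norm_sub_starProjection_sq_le`). The factor `|φ'|²/M` is at most a constant
times `(τ_ω |φ'|)²`, so it is small near the circle. On a compact disc `f` is controlled by its
values on a finite net (`exists_integral_le`). Hence `H_{φ̄}` is small on functions vanishing on
that net, so it is a norm limit of finite rank operators (`isCompactOperator_of_norm_sq_le`).

The duality estimate presupposes `φ̄ K_z ∈ L²_ω`, which needs its own argument. The kernel `K_z` is
the projection of a bounded `g` with compact support, and `g - P_ω g` is estimated in `L²` with the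
extra weight `w²`, where `w` runs through bounded weights increasing to `1 + σ|φ|²`. Such weights
vary slowly with respect to `M` once `σ` is small, so `1 - P_ω` is bounded on the weighted spaces
uniformly in the truncation (`integral_weight_sub_starProjection_le`); Fatou's lemma removes the
truncation.

Necessity tests the operator on normalized kernels `k_z = K_z/‖K_z‖`. By condition 1 they tend
weakly to zero at the boundary, so a compact extension sends them to zero in norm. On a disc of
radius comparable to `τ_ω(z)`, condition 3 makes `K_z` zero-free and bounds `ω |K_z|²` below by a
multiple of `‖K_z‖² τ_ω(z)⁻²`. There `φ̄ K_z - h = K_z (φ̄ - h/K_z)` for the holomorphic `h = P_ω(φ̄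
K_z)`, and the distance from `φ̄` to holomorphic functions on a disc of radius `r` is at least a
multiple of `r² |φ'(z)|` (`norm_deriv_sq_mul_le_integral`). Thus `τ_ω(z) |φ'(z)|` is at most a
constant times `‖H_{φ̄} k_z‖` (`exists_tau_sq_mul_le`). -/

namespace BergmanWeight

/-! ### Wirtinger calculus -/

/-- The Wirtinger derivative `∂F = (∂F/∂x - i ∂F/∂y) / 2` of a complex valued function. -/
noncomputable def dz (F : ℂ → ℂ) (z : ℂ) : ℂ :=
  (1 / 2) * (fderiv ℝ F z 1 - Complex.I * fderiv ℝ F z Complex.I)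

/-- The Wirtinger derivative `∂̄F = (∂F/∂x + i ∂F/∂y) / 2` of a complex valued function. -/
noncomputable def dzb (F : ℂ → ℂ) (z : ℂ) : ℂ :=
  (1 / 2) * (fderiv ℝ F z 1 + Complex.I * fderiv ℝ F z Complex.I)

theorem dz_congr {F G : ℂ → ℂ} {z : ℂ} (h : F =ᶠ[𝓝 z] G) : dz F z = dz G z := by
  simp only [dz, h.fderiv_eq]

theorem dz_mul {F G : ℂ → ℂ} {z : ℂ} (hF : DifferentiableAt ℝ F z) (hG : DifferentiableAt ℝ G z) :
    dz (fun w => F w * G w) z = dz F z * G z + F z * dz G z := by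
  have : fderiv ℝ (fun w => F w * G w) z = F z • fderiv ℝ G z + G z • fderiv ℝ F z :=
    (hF.hasFDerivAt.mul hG.hasFDerivAt).fderiv
  simp only [dz, this, add_apply, smul_apply, smul_eq_mul]
  ring

theorem dzb_mul {F G : ℂ → ℂ} {z : ℂ} (hF : DifferentiableAt ℝ F z)
    (hG : DifferentiableAt ℝ G z) :
    dzb (fun w => F w * G w) z = dzb F z * G z + F z * dzb G z := by
  have : fderiv ℝ (fun w => F w * G w) z = F z • fderiv ℝ G z + G z • fderiv ℝ F z :=
    (hF.hasFDerivAt.mul hG.hasFDerivAt).fderiv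
  simp only [dzb, this, add_apply, smul_apply, smul_eq_mul]
  ring

theorem dz_add {F G : ℂ → ℂ} {z : ℂ} (hF : DifferentiableAt ℝ F z) (hG : DifferentiableAt ℝ G z) :
    dz (fun w => F w + G w) z = dz F z + dz G z := by
  simp only [dz, fderiv_fun_add hF hG, add_apply]
  ring

theorem dzb_add {F G : ℂ → ℂ} {z : ℂ} (hF : DifferentiableAt ℝ F z)
    (hG : DifferentiableAt ℝ G z) :
    dzb (fun w => F w + G w) z = dzb F z + dzb G z := by
  simp only [dzb, fderiv_fun_add hF hG, add_apply]
  ring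

theorem dzb_neg {F : ℂ → ℂ} {z : ℂ} : dzb (fun w => -F w) z = -dzb F z := by
  simp only [dzb, fderiv_fun_neg, neg_apply]
  ring

theorem fderiv_conj (F : ℂ → ℂ) (z v : ℂ) :
    fderiv ℝ (fun w => conj (F w)) z v = conj (fderiv ℝ F z v) := by
  have := Complex.conjCLE.comp_fderiv (f := F) (x := z)
  have h2 : (Complex.conjCLE ∘ F) = fun w => conj (F w) := rfl
  rw [h2] at this
  rw [this]; rfl

theorem dz_conj (F : ℂ → ℂ) (z : ℂ) : dz (fun w => conj (F w)) z = conj (dzb F z) := by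
  simp only [dz, dzb, fderiv_conj, map_mul, map_add, map_one, map_div₀, Complex.conj_I,
    map_ofNat]
  ring

theorem dz_holomorphic {F : ℂ → ℂ} {z : ℂ} (hF : DifferentiableAt ℂ F z) : dz F z = deriv F z := by
  have h := (hF.hasFDerivAt.restrictScalars ℝ).fderiv
  have h1 : fderiv ℂ F z Complex.I = Complex.I * fderiv ℂ F z 1 := by
    rw [← smul_eq_mul, ← map_smul]; simp
  simp only [dz, h, ContinuousLinearMap.coe_restrictScalars', h1]
  rw [← mul_assoc, Complex.I_mul_I, fderiv_apply_one_eq_deriv]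
  ring

theorem dzb_holomorphic {F : ℂ → ℂ} {z : ℂ} (hF : DifferentiableAt ℂ F z) : dzb F z = 0 := by
  have h := (hF.hasFDerivAt.restrictScalars ℝ).fderiv
  have h1 : fderiv ℂ F z Complex.I = Complex.I * fderiv ℂ F z 1 := by
    rw [← smul_eq_mul, ← map_smul]; simp
  simp only [dzb, h, ContinuousLinearMap.coe_restrictScalars', h1]
  rw [← mul_assoc, Complex.I_mul_I]
  ring

theorem fderiv_ofReal {p : ℂ → ℝ} {z : ℂ} (hp : DifferentiableAt ℝ p z) (v : ℂ) :
    fderiv ℝ (fun w => (p w : ℂ)) z v = (fderiv ℝ p z v : ℂ) := by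
  have : HasFDerivAt (fun w => (p w : ℂ)) (Complex.ofRealCLM.comp (fderiv ℝ p z)) z :=
    Complex.ofRealCLM.hasFDerivAt.comp z hp.hasFDerivAt
  rw [this.fderiv]; rfl

theorem dz_ofReal {p : ℂ → ℝ} {z : ℂ} (hp : DifferentiableAt ℝ p z) :
    dz (fun w => (p w : ℂ)) z = wirtinger p z := by
  simp only [dz, wirtinger, fderiv_ofReal hp]

theorem dz_ofReal_exp {p : ℂ → ℝ} {z : ℂ} (hp : DifferentiableAt ℝ p z) :
    dz (fun w => (Real.exp (p w) : ℂ)) z = Real.exp (p z) * dz (fun w => (p w : ℂ)) z := by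
  have h : HasFDerivAt (fun w => Real.exp (p w)) (Real.exp (p z) • fderiv ℝ p z) z :=
    hp.hasFDerivAt.exp
  rw [dz_ofReal h.differentiableAt, dz_ofReal hp]
  simp only [wirtinger, h.fderiv, smul_apply, smul_eq_mul]
  push_cast
  ring

theorem dz_ofReal_neg {p : ℂ → ℝ} {z : ℂ} :
    dz (fun w => ((-p w : ℝ) : ℂ)) z = -dz (fun w => (p w : ℂ)) z := by
  simp only [dz, Complex.ofReal_neg, fderiv_fun_neg, neg_apply]
  ring

/-! ### Second order Wirtinger derivatives and the operator `∂∂̄`. -/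

theorem contDiffAt_dz {F : ℂ → ℂ} {z : ℂ} (hF : ContDiffAt ℝ 2 F z) : ContDiffAt ℝ 1 (dz F) z := by
  have h : ContDiffAt ℝ 1 (fderiv ℝ F) z := hF.fderiv_right (by norm_num)
  unfold dz
  fun_prop

theorem contDiffAt_dzb {F : ℂ → ℂ} {z : ℂ} (hF : ContDiffAt ℝ 2 F z) :
    ContDiffAt ℝ 1 (dzb F) z := by
  have h : ContDiffAt ℝ 1 (fderiv ℝ F) z := hF.fderiv_right (by norm_num)
  unfold dzb
  fun_prop

theorem fderiv_fderiv_apply {V : Type*} [NormedAddCommGroup V] [NormedSpace ℝ V]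
    {F : ℂ → V} {z : ℂ} (hF : ContDiffAt ℝ 2 F z) (u v : ℂ) :
    fderiv ℝ (fun w => fderiv ℝ F w v) z u = fderiv ℝ (fderiv ℝ F) z u v := by
  have h : DifferentiableAt ℝ (fderiv ℝ F) z :=
    (hF.fderiv_right (m := 1) (by norm_num)).differentiableAt (by norm_num)
  have := (h.hasFDerivAt.clm_apply (hasFDerivAt_const v z)).fderiv
  rw [this]; simp

/-- Symmetry of the second derivative cancels the mixed terms. Since `dz_dzb` has the same
right-hand side, `∂` and `∂̄` commute on `C²` functions; this leaves `ddbar p` as the only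
commutator term in the Bochner–Kodaira computation. -/
theorem dzb_dz {F : ℂ → ℂ} {z : ℂ} (hF : ContDiffAt ℝ 2 F z) :
    dzb (dz F) z = (1 / 4) * (fderiv ℝ (fderiv ℝ F) z 1 1 +
      fderiv ℝ (fderiv ℝ F) z Complex.I Complex.I) := by
  have h : DifferentiableAt ℝ (fderiv ℝ F) z :=
    (hF.fderiv_right (m := 1) (by norm_num)).differentiableAt (by norm_num)
  have hs := (hF.isSymmSndFDerivAt (by simp)).eq 1 Complex.I
  have h1 : DifferentiableAt ℝ (fun w => fderiv ℝ F w 1) z := by fun_prop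
  have h2 : DifferentiableAt ℝ (fun w => fderiv ℝ F w Complex.I) z := by fun_prop
  have e : ∀ u, fderiv ℝ (dz F) z u = (1 / 2) * (fderiv ℝ (fderiv ℝ F) z u 1 -
      Complex.I * fderiv ℝ (fderiv ℝ F) z u Complex.I) := by
    intro u
    unfold dz
    rw [fderiv_const_mul (by fun_prop), fderiv_fun_sub h1 (by fun_prop), fderiv_const_mul h2]
    simp only [smul_apply, sub_apply, smul_eq_mul, fderiv_fderiv_apply hF]
  simp only [dzb, e]
  linear_combination (-Complex.I / 4) * hs - (1/4) *
    (fderiv ℝ (fderiv ℝ F) z Complex.I Complex.I) * Complex.I_mul_I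

theorem dz_dzb {F : ℂ → ℂ} {z : ℂ} (hF : ContDiffAt ℝ 2 F z) :
    dz (dzb F) z = (1 / 4) * (fderiv ℝ (fderiv ℝ F) z 1 1 +
      fderiv ℝ (fderiv ℝ F) z Complex.I Complex.I) := by
  have h : DifferentiableAt ℝ (fderiv ℝ F) z :=
    (hF.fderiv_right (m := 1) (by norm_num)).differentiableAt (by norm_num)
  have hs := (hF.isSymmSndFDerivAt (by simp)).eq 1 Complex.I
  have h1 : DifferentiableAt ℝ (fun w => fderiv ℝ F w 1) z := by fun_prop
  have h2 : DifferentiableAt ℝ (fun w => fderiv ℝ F w Complex.I) z := by fun_prop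
  have e : ∀ u, fderiv ℝ (dzb F) z u = (1 / 2) * (fderiv ℝ (fderiv ℝ F) z u 1 +
      Complex.I * fderiv ℝ (fderiv ℝ F) z u Complex.I) := by
    intro u
    unfold dzb
    rw [fderiv_const_mul (by fun_prop), fderiv_fun_add h1 (by fun_prop), fderiv_const_mul h2]
    simp only [smul_apply, add_apply, smul_eq_mul, fderiv_fderiv_apply hF]
  simp only [dz, e]
  linear_combination (Complex.I / 4) * hs - (1/4) *
    (fderiv ℝ (fderiv ℝ F) z Complex.I Complex.I) * Complex.I_mul_I

theorem ddbar_eq (p : ℂ → ℝ) (z : ℂ) : ddbar p z = (1 / 4) * (fderiv ℝ (fderiv ℝ p) z 1 1 +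
    fderiv ℝ (fderiv ℝ p) z Complex.I Complex.I) := by
  unfold ddbar
  rw [InnerProductSpace.laplacian_eq_iteratedFDeriv_complexPlane]
  simp [iteratedFDeriv_two_apply]

theorem dzb_dz_ofReal {p : ℂ → ℝ} {z : ℂ} (hp : ContDiffAt ℝ 2 p z) :
    dzb (dz fun w => (p w : ℂ)) z = ddbar p z := by
  have hP : ContDiffAt ℝ 2 (fun w => (p w : ℂ)) z :=
    Complex.ofRealCLM.contDiff.contDiffAt.comp z hp
  have h : DifferentiableAt ℝ (fderiv ℝ p) z :=
    (hp.fderiv_right (m := 1) (by norm_num)).differentiableAt (by norm_num)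
  have e : ∀ u v, fderiv ℝ (fderiv ℝ fun w => (p w : ℂ)) z u v =
      (fderiv ℝ (fderiv ℝ p) z u v : ℂ) := by
    intro u v
    rw [← fderiv_fderiv_apply hP]
    have hev : (fun w => fderiv ℝ (fun w => (p w : ℂ)) w v) =ᶠ[𝓝 z]
        fun w => ((fderiv ℝ p w v : ℝ) : ℂ) := by
      filter_upwards [hp.eventually (by simp)] with w hw
      exact fderiv_ofReal (hw.differentiableAt (by norm_num)) v
    have h1 : DifferentiableAt ℝ (fun w => fderiv ℝ p w v) z := by fun_prop
    rw [hev.fderiv_eq, fderiv_ofReal h1, fderiv_fderiv_apply hp]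
  rw [dzb_dz hP, ddbar_eq, e, e]
  push_cast; ring

theorem continuousAt_ddbar {p : ℂ → ℝ} {z : ℂ} (hp : ContDiffAt ℝ 2 p z) :
    ContinuousAt (ddbar p) z := by
  have h : ContDiffAt ℝ 1 (fderiv ℝ p) z := hp.fderiv_right (by norm_num)
  have h2 : ContDiffAt ℝ 0 (fderiv ℝ (fderiv ℝ p)) z := h.fderiv_right (by norm_num)
  have h3 := h2.continuousAt
  have : ddbar p = fun z => (1 / 4) * (fderiv ℝ (fderiv ℝ p) z 1 1 +
    fderiv ℝ (fderiv ℝ p) z Complex.I Complex.I) := funext (ddbar_eq p)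
  rw [this]
  fun_prop

/-- Every directional derivative of a compactly supported `C¹` function has integral zero, by
integration by parts against the constant `1`. All later integrations by parts reduce to this
divergence form. -/
theorem integral_dz_eq_zero {F : ℂ → ℂ} (hF : ContDiff ℝ 1 F) (hc : HasCompactSupport F) :
    ∫ z, dz F z = 0 := by
  have hd : Differentiable ℝ F := hF.differentiable (by norm_num)
  have hcont : ∀ v, Continuous fun z => fderiv ℝ F z v := fun v =>
    (hF.continuous_fderiv (by norm_num)).clm_apply continuous_const
  have hint : ∀ v, Integrable fun z => fderiv ℝ F z v := fun v =>
    (hcont v).integrable_of_hasCompactSupport (hc.fderiv_apply ℝ v)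
  have key : ∀ v, ∫ z, fderiv ℝ F z v = 0 := by
    intro v
    have := integral_mul_fderiv_eq_neg_fderiv_mul_of_integrable (μ := (volume : Measure ℂ))
      (f := fun _ : ℂ => (1 : ℂ)) (g := F) (v := v) (by simp) (by simpa using hint v)
      (by simpa using hF.continuous.integrable_of_hasCompactSupport hc)
      (fun x _ => differentiableAt_const _) (fun x _ => hd x)
    simpa using this
  unfold dz
  rw [integral_const_mul, integral_sub (hint 1) ((hint _).const_mul _), integral_const_mul,
    key, key]
  simp

/-- The Bochner–Kodaira–Hörmander inequality in the plane. -/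
theorem integral_ddbar_mul_le {p : ℂ → ℝ} {α : ℂ → ℂ} (hp : ContDiff ℝ 2 p) (hα : ContDiff ℝ 2 α)
    (hc : HasCompactSupport α) :
    ∫ z, Real.exp (-p z) * (ddbar p z * ‖α z‖ ^ 2) ≤
      ∫ z, Real.exp (-p z) * ‖-dz α z + α z * dz (fun w => (p w : ℂ)) z‖ ^ 2 := by
  set P : ℂ → ℂ := fun w => (p w : ℂ) with hPdef
  set E : ℂ → ℂ := fun w => ((Real.exp (-p w) : ℝ) : ℂ) with hEdef
  have hP : ContDiff ℝ 2 P := Complex.ofRealCLM.contDiff.comp hp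
  have hE : ContDiff ℝ 2 E := Complex.ofRealCLM.contDiff.comp (Real.contDiff_exp.comp hp.neg)
  have hconj : ContDiff ℝ 2 (fun z : ℂ => conj z) := Complex.conjCLE.contDiff
  have hdα : ContDiff ℝ 1 (dz α) := contDiff_iff_contDiffAt.2 fun z => contDiffAt_dz hα.contDiffAt
  have hb : ContDiff ℝ 1 (dzb α) := contDiff_iff_contDiffAt.2 fun z => contDiffAt_dzb hα.contDiffAt
  have hdP : ContDiff ℝ 1 (dz P) := contDiff_iff_contDiffAt.2 fun z => contDiffAt_dz hP.contDiffAt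
  have hα1 : ContDiff ℝ 1 α := hα.of_le (by norm_num)
  have hE1 : ContDiff ℝ 1 E := hE.of_le (by norm_num)
  have hconj1 : ContDiff ℝ 1 (fun z : ℂ => conj z) := hconj.of_le (by norm_num)
  set a : ℂ → ℂ := fun z => -dz α z + α z * dz P z with ha
  have haC : ContDiff ℝ 1 a := hdα.neg.add (hα1.mul hdP)
  have hac : HasCompactSupport a := by
    have h1 : HasCompactSupport (dz α) := by
      refine hc.mono' ?_
      intro z hz
      by_contra hn
      have : α =ᶠ[𝓝 z] fun _ => (0 : ℂ) := notMem_tsupport_iff_eventuallyEq.1 hn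
      exact hz (by rw [dz_congr this]; simp [dz])
    exact h1.neg.add hc.mul_right
  have hbc : HasCompactSupport (dzb α) := by
    refine hc.mono' ?_
    intro z hz
    by_contra hn
    have : α =ᶠ[𝓝 z] fun _ => (0 : ℂ) := notMem_tsupport_iff_eventuallyEq.1 hn
    exact hz (by simp [dzb, this.fderiv_eq])
  set F₁ : ℂ → ℂ := fun z => E z * α z * conj (a z)
  set F₂ : ℂ → ℂ := fun z => E z * dzb α z * conj (α z)
  have hF₁ : ContDiff ℝ 1 F₁ := (hE1.mul hα1).mul (hconj1.comp haC)
  have hF₂ : ContDiff ℝ 1 F₂ := (hE1.mul hb).mul (hconj1.comp hα1)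
  have hF₁c : HasCompactSupport F₁ := (hc.mul_left (f := E)).mul_right
  have hF₂c : HasCompactSupport F₂ := (hbc.mul_left (f := E)).mul_right
  have hdE : ∀ z, dz E z = -(E z * dz P z) := by
    intro z
    have := dz_ofReal_exp (p := fun w => -p w) (z := z)
      (hp.neg.differentiable (by norm_num)).differentiableAt
    rw [dz_ofReal_neg] at this
    simp only [E, P, this]; ring
  -- The identity `E|a|² = E Δp |α|² + E|∂̄α|²` modulo exact terms: moving the derivative off `α`
  -- produces `∂̄a`, where `∂̄` meets `∂p` and creates `Δp`; moving it back produces `|∂̄α|²`. The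
  -- boundary terms are `∂F₁` and the conjugate of `∂F₂`.
  have hpt : ∀ z, ((Real.exp (-p z) * ‖a z‖ ^ 2 : ℝ) : ℂ) =
      ((Real.exp (-p z) * (ddbar p z * ‖α z‖ ^ 2) : ℝ) : ℂ) +
      ((Real.exp (-p z) * ‖dzb α z‖ ^ 2 : ℝ) : ℂ) - dz F₁ z - conj (dz F₂ z) := by
    intro z
    have dE : DifferentiableAt ℝ E z := (hE1.differentiable (by norm_num)) z
    have dα : DifferentiableAt ℝ α z := (hα1.differentiable (by norm_num)) z
    have da : DifferentiableAt ℝ a z := (haC.differentiable (by norm_num)) z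
    have db : DifferentiableAt ℝ (dzb α) z := (hb.differentiable (by norm_num)) z
    have dP : DifferentiableAt ℝ (dz P) z := (hdP.differentiable (by norm_num)) z
    have ddα : DifferentiableAt ℝ (dz α) z := (hdα.differentiable (by norm_num)) z
    have dca : DifferentiableAt ℝ (fun z => conj (a z)) z :=
      ((hconj1.comp haC).differentiable (by norm_num)) z
    have dcα : DifferentiableAt ℝ (fun z => conj (α z)) z :=
      ((hconj1.comp hα1).differentiable (by norm_num)) z
    have e1 : dz F₁ z = (-(E z * dz P z) * α z + E z * dz α z) * conj (a z) +
        E z * α z * conj (dzb a z) := by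
      rw [dz_mul (dE.fun_mul dα) dca, dz_mul dE dα, hdE, dz_conj]
    have e2 : dz F₂ z = (-(E z * dz P z) * dzb α z + E z * dz (dzb α) z) * conj (α z) +
        E z * dzb α z * conj (dzb α z) := by
      rw [dz_mul (dE.fun_mul db) dcα, dz_mul dE db, hdE, dz_conj]
    have e3 : dzb a z = -dz (dzb α) z + (dzb α z * dz P z + α z * ddbar p z) := by
      rw [ha, dzb_add ddα.fun_neg (dα.fun_mul dP), dzb_neg, dzb_mul dα dP, dzb_dz hα.contDiffAt,
        dz_dzb hα.contDiffAt, dzb_dz_ofReal hp.contDiffAt]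
    have n : ∀ w : ℂ, ((‖w‖ : ℝ) : ℂ) ^ 2 = w * conj w := fun w => (Complex.mul_conj' w).symm
    have cE : conj (E z) = E z := Complex.conj_ofReal _
    push_cast
    rw [n, n, n, e1, e2, e3]
    have hEz : Complex.exp (-(p z : ℂ)) = E z := by simp [E]
    rw [hEz]
    have haz : a z = -dz α z + α z * dz P z := rfl
    rw [haz]
    simp only [map_add, map_mul, map_neg, cE, Complex.conj_conj, Complex.conj_ofReal]
    ring
  have hexp : Continuous fun z => Real.exp (-p z) := by
    have := hp.continuous; fun_prop
  have hdd : Continuous (ddbar p) :=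
    continuous_iff_continuousAt.2 fun z => continuousAt_ddbar hp.contDiffAt
  have hn : ∀ {f : ℂ → ℂ}, HasCompactSupport f → HasCompactSupport fun z => ‖f z‖ ^ 2 :=
    fun {f} hf => hf.comp_left (g := fun w : ℂ => ‖w‖ ^ 2) (by simp)
  have i1 : Integrable fun z => Real.exp (-p z) * ‖a z‖ ^ 2 :=
    (hexp.mul (haC.continuous.norm.pow 2)).integrable_of_hasCompactSupport (hn hac).mul_left
  have i2 : Integrable fun z => Real.exp (-p z) * (ddbar p z * ‖α z‖ ^ 2) :=
    (hexp.mul (hdd.mul (hα.continuous.norm.pow 2))).integrable_of_hasCompactSupport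
      ((hn hc).mul_left.mul_left)
  have i3 : Integrable fun z => Real.exp (-p z) * ‖dzb α z‖ ^ 2 :=
    (hexp.mul (hb.continuous.norm.pow 2)).integrable_of_hasCompactSupport (hn hbc).mul_left
  have hdz : ∀ {F : ℂ → ℂ}, ContDiff ℝ 1 F → HasCompactSupport F → Integrable (dz F) := by
    intro F hF hFc
    have hcont : ∀ v, Continuous fun z => fderiv ℝ F z v := fun v =>
      (hF.continuous_fderiv (by norm_num)).clm_apply continuous_const
    have hint : ∀ v, Integrable fun z => fderiv ℝ F z v := fun v =>
      (hcont v).integrable_of_hasCompactSupport (hFc.fderiv_apply ℝ v)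
    exact ((hint 1).sub ((hint _).const_mul _)).const_mul _
  have hmain : ((∫ z, Real.exp (-p z) * ‖a z‖ ^ 2 : ℝ) : ℂ) =
      ((∫ z, Real.exp (-p z) * (ddbar p z * ‖α z‖ ^ 2) : ℝ) : ℂ) +
      ((∫ z, Real.exp (-p z) * ‖dzb α z‖ ^ 2 : ℝ) : ℂ) := by
    rw [← integral_complex_ofReal, ← integral_complex_ofReal, ← integral_complex_ofReal]
    have j2 : Integrable fun z => ((Real.exp (-p z) * (ddbar p z * ‖α z‖ ^ 2) : ℝ) : ℂ) :=
      i2.ofReal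
    have j3 : Integrable fun z => ((Real.exp (-p z) * ‖dzb α z‖ ^ 2 : ℝ) : ℂ) := i3.ofReal
    have j5 : Integrable fun z => conj (dz F₂ z) :=
      Complex.conjCLE.toContinuousLinearMap.integrable_comp (hdz hF₂ hF₂c)
    rw [integral_congr_ae (Eventually.of_forall hpt),
      integral_sub (f := fun z => _ - _) ((j2.add j3).sub (hdz hF₁ hF₁c)) j5,
      integral_sub (f := fun z => _ + _) (j2.add j3) (hdz hF₁ hF₁c), integral_add j2 j3, integral_conj,
      integral_dz_eq_zero hF₁ hF₁c, integral_dz_eq_zero hF₂ hF₂c]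
    simp
  have hmain' := Complex.ofReal_injective (hmain.trans (Complex.ofReal_add _ _).symm)
  rw [hmain']
  -- Only the sign of the `∂̄α` term matters; dropping it turns the identity into the inequality.
  have : 0 ≤ ∫ z, Real.exp (-p z) * ‖dzb α z‖ ^ 2 := integral_nonneg fun z => by positivity
  linarith

end BergmanWeight

namespace BergmanWeight

/-! ### Test functions and the formal adjoint of `∂̄` -/

theorem exists_closedBall_of_isCompact {S : Set ℂ} (hSc : IsCompact S) (hS : S ⊆ ball (0 : ℂ) 1) :
    ∃ r : ℝ, 0 ≤ r ∧ r < 1 ∧ S ⊆ closedBall (0 : ℂ) r := by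
  rcases S.eq_empty_or_nonempty with rfl | hne
  · exact ⟨0, by simp, by simp, by simp⟩
  · obtain ⟨x, hx, hmax⟩ := hSc.exists_isMaxOn hne continuous_norm.continuousOn
    exact ⟨‖x‖, norm_nonneg _, by simpa using hS hx, fun y hy => by simpa using hmax hy⟩

/-- Continuous functions with compact support in the unit disc. -/
structure CompactlySupported (f : ℂ → ℂ) : Prop where
  continuous : Continuous f
  hasCompactSupport : HasCompactSupport f
  tsupport_subset : tsupport f ⊆ ball (0 : ℂ) 1

/-- Functions of class `C²` with compact support in the unit disc. -/
structure IsTest (α : ℂ → ℂ) : Prop where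
  contDiff : ContDiff ℝ 2 α
  hasCompactSupport : HasCompactSupport α
  tsupport_subset : tsupport α ⊆ ball (0 : ℂ) 1

theorem IsTest.compactlySupported {α : ℂ → ℂ} (h : IsTest α) : CompactlySupported α :=
  ⟨h.contDiff.continuous, h.hasCompactSupport, h.tsupport_subset⟩

/-- The factor `g` is arbitrary outside the disc, because the support of `f` is a compact subset of
it. Potentials, symbols and weights with no control at the boundary can therefore multiply test
functions. -/
theorem CompactlySupported.mul {f g : ℂ → ℂ} (hf : CompactlySupported f)
    (hg : ContinuousOn g (ball 0 1)) : CompactlySupported fun z => g z * f z := by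
  have hs : (tsupport fun z => g z * f z) ⊆ ball (0 : ℂ) 1 :=
    tsupport_mul_subset_right.trans hf.tsupport_subset
  exact ⟨(hg.mul hf.continuous.continuousOn).continuous_of_tsupport_subset isOpen_ball hs,
    hf.hasCompactSupport.mul_left, hs⟩

theorem CompactlySupported.add {f g : ℂ → ℂ} (hf : CompactlySupported f)
    (hg : CompactlySupported g) : CompactlySupported fun z => f z + g z :=
  ⟨hf.continuous.add hg.continuous, hf.hasCompactSupport.add hg.hasCompactSupport,
    (tsupport_add f g).trans (Set.union_subset hf.tsupport_subset hg.tsupport_subset)⟩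

theorem CompactlySupported.neg {f : ℂ → ℂ} (hf : CompactlySupported f) :
    CompactlySupported fun z => -f z := by
  simpa using hf.mul (g := fun _ => -1) continuousOn_const

theorem CompactlySupported.eq_zero {f : ℂ → ℂ} (hf : CompactlySupported f) {z : ℂ}
    (hz : z ∉ ball (0 : ℂ) 1) : f z = 0 :=
  image_eq_zero_of_notMem_tsupport fun h => hz (hf.tsupport_subset h)

theorem contDiff_of_tsupport_subset {V : Type*} [NormedAddCommGroup V] [NormedSpace ℝ V]
    {f : ℂ → V} {U : Set ℂ} (hU : IsOpen U) {n : WithTop ℕ∞}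
    (hf : ContDiffOn ℝ n f U) (hs : tsupport f ⊆ U) : ContDiff ℝ n f := by
  refine contDiff_iff_contDiffAt.2 fun z => ?_
  by_cases hz : z ∈ tsupport f
  · exact hf.contDiffAt (hU.mem_nhds (hs hz))
  · exact contDiffAt_const.congr_of_eventuallyEq (notMem_tsupport_iff_eventuallyEq.1 hz)

theorem IsTest.mul {α g : ℂ → ℂ} (hα : IsTest α) (hg : ContDiffOn ℝ 2 g (ball 0 1)) :
    IsTest fun z => g z * α z := by
  have hs : (tsupport fun z => g z * α z) ⊆ ball (0 : ℂ) 1 :=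
    tsupport_mul_subset_right.trans hα.tsupport_subset
  exact ⟨contDiff_of_tsupport_subset isOpen_ball (hg.mul hα.contDiff.contDiffOn) hs,
    hα.hasCompactSupport.mul_left, hs⟩

theorem IsTest.add {α β : ℂ → ℂ} (hα : IsTest α) (hβ : IsTest β) : IsTest fun z => α z + β z :=
  ⟨hα.contDiff.add hβ.contDiff, hα.hasCompactSupport.add hβ.hasCompactSupport,
    (tsupport_add α β).trans (Set.union_subset hα.tsupport_subset hβ.tsupport_subset)⟩

theorem tsupport_dz_subset (α : ℂ → ℂ) : tsupport (dz α) ⊆ tsupport α := by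
  refine closure_minimal (fun z hz => ?_) (isClosed_tsupport α)
  by_contra hn
  have : α =ᶠ[𝓝 z] fun _ => (0 : ℂ) := notMem_tsupport_iff_eventuallyEq.1 hn
  exact hz (by rw [dz_congr this]; simp [dz])

theorem IsTest.compactlySupported_dz {α : ℂ → ℂ} (h : IsTest α) : CompactlySupported (dz α) :=
  ⟨continuous_iff_continuousAt.2 fun _ => (contDiffAt_dz h.contDiff.contDiffAt).continuousAt,
    h.hasCompactSupport.mono' ((subset_tsupport _).trans (tsupport_dz_subset α)),
    (tsupport_dz_subset α).trans h.tsupport_subset⟩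

/-- A `C²` function on the disc agrees near a given compact subset with a global `C²` function. -/
theorem exists_contDiff_eventuallyEq {p : ℂ → ℝ} (hp : ContDiffOn ℝ 2 p (ball 0 1)) {S : Set ℂ}
    (hSc : IsCompact S) (hS : S ⊆ ball (0 : ℂ) 1) :
    ∃ q : ℂ → ℝ, ContDiff ℝ 2 q ∧ ∀ z ∈ S, q =ᶠ[𝓝 z] p := by
  obtain ⟨r, h0, h1, hr⟩ := exists_closedBall_of_isCompact hSc hS
  -- The two radii satisfy `r < (1 + r)/2 < (3 + r)/4 < 1`, so the cut-off equals `1` near every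
  -- point of `S` and is still supported in the disc.
  let b : ContDiffBump (0 : ℂ) := ⟨(1 + r) / 2, (3 + r) / 4, by linarith, by linarith⟩
  have hb : tsupport b ⊆ ball (0 : ℂ) 1 := by
    rw [b.tsupport_eq]
    exact closedBall_subset_ball (show (3 + r) / 4 < 1 by linarith)
  refine ⟨fun z => b z * p z, contDiff_of_tsupport_subset isOpen_ball
    (b.contDiff.contDiffOn.mul hp) (tsupport_mul_subset_left.trans hb), fun z hz => ?_⟩
  have hz' : z ∈ ball (0 : ℂ) ((1 + r) / 2) := by
    have := mem_closedBall.1 (hr hz)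
    exact mem_ball.2 (by linarith)
  filter_upwards [isOpen_ball.mem_nhds hz'] with w hw
  rw [b.one_of_mem_closedBall (ball_subset_closedBall hw), one_mul]

/-- The Bochner–Kodaira–Hörmander inequality for a potential on the disc. -/
theorem IsTest.integral_ddbar_mul_le {p : ℂ → ℝ} {α : ℂ → ℂ} (hp : ContDiffOn ℝ 2 p (ball 0 1))
    (hα : IsTest α) :
    ∫ z, Real.exp (-p z) * (ddbar p z * ‖α z‖ ^ 2) ≤
      ∫ z, Real.exp (-p z) * ‖-dz α z + α z * dz (fun w => (p w : ℂ)) z‖ ^ 2 := by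
  obtain ⟨q, hq, hqp⟩ := exists_contDiff_eventuallyEq hp hα.hasCompactSupport hα.tsupport_subset
  have h := BergmanWeight.integral_ddbar_mul_le hq hα.contDiff hα.hasCompactSupport
  have e1 : ∀ z, Real.exp (-q z) * (ddbar q z * ‖α z‖ ^ 2) =
      Real.exp (-p z) * (ddbar p z * ‖α z‖ ^ 2) := by
    intro z
    by_cases hz : z ∈ tsupport α
    · rw [(hqp z hz).eq_of_nhds]
      simp only [ddbar, (InnerProductSpace.laplacian_congr_nhds (hqp z hz)).eq_of_nhds]
    · simp [image_eq_zero_of_notMem_tsupport hz]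
  have e2 : ∀ z, Real.exp (-q z) * ‖-dz α z + α z * dz (fun w => (q w : ℂ)) z‖ ^ 2 =
      Real.exp (-p z) * ‖-dz α z + α z * dz (fun w => (p w : ℂ)) z‖ ^ 2 := by
    intro z
    by_cases hz : z ∈ tsupport α
    · have : (fun w => (q w : ℂ)) =ᶠ[𝓝 z] fun w => (p w : ℂ) := by
        filter_upwards [hqp z hz] with w hw
        rw [hw]
      rw [(hqp z hz).eq_of_nhds, dz_congr this]
    · have := image_eq_zero_of_notMem_tsupport (fun h => hz (tsupport_dz_subset α h))
      simp [image_eq_zero_of_notMem_tsupport hz, this]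
  simpa only [e1, e2] using h

/-! ### The measure `ω dA` on compactly supported functions, and the a priori estimate for `dstar`.
-/

variable (ω : BergmanWeight)

instance : IsFiniteMeasure ω.measure := by
  refine ⟨?_⟩
  have := ω.lintegral_measure fun _ => 1
  rw [lintegral_one] at this
  rw [this]
  simpa using ω.integrable.lintegral_lt_top

theorem ae_mem_ball : ∀ᵐ z ∂ω.measure, z ∈ ball (0 : ℂ) 1 :=
  (withDensity_absolutelyContinuous _ _).ae_le (ae_restrict_mem measurableSet_ball)

theorem exp_neg_potential {z : ℂ} (hz : z ∈ ball (0 : ℂ) 1) :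
    Real.exp (-ω.potential z) = ω.toFun z := by
  simp [potential, Real.exp_log (ω.pos z hz)]

theorem integral_measure {V : Type*} [NormedAddCommGroup V] [NormedSpace ℝ V] (f : ℂ → V) :
    ∫ z, f z ∂ω.measure = ∫ z in ball (0 : ℂ) 1, ω.toFun z • f z := by
  unfold measure
  rw [integral_withDensity_eq_integral_toReal_smul₀ ω.integrable.aemeasurable.ennreal_ofReal
    (Eventually.of_forall fun _ => ENNReal.ofReal_lt_top)]
  refine setIntegral_congr_fun measurableSet_ball fun z hz => ?_
  simp only [ENNReal.toReal_ofReal (ω.pos z hz).le]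

/-- Passing to an integral over the whole plane gives access to the inequalities for `e^{-p}`;
vanishing of `f` outside the disc makes the values of `ω` there irrelevant. -/
theorem integral_measure_of_eq_zero {V : Type*} [NormedAddCommGroup V] [NormedSpace ℝ V]
    {f : ℂ → V} (hf : ∀ z ∉ ball (0 : ℂ) 1, f z = 0) :
    ∫ z, f z ∂ω.measure = ∫ z, Real.exp (-ω.potential z) • f z := by
  rw [integral_measure, ← setIntegral_eq_integral_of_forall_compl_eq_zero (s := ball (0 : ℂ) 1)
    (f := fun z => Real.exp (-ω.potential z) • f z)]
  · exact setIntegral_congr_fun measurableSet_ball fun z hz => by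
      simp only [ω.exp_neg_potential hz]
  · intro z hz
    rw [hf z hz, smul_zero]

theorem CompactlySupported.memLp {f : ℂ → ℂ} (hf : CompactlySupported f) : MemLp f 2 ω.measure :=
  hf.continuous.memLp_of_hasCompactSupport hf.hasCompactSupport

theorem CompactlySupported.integrable {f : ℂ → ℂ} (hf : CompactlySupported f) :
    Integrable f ω.measure :=
  hf.continuous.integrable_of_hasCompactSupport hf.hasCompactSupport

theorem CompactlySupported.integrable_sq {f : ℂ → ℂ} (hf : CompactlySupported f) :
    Integrable (fun z => ‖f z‖ ^ 2) ω.measure :=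
  (hf.memLp ω).integrable_norm_pow (p := 2) two_ne_zero

/-- The formal adjoint of `∂̄` in `L²_ω`. -/
noncomputable def dstar (α : ℂ → ℂ) (z : ℂ) : ℂ :=
  -dz α z + α z * dz (fun w => (ω.potential w : ℂ)) z

theorem contDiffOn_ofReal {p : ℂ → ℝ} {n : WithTop ℕ∞} {s : Set ℂ} (hp : ContDiffOn ℝ n p s) :
    ContDiffOn ℝ n (fun w => (p w : ℂ)) s :=
  Complex.ofRealCLM.contDiff.comp_contDiffOn hp

theorem continuousOn_dz {F : ℂ → ℂ} (hF : ContDiffOn ℝ 2 F (ball 0 1)) :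
    ContinuousOn (dz F) (ball 0 1) := fun _ hz =>
  (contDiffAt_dz (hF.contDiffAt (isOpen_ball.mem_nhds hz))).continuousAt.continuousWithinAt

theorem continuousOn_ddbar {p : ℂ → ℝ} (hp : ContDiffOn ℝ 2 p (ball 0 1)) :
    ContinuousOn (ddbar p) (ball 0 1) := fun _ hz =>
  (continuousAt_ddbar (hp.contDiffAt (isOpen_ball.mem_nhds hz))).continuousWithinAt

theorem IsTest.compactlySupported_dstar {ω : BergmanWeight}
    (hω : ContDiffOn ℝ 2 ω.potential (ball 0 1)) {α : ℂ → ℂ} (hα : IsTest α) :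
    CompactlySupported (ω.dstar α) := by
  have := hα.compactlySupported_dz.neg.add
    (hα.compactlySupported.mul (continuousOn_dz (contDiffOn_ofReal hω)))
  unfold dstar
  simpa only [mul_comm] using this

/-- The Leibniz rule for the adjoint. The commutator `-α ∂g` is the error term in every weighted
estimate below. -/
theorem dstar_mul {α g : ℂ → ℂ} (hα : IsTest α) (hg : ContDiffOn ℝ 2 g (ball 0 1)) (z : ℂ) :
    ω.dstar (fun z => g z * α z) z = g z * ω.dstar α z - α z * dz g z := by
  by_cases hz : z ∈ ball (0 : ℂ) 1
  · have h1 : DifferentiableAt ℝ g z :=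
      (hg.contDiffAt (isOpen_ball.mem_nhds hz)).differentiableAt (by norm_num)
    have h2 : DifferentiableAt ℝ α z := (hα.contDiff.differentiable (by norm_num)) z
    simp only [dstar, dz_mul h1 h2]
    ring
  · simp only [dstar, hα.compactlySupported.eq_zero hz, hα.compactlySupported_dz.eq_zero hz,
      (hα.mul hg).compactlySupported_dz.eq_zero hz]
    simp

/-- The elementary step that absorbs the gradient term of the twisted estimate. -/
theorem norm_add_sq_le {a b : ℂ} {s : ℝ} (hs : 0 < s) :
    ‖a + b‖ ^ 2 ≤ (1 + 1 / s) * ‖a‖ ^ 2 + (1 + s) * ‖b‖ ^ 2 := by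
  have h1 : ‖a + b‖ ^ 2 ≤ (‖a‖ + ‖b‖) ^ 2 := by gcongr; exact norm_add_le a b
  have h2 : (1 + 1 / s) * ‖a‖ ^ 2 + (1 + s) * ‖b‖ ^ 2 - (‖a‖ + ‖b‖) ^ 2 =
      (‖a‖ - s * ‖b‖) ^ 2 / s := by field_simp; ring
  have h3 : 0 ≤ (‖a‖ - s * ‖b‖) ^ 2 / s := by positivity
  linarith

theorem CompactlySupported.integrable_mul_sq {f : ℂ → ℂ} (hf : CompactlySupported f) {M : ℂ → ℝ}
    (hM : ContinuousOn M (ball 0 1)) : Integrable (fun z => M z * ‖f z‖ ^ 2) ω.measure := by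
  have h := ((hf.mul hf.continuous.star.continuousOn).mul
    (Complex.continuous_ofReal.comp_continuousOn hM)).integrable ω
  refine h.re.congr (Eventually.of_forall fun z => ?_)
  have : star (f z) * f z = ((‖f z‖ ^ 2 : ℝ) : ℂ) := by
    push_cast; exact Complex.conj_mul' (f z)
  simp only [Function.comp, this]
  rw [← Complex.ofReal_mul]
  exact Complex.ofReal_re _

/-- The a priori estimate for the formal adjoint of `∂̄`, for weights of class `𝓦*`. -/
theorem exists_apriori (hω : ω.ClassWStar) : ∃ M : ℂ → ℝ, ContinuousOn M (ball 0 1) ∧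
    (∀ z ∈ ball (0 : ℂ) 1, 0 < M z) ∧ (∃ δ > (0 : ℝ), ∀ z : 𝔻, δ ≤ ω.tau z ^ 2 * M z) ∧
    ∃ A > (0 : ℝ), ∀ α, IsTest α →
      ∫ z, M z * ‖α z‖ ^ 2 ∂ω.measure ≤ A * ∫ z, ‖ω.dstar α z‖ ^ 2 ∂ω.measure := by
  have hpot := hω.contDiffOn_potential
  have hposM : ∀ {M : ℂ → ℝ} {δ : ℝ}, 0 < δ → (∀ z : 𝔻, δ ≤ ω.tau z ^ 2 * M z) →
      ∀ z ∈ ball (0 : ℂ) 1, 0 < M z := by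
    intro M δ hδ h z hz
    have h1 := h (Complex.UnitDisc.mk z (by simpa using hz))
    rw [Complex.UnitDisc.coe_mk] at h1
    exact pos_of_mul_pos_right (hδ.trans_le h1) (sq_nonneg _)
  rcases hω.laplacian_condition with ⟨c, hc, h⟩ | ⟨ψ, hψ, -, -, δ, hδ, t, ht, h⟩
  · refine ⟨ddbar ω.potential, continuousOn_ddbar hpot, hposM hc h, ⟨c, hc, h⟩, 1, one_pos,
      fun α hα => ?_⟩
    have h1 := hα.integral_ddbar_mul_le hpot
    rw [one_mul, ω.integral_measure_of_eq_zero, ω.integral_measure_of_eq_zero]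
    · exact h1
    · intro z hz
      simp [(hα.compactlySupported_dstar hpot).eq_zero hz]
    · intro z hz
      simp [hα.compactlySupported.eq_zero hz]
  · have hδψ : ∀ z : 𝔻, δ ≤ ω.tau z ^ 2 * ddbar ψ z := fun z => (h z).1
    -- With this `s` one has `2 + t = 1 + 2s`, so subtracting the absorbed term with factor `1 + s`
    -- leaves `s ∫ Δψ |α|²`; `t > -1` makes `s` positive.
    set s : ℝ := (1 + t) / 2 with hs
    have hs0 : 0 < s := by have := ht.1; linarith
    refine ⟨ddbar ψ, continuousOn_ddbar hψ, hposM hδ hδψ, ⟨δ, hδ, hδψ⟩, (1 + 1 / s) / s,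
      by positivity, fun α hα => ?_⟩
    -- Twisting: the potential `p + 2ψ` applied to `γ = e^ψ α`. The factor `e^{-2ψ}` cancels
    -- `|e^ψ|²`, and the adjoint for the new potential sends `γ` to `e^ψ (D α + α ∂ψ)`, so
    -- everything returns to `L²_ω` with curvature `Δp + 2Δψ`.
    set γ : ℂ → ℂ := fun z => ((Real.exp (ψ z) : ℝ) : ℂ) * α z with hγ
    have heψ : ContDiffOn ℝ 2 (fun z => ((Real.exp (ψ z) : ℝ) : ℂ)) (ball 0 1) :=
      contDiffOn_ofReal (Real.contDiff_exp.comp_contDiffOn hψ)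
    have hγt : IsTest γ := hα.mul heψ
    have hpψ : ContDiffOn ℝ 2 (fun z => ω.potential z + 2 * ψ z) (ball 0 1) :=
      hpot.add (contDiffOn_const.mul hψ)
    have h1 := hγt.integral_ddbar_mul_le hpψ
    have hψc : ContDiffOn ℝ 2 (fun z => (ψ z : ℂ)) (ball 0 1) := contDiffOn_ofReal hψ
    have hDα := hα.compactlySupported_dstar hpot
    have hαψ := hα.compactlySupported.mul (continuousOn_dz hψc)
    have iL : Integrable (fun z => (ddbar ω.potential z + 2 * ddbar ψ z) * ‖α z‖ ^ 2) ω.measure :=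
      hα.compactlySupported.integrable_mul_sq ω
        ((continuousOn_ddbar hpot).add (continuousOn_const.mul (continuousOn_ddbar hψ)))
    have iψ : Integrable (fun z => ddbar ψ z * ‖α z‖ ^ 2) ω.measure :=
      hα.compactlySupported.integrable_mul_sq ω (continuousOn_ddbar hψ)
    have e1 : ∫ z, (ddbar ω.potential z + 2 * ddbar ψ z) * ‖α z‖ ^ 2 ∂ω.measure ≤
        ∫ z, ‖ω.dstar α z + dz (fun w => (ψ w : ℂ)) z * α z‖ ^ 2 ∂ω.measure := by
      rw [ω.integral_measure_of_eq_zero, ω.integral_measure_of_eq_zero]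
      rotate_left
      · intro z hz
        simp [(hDα.add hαψ).eq_zero hz]
      · intro z hz
        simp [hα.compactlySupported.eq_zero hz]
      refine (le_of_eq (integral_congr_ae (Eventually.of_forall fun z => ?_))).trans
        (h1.trans (le_of_eq (integral_congr_ae (Eventually.of_forall fun z => ?_))))
      · by_cases hz : z ∈ ball (0 : ℂ) 1
        · have d1 := hpot.contDiffAt (isOpen_ball.mem_nhds hz)
          have d2 := hψ.contDiffAt (isOpen_ball.mem_nhds hz)
          have d3 : ddbar (fun z => ω.potential z + 2 * ψ z) z =
              ddbar ω.potential z + 2 * ddbar ψ z := by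
            have e : (fun z => ω.potential z + 2 * ψ z) = ω.potential + (2 : ℝ) • ψ := by
              ext; simp
            simp only [ddbar]
            rw [e, ContDiffAt.laplacian_add (f₂ := (2 : ℝ) • ψ) d1 (d2.const_smul (2 : ℝ)),
              InnerProductSpace.laplacian_smul _ d2]
            simp only [smul_eq_mul]; ring
          have d4 : ‖γ z‖ ^ 2 = Real.exp (2 * ψ z) * ‖α z‖ ^ 2 := by
            rw [hγ]
            simp only [norm_mul, Complex.norm_real, Real.norm_of_nonneg (Real.exp_pos _).le]
            rw [mul_pow, ← Real.exp_nat_mul]; norm_num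
          simp only [smul_eq_mul, d3, d4, neg_add, Real.exp_add]
          have : Real.exp (-(2 * ψ z)) * Real.exp (2 * ψ z) = 1 := by
            rw [← Real.exp_add]; simp
          linear_combination (-(Real.exp (-ω.potential z)) *
            (ddbar ω.potential z + 2 * ddbar ψ z) * ‖α z‖ ^ 2) * this
        · simp [hγ, hα.compactlySupported.eq_zero hz]
      · by_cases hz : z ∈ ball (0 : ℂ) 1
        · have d1 := (hpot.contDiffAt (isOpen_ball.mem_nhds hz)).differentiableAt (by norm_num)
          have d2 := (hψ.contDiffAt (isOpen_ball.mem_nhds hz)).differentiableAt (by norm_num)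
          have d1c := ((contDiffOn_ofReal hpot).contDiffAt
            (isOpen_ball.mem_nhds hz)).differentiableAt (by norm_num)
          have d2c := (hψc.contDiffAt (isOpen_ball.mem_nhds hz)).differentiableAt (by norm_num)
          have d3c := (heψ.contDiffAt (isOpen_ball.mem_nhds hz)).differentiableAt (by norm_num)
          have dα : DifferentiableAt ℝ α z := (hα.contDiff.differentiable (by norm_num)) z
          have d3 : dz (fun w => ((ω.potential w + 2 * ψ w : ℝ) : ℂ)) z =
              dz (fun w => (ω.potential w : ℂ)) z + 2 * dz (fun w => (ψ w : ℂ)) z := by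
            have e : (fun w => ((ω.potential w + 2 * ψ w : ℝ) : ℂ)) =
                fun w => (ω.potential w : ℂ) + 2 * (ψ w : ℂ) := by ext; push_cast; ring
            rw [e, dz_add d1c (d2c.const_mul 2), dz_mul (differentiableAt_const _) d2c]
            have : dz (fun _ => (2 : ℂ)) z = 0 := by simp [dz]
            rw [this]; ring
          have d4 : -dz γ z + γ z * dz (fun w => ((ω.potential w + 2 * ψ w : ℝ) : ℂ)) z =
              (Real.exp (ψ z) : ℂ) * (ω.dstar α z + dz (fun w => (ψ w : ℂ)) z * α z) := by
            rw [d3, hγ, dz_mul d3c dα, dz_ofReal_exp d2, dstar]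
            ring
          beta_reduce
          rw [d4, norm_mul, Complex.norm_real, Real.norm_of_nonneg (Real.exp_pos _).le, mul_pow,
            ← Real.exp_nat_mul, neg_add, Real.exp_add]
          have : Real.exp (-(2 * ψ z)) * Real.exp ((2 : ℕ) * ψ z) = 1 := by
            rw [← Real.exp_add]; simp
          simp only [smul_eq_mul]
          linear_combination (Real.exp (-ω.potential z) *
            ‖ω.dstar α z + dz (fun w => (ψ w : ℂ)) z * α z‖ ^ 2) * this
        · simp only [hγt.compactlySupported.eq_zero hz, hγt.compactlySupported_dz.eq_zero hz,
            (hDα.add hαψ).eq_zero hz]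
          simp
    -- Here `Δp ≥ t Δψ` enters; `|∂ψ|² ≤ Δψ` is what bounds the gradient term in the next
    -- inequality.
    have e2 : ∫ z, (2 + t) * (ddbar ψ z * ‖α z‖ ^ 2) ∂ω.measure ≤
        ∫ z, (ddbar ω.potential z + 2 * ddbar ψ z) * ‖α z‖ ^ 2 ∂ω.measure := by
      refine integral_mono_ae (iψ.const_mul _) iL ?_
      filter_upwards [ω.ae_mem_ball] with z hz
      have := (h (Complex.UnitDisc.mk z (by simpa using hz))).2.1
      rw [Complex.UnitDisc.coe_mk] at this
      nlinarith [sq_nonneg ‖α z‖]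
    have e3 : ∫ z, ‖ω.dstar α z + dz (fun w => (ψ w : ℂ)) z * α z‖ ^ 2 ∂ω.measure ≤
        ∫ z, ((1 + 1 / s) * ‖ω.dstar α z‖ ^ 2 + (1 + s) * (ddbar ψ z * ‖α z‖ ^ 2)) ∂ω.measure := by
      refine integral_mono_ae ((hDα.add hαψ).integrable_sq ω)
        (((hDα.integrable_sq ω).const_mul _).add (iψ.const_mul _)) ?_
      filter_upwards [ω.ae_mem_ball] with z hz
      have h3 := (h (Complex.UnitDisc.mk z (by simpa using hz))).2.2
      rw [Complex.UnitDisc.coe_mk] at h3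
      refine (norm_add_sq_le hs0).trans ?_
      have d2 := (hψ.contDiffAt (isOpen_ball.mem_nhds hz)).differentiableAt (by norm_num)
      rw [norm_mul, mul_pow, dz_ofReal d2]
      gcongr
    rw [integral_add ((hDα.integrable_sq ω).const_mul _) (iψ.const_mul _), integral_const_mul,
      integral_const_mul] at e3
    rw [integral_const_mul] at e2
    rw [div_mul_eq_mul_div, le_div_iff₀ hs0]
    have : 2 + t = 1 + 2 * s := by rw [hs]; ring
    rw [this] at e2
    linarith

end BergmanWeight

namespace BergmanWeight

/-! ### Weyl's lemma for `∂̄` -/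

section Weyl

open Convolution ContinuousLinearMap

/-- The convolution of `g` with a normalized bump function. -/
noncomputable def mollify (ρ : ContDiffBump (0 : ℂ)) (g : ℂ → ℂ) : ℂ → ℂ :=
  ρ.normed volume ⋆[lsmul ℝ ℝ, volume] g

/-- The derivative falls on the bump function, so that `g` needs only to be integrable. -/
theorem hasFDerivAt_mollify (ρ : ContDiffBump (0 : ℂ)) {g : ℂ → ℂ} (hg : Integrable g) (x v : ℂ) :
    DifferentiableAt ℝ (mollify ρ g) x ∧
    fderiv ℝ (mollify ρ g) x v = ∫ t, (fderiv ℝ (ρ.normed volume) (x - t) v : ℝ) • g t := by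
  have hc : HasCompactSupport (ρ.normed volume) := ρ.hasCompactSupport_normed
  have hs : ContDiff ℝ 1 (ρ.normed volume) := ρ.contDiff_normed
  have hl := hg.locallyIntegrable
  have h := hc.hasFDerivAt_convolution_right (lsmul ℝ ℝ).flip hl hs x
  have e : mollify ρ g = g ⋆[(lsmul ℝ ℝ).flip, volume] ρ.normed volume := by
    rw [mollify, ← convolution_flip]
  rw [e]
  refine ⟨h.differentiableAt, ?_⟩
  rw [h.fderiv, convolution_precompR_apply _ hl (hc.fderiv ℝ) (hs.continuous_fderiv one_ne_zero),
    convolution_def]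
  rfl

/-- Young's inequality for a kernel of mass one. The bound does not depend on `ρ`, and the mean
value property upgrades it to a uniform sup bound on holomorphic mollifications. -/
theorem lintegral_mollify_le (ρ : ContDiffBump (0 : ℂ)) {g : ℂ → ℂ} (hg : Integrable g) :
    ∫⁻ x, ‖mollify ρ g x‖ₑ ≤ ∫⁻ x, ‖g x‖ₑ := by
  have hρ : Integrable (ρ.normed (volume : Measure ℂ)) := ρ.integrable_normed
  have hi := hρ.integrable_convolution (lsmul ℝ ℝ) hg.norm
  have h1 : ∫ x, (ρ.normed volume ⋆[lsmul ℝ ℝ, volume] fun t => ‖g t‖) x = ∫ x, ‖g x‖ := by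
    rw [integral_convolution _ hρ hg.norm, ρ.integral_normed]
    simp
  have hle : ∀ x, ‖mollify ρ g x‖ ≤ (ρ.normed volume ⋆[lsmul ℝ ℝ, volume] fun t => ‖g t‖) x := by
    intro x
    refine (norm_integral_le_integral_norm _).trans (le_of_eq (integral_congr_ae
      (Eventually.of_forall fun t => ?_)))
    simp [abs_of_nonneg (ρ.nonneg_normed t)]
  calc ∫⁻ x, ‖mollify ρ g x‖ₑ
      ≤ ∫⁻ x, ENNReal.ofReal ((ρ.normed volume ⋆[lsmul ℝ ℝ, volume] fun t => ‖g t‖) x) := by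
        refine lintegral_mono fun x => ?_
        rw [← ofReal_norm]
        exact ENNReal.ofReal_le_ofReal (hle x)
    _ = ENNReal.ofReal (∫ x, ‖g x‖) := by
        rw [← h1, ofReal_integral_eq_lintegral_ofReal hi
          (Eventually.of_forall fun x => (norm_nonneg _).trans (hle x))]
    _ = ∫⁻ x, ‖g x‖ₑ := by
        rw [ofReal_integral_norm_eq_lintegral_enorm hg]

theorem differentiableOn_mollify {h : ℂ → ℂ} {R R' : ℝ} (hR' : R' < 1)
    (hint : IntegrableOn h (ball 0 R'))
    (hh : ∀ β, IsTest β → ∫ z in ball (0 : ℂ) 1, h z * dzb β z = 0)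
    (ρ : ContDiffBump (0 : ℂ)) (hρ : R + ρ.rOut < R') :
    DifferentiableOn ℂ (mollify ρ ((ball 0 R').indicator h)) (ball 0 R) := by
  intro x hx
  set g := (ball (0 : ℂ) R').indicator h with hg
  have hgi : Integrable g := (integrable_indicator_iff measurableSet_ball).2 hint
  have hd := hasFDerivAt_mollify ρ hgi x
  refine DifferentiableAt.differentiableWithinAt
    (differentiableAt_complex_iff_differentiableAt_real.2 ⟨(hd 1).1, ?_⟩)
  rw [(hd 1).2, (hd Complex.I).2]
  set β : ℂ → ℂ := fun t => ((ρ.normed volume (x - t) : ℝ) : ℂ) with hβ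
  have hsm : ContDiff ℝ 2 (ρ.normed (volume : Measure ℂ)) := ρ.contDiff_normed
  have hdiff : Differentiable ℝ (ρ.normed (volume : Measure ℂ)) :=
    hsm.differentiable (by norm_num)
  have hsub : tsupport β ⊆ closedBall x ρ.rOut := by
    refine closure_minimal (fun t ht => ?_) isClosed_closedBall
    have h1 : x - t ∈ Function.support (ρ.normed (volume : Measure ℂ)) := by
      intro h0; exact ht (by simp [hβ, h0])
    rw [ρ.support_normed_eq, mem_ball, dist_zero_right] at h1
    rw [mem_closedBall, dist_comm, dist_eq_norm]; exact h1.le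
  have hsub' : closedBall x ρ.rOut ⊆ ball (0 : ℂ) R' := by
    refine closedBall_subset_ball' ?_
    have := mem_ball.1 hx
    linarith
  have hβt : IsTest β := by
    refine ⟨Complex.ofRealCLM.contDiff.comp (hsm.comp (contDiff_const.sub contDiff_id)), ?_,
      hsub.trans (hsub'.trans (ball_subset_ball hR'.le))⟩
    exact (isCompact_closedBall x ρ.rOut).of_isClosed_subset (isClosed_tsupport _) hsub
  have hfd : ∀ t v, fderiv ℝ β t v = -((fderiv ℝ (ρ.normed volume) (x - t) v : ℝ) : ℂ) := by
    intro t v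
    have h1 : HasFDerivAt (fun t => ρ.normed volume (x - t))
        ((fderiv ℝ (ρ.normed volume) (x - t)).comp (-ContinuousLinearMap.id ℝ ℂ)) t :=
      (hdiff (x - t)).hasFDerivAt.comp t ((hasFDerivAt_id t).const_sub x)
    rw [hβ, fderiv_ofReal h1.differentiableAt, h1.fderiv]
    simp
  have key := hh β hβt
  have hz : ∀ t ∉ ball (0 : ℂ) R', dzb β t = 0 := by
    intro t ht
    have : β =ᶠ[𝓝 t] fun _ => (0 : ℂ) :=
      notMem_tsupport_iff_eventuallyEq.1 fun h => ht (hsub' (hsub h))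
    simp [dzb, this.fderiv_eq]
  have e1 : ∫ z in ball (0 : ℂ) 1, h z * dzb β z = ∫ z, g z * dzb β z := by
    rw [← setIntegral_eq_integral_of_forall_compl_eq_zero (s := ball (0 : ℂ) 1)
      (f := fun z => g z * dzb β z)]
    · refine setIntegral_congr_fun measurableSet_ball fun z _ => ?_
      by_cases hzR : z ∈ ball (0 : ℂ) R'
      · simp [hg, Set.indicator_of_mem hzR]
      · simp [hz z hzR]
    · intro z hz1
      simp [hz z fun h => hz1 (ball_subset_ball hR'.le h)]
  rw [e1] at key
  have hcs : HasCompactSupport (ρ.normed (volume : Measure ℂ)) := ρ.hasCompactSupport_normed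
  have hi : ∀ v, Integrable fun t => (fderiv ℝ (ρ.normed volume) (x - t) v : ℝ) • g t := by
    intro v
    have hc : Continuous fun t => fderiv ℝ (ρ.normed (volume : Measure ℂ)) (x - t) v :=
      ((hsm.continuous_fderiv (by norm_num)).comp (continuous_const.sub continuous_id)).clm_apply
        continuous_const
    obtain ⟨C, hC⟩ := (hcs.fderiv_apply ℝ v).exists_bound_of_continuous
      ((hsm.continuous_fderiv (by norm_num)).clm_apply continuous_const)
    exact hgi.bdd_smul C hc.aestronglyMeasurable (Eventually.of_forall fun t => hC _)
  have e2 : ∀ t, g t * dzb β t = (-(1 / 2)) * ((fderiv ℝ (ρ.normed volume) (x - t) 1 : ℝ) • g t +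
      Complex.I * ((fderiv ℝ (ρ.normed volume) (x - t) Complex.I : ℝ) • g t)) := by
    intro t
    simp only [dzb, hfd, Complex.real_smul]
    ring
  simp only [e2] at key
  rw [integral_const_mul, integral_add (hi 1) ((hi _).const_mul _), integral_const_mul] at key
  have key2 := (mul_eq_zero.1 key).resolve_left (by norm_num)
  rw [smul_eq_mul]
  linear_combination (-Complex.I) * key2 +
    (∫ t, (fderiv ℝ (ρ.normed volume) (x - t) Complex.I : ℝ) • g t) * Complex.I_mul_I

/-- The mollifications are holomorphic and converge almost everywhere. The sub-mean value property
bounds them uniformly, which allows dominated convergence in `L¹`; a second use of it turns `L¹`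
convergence into uniform convergence on a smaller disc. -/
theorem exists_holomorphic_local {h : ℂ → ℂ} {R : ℝ} (hR : R < 1)
    (hint : ∀ r < 1, IntegrableOn h (ball 0 r))
    (hh : ∀ β, IsTest β → ∫ z in ball (0 : ℂ) 1, h z * dzb β z = 0) :
    ∃ F : ℂ → ℂ, DifferentiableOn ℂ F (ball 0 R) ∧ h =ᵐ[volume.restrict (ball 0 R)] F := by
  -- Four steps of length `s` lead from `R` to `1`: uniform convergence on radius `R`, the sup bound
  -- on `R + s`, holomorphy on `R + 2s`, truncation at `R + 3s < 1`.
  set s : ℝ := (1 - R) / 4 with hs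
  have hs0 : 0 < s := by linarith
  set g := (ball (0 : ℂ) (R + 3 * s)).indicator h with hg
  have hgi : Integrable g :=
    (integrable_indicator_iff measurableSet_ball).2 (hint _ (by linarith))
  -- The ratio of outer to inner radius is fixed at `2`, as the theorem on almost everywhere
  -- convergence requires; the shift `n + 3` keeps the outer radius below `s`.
  let ρ : ℕ → ContDiffBump (0 : ℂ) := fun n =>
    ⟨s / (n + 3) / 2, s / (n + 3), by positivity, by
      have : 0 < s / (n + 3) := by positivity
      linarith⟩
  have hρs : ∀ n, (ρ n).rOut < s := fun n =>
    div_lt_self hs0 (by have : (0 : ℝ) ≤ n := n.cast_nonneg; linarith)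
  have hρ0 : Tendsto (fun n => (ρ n).rOut) atTop (𝓝 0) := by
    have : Tendsto (fun n : ℕ => (n : ℝ) + 3) atTop atTop :=
      tendsto_atTop_add_const_right _ _ tendsto_natCast_atTop_atTop
    exact this.const_div_atTop s
  have hae : ∀ᵐ x, Tendsto (fun n => mollify (ρ n) g x) atTop (𝓝 (g x)) :=
    ContDiffBump.ae_convolution_tendsto_right_of_locallyIntegrable (K := 2) hρ0
      (Eventually.of_forall fun n => le_of_eq (by simp only [ρ]; ring)) hgi.locallyIntegrable
  have hhol : ∀ n, DifferentiableOn ℂ (mollify (ρ n) g) (ball 0 (R + 2 * s)) := fun n =>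
    differentiableOn_mollify (by linarith) (hint _ (by linarith)) hh (ρ n)
      (by have := hρs n; linarith)
  set m : ℝ≥0∞ := ENNReal.ofReal (s ^ 2 * Real.pi) with hm
  have hm0 : m ≠ 0 := by
    rw [hm, Ne, ENNReal.ofReal_eq_zero, not_le]; positivity
  have hmt : m ≠ ⊤ := ENNReal.ofReal_ne_top
  have hbd : ∀ n, ∀ a ∈ ball (0 : ℂ) (R + s), ‖mollify (ρ n) g a‖ₑ ≤ (∫⁻ x, ‖g x‖ₑ) / m := by
    intro n a ha
    have hsub : ball a s ⊆ ball (0 : ℂ) (R + 2 * s) :=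
      ball_subset_ball' (by have := mem_ball.1 ha; linarith)
    have h1 := norm_le_lintegral_ball _ a s hs0 ((hhol n).mono hsub)
    rw [ENNReal.le_div_iff_mul_le (Or.inl hm0) (Or.inl hmt), mul_comm]
    exact h1.trans ((setLIntegral_le_lintegral _ _).trans (lintegral_mollify_le _ hgi))
  have hgfin : ∫⁻ x, ‖g x‖ₑ ≠ ⊤ := hgi.2.ne
  have hmeas : ∀ n, AEStronglyMeasurable (mollify (ρ n) g)
      (volume.restrict (ball (0 : ℂ) (R + s))) := fun n =>
    ((hhol n).continuousOn.mono (ball_subset_ball (by linarith))).aestronglyMeasurable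
      measurableSet_ball
  have hL1 : Tendsto (fun n => ∫⁻ x in ball (0 : ℂ) (R + s), ‖mollify (ρ n) g x - g x‖ₑ) atTop
      (𝓝 0) := by
    have := tendsto_lintegral_of_dominated_convergence'
      (μ := volume.restrict (ball (0 : ℂ) (R + s)))
      (F := fun n x => ‖mollify (ρ n) g x - g x‖ₑ) (f := fun _ => 0)
      (fun x => (∫⁻ x, ‖g x‖ₑ) / m + ‖g x‖ₑ)
      (fun n => ((hmeas n).sub hgi.1.restrict).enorm) ?_ ?_ ?_
    · simpa using this
    · intro n
      filter_upwards [ae_restrict_mem measurableSet_ball] with x hx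
      exact (enorm_sub_le).trans (by gcongr; exact hbd n x hx)
    · rw [lintegral_add_left' aemeasurable_const, setLIntegral_const]
      exact ENNReal.add_ne_top.2 ⟨ENNReal.mul_ne_top (ENNReal.div_ne_top hgfin hm0)
        measure_ball_lt_top.ne, ((setLIntegral_le_lintegral _ _).trans_lt hgi.2).ne⟩
    · filter_upwards [ae_restrict_of_ae hae] with x hx
      have := (hx.sub_const (g x)).enorm
      simpa using this
  have hU : UniformCauchySeqOn (fun n => mollify (ρ n) g) atTop (ball (0 : ℂ) R) := by
    rw [Metric.uniformCauchySeqOn_iff]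
    intro ε hε
    have hεm : 0 < ENNReal.ofReal (ε / 3) * m := by
      refine ENNReal.mul_pos ?_ hm0
      rw [Ne, ENNReal.ofReal_eq_zero, not_le]; positivity
    obtain ⟨N, hN⟩ := eventually_atTop.1 (hL1.eventually (gt_mem_nhds hεm))
    refine ⟨N, fun i hi j hj a ha => ?_⟩
    have hsub : ball a s ⊆ ball (0 : ℂ) (R + s) :=
      ball_subset_ball' (by have := mem_ball.1 ha; linarith)
    have hsub2 : ball (0 : ℂ) (R + s) ⊆ ball 0 (R + 2 * s) := ball_subset_ball (by linarith)
    have h1 := norm_le_lintegral_ball (fun x => mollify (ρ i) g x - mollify (ρ j) g x) a s hs0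
      (((hhol i).sub (hhol j)).mono (hsub.trans hsub2))
    have h2 : ∫⁻ x in ball a s, ‖mollify (ρ i) g x - mollify (ρ j) g x‖ₑ ≤
        ENNReal.ofReal (ε / 3) * m + ENNReal.ofReal (ε / 3) * m := by
      refine (lintegral_mono_set hsub).trans ?_
      refine le_trans ?_ (add_le_add (hN i hi).le (hN j hj).le)
      rw [← lintegral_add_left' (f := fun x => ‖mollify (ρ i) g x - g x‖ₑ)
        ((hmeas i).sub hgi.1.restrict).enorm]
      refine lintegral_mono fun x => ?_
      have : mollify (ρ i) g x - mollify (ρ j) g x =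
        (mollify (ρ i) g x - g x) - (mollify (ρ j) g x - g x) := by ring
      rw [this]
      exact enorm_sub_le
    have h3 : m * ‖mollify (ρ i) g a - mollify (ρ j) g a‖ₑ ≤
        m * ENNReal.ofReal (ε / 3 + ε / 3) := by
      refine (h1.trans h2).trans (le_of_eq ?_)
      rw [ENNReal.ofReal_add (by positivity) (by positivity)]; ring
    have h4 := (ENNReal.mul_le_mul_iff_right hm0 hmt).1 h3
    rw [← ofReal_norm, ENNReal.ofReal_le_ofReal_iff (by positivity)] at h4
    rw [dist_eq_norm]; linarith
  have hlim : ∀ a ∈ ball (0 : ℂ) R, ∃ l, Tendsto (fun n => mollify (ρ n) g a) atTop (𝓝 l) :=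
    fun a ha => cauchySeq_tendsto_of_complete (hU.cauchySeq ha)
  choose! F hF using hlim
  refine ⟨F, (hU.tendstoUniformlyOn_of_tendsto hF).tendstoLocallyUniformlyOn.differentiableOn
    (Eventually.of_forall fun n => (hhol n).mono (ball_subset_ball (by linarith))) isOpen_ball, ?_⟩
  filter_upwards [ae_restrict_of_ae hae, ae_restrict_mem measurableSet_ball] with x hx hxR
  have : g x = h x := Set.indicator_of_mem (ball_subset_ball (by linarith) hxR) h
  rw [← this]
  exact tendsto_nhds_unique hx (hF x hxR)

/-- Weyl's lemma: a locally integrable function on the disc which is weakly holomorphic agrees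
almost everywhere with a holomorphic function. -/
theorem exists_holomorphic_of_weak {h : ℂ → ℂ} (hint : ∀ r < 1, IntegrableOn h (ball 0 r))
    (hh : ∀ β, IsTest β → ∫ z in ball (0 : ℂ) 1, h z * dzb β z = 0) :
    ∃ F : ℂ → ℂ, DifferentiableOn ℂ F (ball 0 1) ∧ h =ᵐ[volume.restrict (ball 0 1)] F := by
  have hloc : ∀ R : ℝ, R < 1 → ∃ F : ℂ → ℂ, DifferentiableOn ℂ F (ball 0 R) ∧
      h =ᵐ[volume.restrict (ball 0 R)] F := fun R hR => exists_holomorphic_local hR hint hh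
  choose! F hF hFae using hloc
  have hcons : ∀ R R', R ≤ R' → R' < 1 → Set.EqOn (F R') (F R) (ball 0 R) := by
    intro R R' hRR hR'
    have hsub : ball (0 : ℂ) R ⊆ ball 0 R' := ball_subset_ball hRR
    refine Measure.eqOn_open_of_ae_eq (μ := volume) ?_ isOpen_ball
      ((hF R' hR').continuousOn.mono hsub) (hF R (hRR.trans_lt hR')).continuousOn
    filter_upwards [hFae R (hRR.trans_lt hR'), ae_restrict_of_ae_restrict_of_subset hsub
      (hFae R' hR')] with x h1 h2
    rw [← h1, ← h2]
  -- Gluing: the local solutions agree on common discs, and the radius `(1 + ‖x‖)/2` always has `x`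
  -- in its interior.
  set G : ℂ → ℂ := fun x => F ((1 + ‖x‖) / 2) x with hG
  have hGF : ∀ R < 1, Set.EqOn G (F R) (ball 0 R) := by
    intro R hR x hx
    have hx' : ‖x‖ < R := by simpa using hx
    rcases le_total ((1 + ‖x‖) / 2) R with h1 | h1
    · exact (hcons _ _ h1 hR (by rw [mem_ball_zero_iff]; linarith)).symm
    · exact hcons _ _ h1 (by linarith) hx
  refine ⟨G, fun x hx => ?_, ?_⟩
  · have hx' : ‖x‖ < 1 := by simpa using hx
    have hxm : x ∈ ball (0 : ℂ) ((1 + ‖x‖) / 2) := by rw [mem_ball_zero_iff]; linarith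
    have hn := isOpen_ball.mem_nhds hxm
    have hR : (1 + ‖x‖) / 2 < 1 := by linarith
    exact (((hF _ hR).differentiableAt hn).congr_of_eventuallyEq
      ((hGF _ hR).eventuallyEq_of_mem hn)).differentiableWithinAt
  · have hall : ∀ n : ℕ, ∀ᵐ x : ℂ, x ∈ ball (0 : ℂ) (1 - 1 / ((n : ℝ) + 1)) → h x = G x := by
      intro n
      have hlt : (1 : ℝ) - 1 / ((n : ℝ) + 1) < 1 := by
        have : (0 : ℝ) < 1 / ((n : ℝ) + 1) := by positivity
        linarith
      filter_upwards [(ae_restrict_iff' measurableSet_ball).1 (hFae _ hlt)] with x hx hxm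
      rw [hx hxm, hGF _ hlt hxm]
    rw [EventuallyEq, ae_restrict_iff' measurableSet_ball]
    filter_upwards [ae_all_iff.2 hall] with x hx hxm
    obtain ⟨n, hn⟩ := exists_nat_one_div_lt (show (0 : ℝ) < 1 - ‖x‖ by simpa using hxm)
    exact hx n (by rw [mem_ball_zero_iff]; linarith)

end Weyl

end BergmanWeight

namespace BergmanWeight

/-! ### The orthogonal complement of the Bergman space -/

variable (ω : BergmanWeight)

theorem contDiffOn_of_differentiableOn {F : ℂ → ℂ} (hF : DifferentiableOn ℂ F (ball 0 1)) :
    ContDiffOn ℝ 2 F (ball 0 1) :=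
  (hF.contDiffOn (n := 2) isOpen_ball).restrict_scalars ℝ

/-- The difference of the two integrands, times `e^{-p}`, is `-∂(e^{-p} g α)`. The pairing is
bilinear, so `∂` falls on `g`; with `g = φ · conj f` only `φ'` survives. -/
theorem integral_mul_dstar {ω : BergmanWeight} (hω : ContDiffOn ℝ 2 ω.potential (ball 0 1))
    {g α : ℂ → ℂ} (hg : ContDiffOn ℝ 2 g (ball 0 1)) (hα : IsTest α) :
    ∫ z, g z * ω.dstar α z ∂ω.measure = ∫ z, dz g z * α z ∂ω.measure := by
  have hDα := hα.compactlySupported_dstar hω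
  set E : ℂ → ℂ := fun z => ((Real.exp (-ω.potential z) : ℝ) : ℂ) with hE
  have hEc : ContDiffOn ℝ 2 E (ball 0 1) :=
    contDiffOn_ofReal (Real.contDiff_exp.comp_contDiffOn hω.neg)
  have hβ : IsTest fun z => (E z * g z) * α z := hα.mul (hEc.mul hg)
  have i1 := (hDα.mul hg.continuousOn).integrable ω
  have i2 := (hα.compactlySupported.mul (continuousOn_dz hg)).integrable ω
  rw [← sub_eq_zero, ← integral_sub i1 i2, ω.integral_measure_of_eq_zero, ← neg_eq_zero,
    ← integral_neg, ← integral_dz_eq_zero (hβ.contDiff.of_le (by norm_num)) hβ.hasCompactSupport]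
  · refine integral_congr_ae (Eventually.of_forall fun z => ?_)
    by_cases hz : z ∈ ball (0 : ℂ) 1
    · have hn := isOpen_ball.mem_nhds hz
      have dp := (hω.contDiffAt hn).differentiableAt (by norm_num)
      have dE := (hEc.contDiffAt hn).differentiableAt (by norm_num)
      have dg := (hg.contDiffAt hn).differentiableAt (by norm_num)
      have dα : DifferentiableAt ℝ α z := (hα.contDiff.differentiable (by norm_num)) z
      have e1 : dz E z = -(E z * dz (fun w => (ω.potential w : ℂ)) z) := by
        have := dz_ofReal_exp (p := fun w => -ω.potential w) (z := z) dp.neg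
        rw [dz_ofReal_neg] at this
        simp only [hE, this]; ring
      beta_reduce
      rw [dz_mul (dE.fun_mul dg) dα, dz_mul dE dg, e1, dstar, Complex.real_smul]
      simp only [hE]
      ring
    · simp [hDα.eq_zero hz, hα.compactlySupported.eq_zero hz,
        hβ.compactlySupported_dz.eq_zero hz]
  · intro z hz
    simp [hDα.eq_zero hz, hα.compactlySupported.eq_zero hz]

theorem dstar_add {α β : ℂ → ℂ} (hα : IsTest α) (hβ : IsTest β) (z : ℂ) :
    ω.dstar (fun z => α z + β z) z = ω.dstar α z + ω.dstar β z := by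
  simp only [dstar, dz_add ((hα.contDiff.differentiable (by norm_num)) z)
    ((hβ.contDiff.differentiable (by norm_num)) z)]
  ring

/-- The subspace of `L²_ω` formed by the images of test functions under the formal adjoint
of `∂̄`. -/
def dstarRange : Submodule ℂ ω.L2 where
  carrier := {x | ∃ α, IsTest α ∧ x =ᵐ[ω.measure] ω.dstar α}
  zero_mem' := by
    have h0 : IsTest fun _ => (0 : ℂ) :=
      ⟨contDiff_const, HasCompactSupport.zero, by simp [tsupport]⟩
    refine ⟨_, h0, ?_⟩
    filter_upwards [Lp.coeFn_zero ℂ 2 ω.measure] with z hz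
    rw [hz]; simp [dstar, dz]
  add_mem' := by
    rintro x y ⟨α, hα, hx⟩ ⟨β, hβ, hy⟩
    refine ⟨_, hα.add hβ, ?_⟩
    filter_upwards [Lp.coeFn_add x y, hx, hy] with z h1 h2 h3
    rw [h1, Pi.add_apply, h2, h3, ω.dstar_add hα hβ]
  smul_mem' := by
    rintro c x ⟨α, hα, hx⟩
    have hc : ContDiffOn ℝ 2 (fun _ : ℂ => c) (ball 0 1) := contDiffOn_const
    refine ⟨_, hα.mul hc, ?_⟩
    filter_upwards [Lp.coeFn_smul c x, hx] with z h1 h2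
    rw [h1, Pi.smul_apply, h2, ω.dstar_mul hα hc]
    simp [dz]

theorem inner_eq_integral {x y : ω.L2} {f g : ℂ → ℂ} (hx : x =ᵐ[ω.measure] f)
    (hy : y =ᵐ[ω.measure] g) : ⟪x, y⟫_ℂ = ∫ z, conj (f z) * g z ∂ω.measure := by
  rw [L2.inner_def]
  refine integral_congr_ae ?_
  filter_upwards [hx, hy] with z h1 h2
  rw [h1, h2, RCLike.inner_apply, mul_comm]

theorem norm_sq_eq_integral {x : ω.L2} {f : ℂ → ℂ} (hx : x =ᵐ[ω.measure] f) :
    ‖x‖ ^ 2 = ∫ z, ‖f z‖ ^ 2 ∂ω.measure := by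
  have h := inner_self_eq_norm_sq_to_K (𝕜 := ℂ) x
  rw [ω.inner_eq_integral hx hx] at h
  have e : ∀ z, conj (f z) * f z = ((‖f z‖ ^ 2 : ℝ) : ℂ) := fun z => by
    rw [Complex.conj_mul']; push_cast; rfl
  simp only [e] at h
  rw [integral_complex_ofReal] at h
  refine Complex.ofReal_injective (Eq.trans ?_ h.symm)
  push_cast; rfl

variable {ω}

/-- The measure is finite, so `v` is integrable for `ω dA`; on a smaller disc the continuous factor
`e^p` removes the weight. -/
theorem integrableOn_of_L2 (hω : ContDiffOn ℝ 2 ω.potential (ball 0 1)) (v : ω.L2) (r : ℝ)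
    (hr : r < 1) : IntegrableOn v (ball 0 r) := by
  have h1 : Integrable v ω.measure := (Lp.memLp v).integrable (by norm_num)
  have h2 : IntegrableOn (fun z => ω.toFun z • v z) (ball 0 1) := by
    have h3 : IntegrableOn (fun z => (ENNReal.ofReal (ω.toFun z)).toReal • v z) (ball 0 1) :=
      (integrable_withDensity_iff_integrable_smul₀'
        ω.integrable.aemeasurable.ennreal_ofReal
        (Eventually.of_forall fun _ => ENNReal.ofReal_lt_top)).1 h1
    refine h3.congr_fun (fun z hz => ?_) measurableSet_ball
    simp only [ENNReal.toReal_ofReal (ω.pos z hz).le]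
  have hsub : closedBall (0 : ℂ) r ⊆ ball 0 1 := closedBall_subset_ball hr
  have h4 := (h2.mono_set hsub).continuousOn_mul (g := fun z => ((Real.exp (ω.potential z) : ℝ) : ℂ))
    (Complex.continuous_ofReal.comp_continuousOn
      (Real.continuous_exp.comp_continuousOn (hω.continuousOn.mono hsub)))
    (isCompact_closedBall _ _)
  have h5 : IntegrableOn v (closedBall 0 r) := by
    refine h4.congr_fun (fun z hz => ?_) isClosed_closedBall.measurableSet
    have h6 := ω.exp_neg_potential (hsub hz)
    simp only [Complex.real_smul]
    rw [← h6, ← mul_assoc, ← Complex.ofReal_mul, ← Real.exp_add]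
    simp
  exact h5.mono_set ball_subset_closedBall

theorem mem_A2_of_orthogonal (hω : ContDiffOn ℝ 2 ω.potential (ball 0 1)) {v : ω.L2}
    (hv : v ∈ ω.dstarRangeᗮ) : v ∈ ω.A2 := by
  obtain ⟨F, hF, hvF⟩ := exists_holomorphic_of_weak (h := v)
    (fun r hr => integrableOn_of_L2 hω v r hr) (fun β hβ => by
      have hβc : IsTest fun z => conj (β z) :=
        ⟨Complex.conjCLE.contDiff.comp hβ.contDiff,
          hβ.hasCompactSupport.comp_left (g := fun z : ℂ => conj z) (by simp), by
          have : (tsupport fun z => conj (β z)) = tsupport β := by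
            simp only [tsupport]; congr 1; ext; simp
          rw [this]; exact hβ.tsupport_subset⟩
      have hE : ContDiffOn ℝ 2 (fun z => ((Real.exp (ω.potential z) : ℝ) : ℂ)) (ball 0 1) :=
        contDiffOn_ofReal (Real.contDiff_exp.comp_contDiffOn hω)
      -- For `α = e^p · conj β` the terms in `∂p` cancel and `ω · conj (D α) = -∂̄β`. Orthogonality
      -- to `D α` thus becomes the unweighted weak Cauchy–Riemann equation.
      have hα := hβc.mul hE
      have hD := (hα.compactlySupported_dstar hω).memLp ω
      have h0 := (Submodule.mem_orthogonal _ _).1 hv (hD.toLp _) ⟨_, hα, hD.coeFn_toLp⟩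
      rw [ω.inner_eq_integral hD.coeFn_toLp (EventuallyEq.refl _ _), ω.integral_measure] at h0
      rw [← neg_eq_zero, ← integral_neg]
      refine Eq.trans ?_ h0
      refine setIntegral_congr_fun measurableSet_ball fun z hz => ?_
      have hn := isOpen_ball.mem_nhds hz
      have dp := (hω.contDiffAt hn).differentiableAt (by norm_num)
      have dE := (hE.contDiffAt hn).differentiableAt (by norm_num)
      have dβ : DifferentiableAt ℝ (fun z => conj (β z)) z :=
        (hβc.contDiff.differentiable (by norm_num)) z
      have hone : (ω.toFun z : ℂ) * ((Real.exp (ω.potential z) : ℝ) : ℂ) = 1 := by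
        rw [← ω.exp_neg_potential hz, ← Complex.ofReal_mul, ← Real.exp_add]; simp
      simp only [dstar, dz_mul dE dβ, dz_conj, dz_ofReal_exp dp, Complex.real_smul, map_add,
        map_mul, map_neg, Complex.conj_conj, Complex.conj_ofReal]
      linear_combination (v z * dzb β z) * hone)
  exact ⟨F, hF, (withDensity_absolutelyContinuous _ _).ae_le hvF⟩

/-- Duality applied to `mem_A2_of_orthogonal`: elements orthogonal to `A²_ω` are `L²` limits of
functions `D α` with `α` a test function, so closed conditions on them need only be checked on such
functions. -/
theorem orthogonal_A2_le (hω : ContDiffOn ℝ 2 ω.potential (ball 0 1)) :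
    ω.A2ᗮ ≤ ω.dstarRange.topologicalClosure := by
  rw [← Submodule.orthogonal_orthogonal_eq_closure]
  exact Submodule.orthogonal_le fun v hv => mem_A2_of_orthogonal hω hv

/-- Integration by parts against `φ̄ f`. -/
theorem inner_mulConj_dstar (hω : ContDiffOn ℝ 2 ω.potential (ball 0 1)) {φ : ℂ → ℂ}
    (hφ : DifferentiableOn ℂ φ (ball 0 1)) (f : ω.A2) {b x : ω.L2}
    (hb : b =ᵐ[ω.measure] fun z => conj (φ z) * (f : ω.L2) z) {α : ℂ → ℂ} (hα : IsTest α)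
    (hx : x =ᵐ[ω.measure] ω.dstar α) :
    ⟪b, x⟫_ℂ = ∫ z, deriv φ z * conj (ω.rep f z) * α z ∂ω.measure := by
  have hb' : b =ᵐ[ω.measure] fun z => conj (φ z) * ω.rep f z := by
    filter_upwards [hb, ω.coe_ae_eq_rep f] with z h1 h2
    rw [h1, h2]
  have hf := ω.rep_differentiableOn f
  have hfc : ContDiffOn ℝ 2 (fun z => conj (ω.rep f z)) (ball 0 1) :=
    Complex.conjCLE.contDiff.comp_contDiffOn (contDiffOn_of_differentiableOn hf)
  rw [ω.inner_eq_integral hb' hx]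
  have h1 := integral_mul_dstar hω ((contDiffOn_of_differentiableOn hφ).mul hfc) hα
  simp only [map_mul, Complex.conj_conj]
  rw [h1]
  refine integral_congr_ae ?_
  filter_upwards [ω.ae_mem_ball] with z hz
  have hn := isOpen_ball.mem_nhds hz
  have d1 := (hφ.differentiableAt hn)
  have d2 := (hfc.contDiffAt hn).differentiableAt (by norm_num)
  rw [dz_mul (d1.restrictScalars ℝ) d2, dz_holomorphic d1, dz_conj,
    dzb_holomorphic (hf.differentiableAt hn)]
  simp

/-- The integration by parts formula with symbol `1`, whose derivative vanishes. -/
theorem dstarRange_le (hω : ContDiffOn ℝ 2 ω.potential (ball 0 1)) : ω.dstarRange ≤ ω.A2ᗮ := by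
  rintro x ⟨α, hα, hx⟩
  refine (Submodule.mem_orthogonal _ _).2 fun f hf => ?_
  rw [inner_mulConj_dstar hω (φ := fun _ => 1) (differentiableOn_const 1) ⟨f, hf⟩ (by simp) hα hx]
  simp

/-- The norm estimate for the canonical solution `φ̄ f - P_ω (φ̄ f)`. -/
theorem norm_sub_starProjection_sq_le (hω : ContDiffOn ℝ 2 ω.potential (ball 0 1))
    {M : ℂ → ℝ} (hMc : ContinuousOn M (ball 0 1)) (hM : ∀ z ∈ ball (0 : ℂ) 1, 0 < M z)
    {A : ℝ} (hA : 0 < A)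
    (hap : ∀ α, IsTest α →
      ∫ z, M z * ‖α z‖ ^ 2 ∂ω.measure ≤ A * ∫ z, ‖ω.dstar α z‖ ^ 2 ∂ω.measure)
    {φ : ℂ → ℂ} (hφ : DifferentiableOn ℂ φ (ball 0 1)) (f : ω.A2) {b : ω.L2}
    (hb : b =ᵐ[ω.measure] fun z => conj (φ z) * (f : ω.L2) z)
    (hint : Integrable (fun z => ‖deriv φ z‖ ^ 2 / M z * ‖ω.rep f z‖ ^ 2) ω.measure) :
    ‖b - ω.A2.starProjection b‖ ^ 2 ≤
      A * ∫ z, ‖deriv φ z‖ ^ 2 / M z * ‖ω.rep f z‖ ^ 2 ∂ω.measure := by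
  set J := ∫ z, ‖deriv φ z‖ ^ 2 / M z * ‖ω.rep f z‖ ^ 2 ∂ω.measure with hJ
  set v := b - ω.A2.starProjection b with hv
  have hvo : v ∈ ω.A2ᗮ := Submodule.sub_starProjection_mem_orthogonal b
  have key : ∀ x ∈ ω.dstarRange, (⟪v, x⟫_ℂ).re ≤ A / 2 * J + 1 / 2 * ‖x‖ ^ 2 := by
    rintro x ⟨α, hα, hx⟩
    have h1 : ⟪v, x⟫_ℂ = ⟪b, x⟫_ℂ := by
      have hxo := dstarRange_le hω ⟨α, hα, hx⟩
      have h2 : ⟪ω.A2.starProjection b, x⟫_ℂ = 0 :=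
        (Submodule.mem_orthogonal _ _).1 hxo _ (Submodule.starProjection_apply_mem _ b)
      rw [hv, inner_sub_left, h2, sub_zero]
    rw [h1, inner_mulConj_dstar hω hφ f hb hα hx, ω.norm_sq_eq_integral hx]
    have iα : Integrable (fun z => M z * ‖α z‖ ^ 2) ω.measure :=
      hα.compactlySupported.integrable_mul_sq ω hMc
    calc (∫ z, deriv φ z * conj (ω.rep f z) * α z ∂ω.measure).re
        ≤ ‖∫ z, deriv φ z * conj (ω.rep f z) * α z ∂ω.measure‖ := Complex.re_le_norm _
      _ ≤ ∫ z, (A / 2 * (‖deriv φ z‖ ^ 2 / M z * ‖ω.rep f z‖ ^ 2) +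
            1 / (2 * A) * (M z * ‖α z‖ ^ 2)) ∂ω.measure := by
          refine norm_integral_le_of_norm_le ((hint.const_mul _).add (iα.const_mul _)) ?_
          filter_upwards [ω.ae_mem_ball] with z hz
          have hMz := hM z hz
          rw [norm_mul, norm_mul, RCLike.norm_conj]
          -- Weighted AM-GM; the factor `1/(2A)` on the second term is chosen so that the a priori
          -- estimate returns exactly `½‖x‖²`.
          have : A / 2 * (‖deriv φ z‖ ^ 2 / M z * ‖ω.rep f z‖ ^ 2) +
              1 / (2 * A) * (M z * ‖α z‖ ^ 2) - ‖deriv φ z‖ * ‖ω.rep f z‖ * ‖α z‖ =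
              (A * ‖deriv φ z‖ * ‖ω.rep f z‖ - M z * ‖α z‖) ^ 2 / (2 * A * M z) := by
            field_simp; ring
          have h0 : 0 ≤ (A * ‖deriv φ z‖ * ‖ω.rep f z‖ - M z * ‖α z‖) ^ 2 / (2 * A * M z) := by
            positivity
          linarith
      _ = A / 2 * J + 1 / (2 * A) * ∫ z, M z * ‖α z‖ ^ 2 ∂ω.measure := by
          rw [integral_add (hint.const_mul _) (iα.const_mul _), integral_const_mul,
            integral_const_mul]
      _ ≤ _ := by
          have h2 := hap α hα
          have h3 : 1 / (2 * A) * ∫ z, M z * ‖α z‖ ^ 2 ∂ω.measure ≤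
              1 / (2 * A) * (A * ∫ z, ‖ω.dstar α z‖ ^ 2 ∂ω.measure) := by gcongr
          have h4 : 1 / (2 * A) * (A * ∫ z, ‖ω.dstar α z‖ ^ 2 ∂ω.measure) =
              1 / 2 * ∫ z, ‖ω.dstar α z‖ ^ 2 ∂ω.measure := by field_simp
          linarith
  -- The inequality is closed in `x`, hence holds at `x = v`, where `½‖v‖²` is absorbed. The test
  -- functions themselves need not converge.
  have hcl : IsClosed {x : ω.L2 | (⟪v, x⟫_ℂ).re ≤ A / 2 * J + 1 / 2 * ‖x‖ ^ 2} :=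
    isClosed_le (Complex.continuous_re.comp (continuous_const.inner continuous_id)) (by fun_prop)
  have hmem : (⟪v, v⟫_ℂ).re ≤ A / 2 * J + 1 / 2 * ‖v‖ ^ 2 :=
    closure_minimal key hcl (orthogonal_A2_le hω hvo)
  have h5 : (⟪v, v⟫_ℂ).re = ‖v‖ ^ 2 := by
    rw [inner_self_eq_norm_sq_to_K]; norm_cast
  rw [h5] at hmem
  linarith

end BergmanWeight

namespace BergmanWeight

/-! ### Mean values of holomorphic functions over discs -/

theorem integral_circleMap_eq {F : ℂ → ℂ} {a : ℂ} {R ρ : ℝ} (h0 : 0 ≤ ρ) (hR : ρ < R)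
    (hF : DifferentiableOn ℂ F (ball a R)) :
    ∫ θ in Set.Ioo (-Real.pi) Real.pi, F (circleMap a ρ θ) = (2 * Real.pi : ℝ) * F a := by
  have hd : DiffContOnCl ℂ F (ball a |ρ|) := by
    rw [abs_of_nonneg h0]
    exact ⟨hF.mono (ball_subset_ball hR.le), hF.continuousOn.mono
      (closure_ball_subset_closedBall.trans (closedBall_subset_ball hR))⟩
  have h := hd.circleAverage
  have hp : Function.Periodic (fun θ => F (circleMap a ρ θ)) (2 * Real.pi) := by
    intro θ; simp only [periodic_circleMap a ρ θ]
  have h2 : (∫ θ in (0:ℝ)..2 * Real.pi, F (circleMap a ρ θ)) =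
      ∫ θ in (-Real.pi)..Real.pi, F (circleMap a ρ θ) := by
    have := hp.intervalIntegral_add_eq 0 (-Real.pi)
    rw [zero_add, show -Real.pi + 2 * Real.pi = Real.pi by ring] at this
    exact this
  rw [Real.circleAverage_def, h2, intervalIntegral.integral_of_le (by linarith [Real.pi_pos]),
    integral_Ioc_eq_integral_Ioo] at h
  rw [← h, Complex.real_smul, ← mul_assoc, ← Complex.ofReal_mul, mul_inv_cancel₀ (by positivity)]
  simp

/-- The mean value property on discs, with a radial weight. -/
theorem integral_ball_radial {F : ℂ → ℂ} {a : ℂ} {R r : ℝ} (hr : 0 < r) (hR : r < R)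
    (hF : DifferentiableOn ℂ F (ball a R)) (k : ℕ) :
    ∫ z in ball a r, ((‖z - a‖ ^ k : ℝ) : ℂ) * F z =
      ((2 * Real.pi * (r ^ (k + 2) / (k + 2)) : ℝ) : ℂ) * F a := by
  set f : ℂ → ℂ := (ball a r).indicator fun z => ((‖z - a‖ ^ k : ℝ) : ℂ) * F z with hf
  have h1 : ∫ z in ball a r, ((‖z - a‖ ^ k : ℝ) : ℂ) * F z = ∫ z, f (a + z) := by
    rw [← integral_indicator measurableSet_ball, integral_add_left_eq_self f a]
  rw [h1, ← Complex.integral_comp_polarCoord_symm, polarCoord_target]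
  have hsplit : ∫ p in Set.Ioi (0 : ℝ) ×ˢ Set.Ioo (-Real.pi) Real.pi,
        p.1 • f (a + Complex.polarCoord.symm p) =
      ∫ p in Set.Ioo (0 : ℝ) r ×ˢ Set.Ioo (-Real.pi) Real.pi,
        ((p.1 ^ (k + 1) : ℝ) : ℂ) * F (circleMap a p.1 p.2) := by
    have e : ∀ p ∈ Set.Ioi (0 : ℝ) ×ˢ Set.Ioo (-Real.pi) Real.pi,
        p.1 • f (a + Complex.polarCoord.symm p) =
        (Set.Ioo (0 : ℝ) r ×ˢ Set.Ioo (-Real.pi) Real.pi).indicator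
          (fun p : ℝ × ℝ => ((p.1 ^ (k + 1) : ℝ) : ℂ) * F (circleMap a p.1 p.2)) p := by
      rintro ⟨ρ, θ⟩ ⟨hρ, hθ⟩
      have hρ0 : 0 < ρ := hρ
      have e : a + Complex.polarCoord.symm (ρ, θ) = circleMap a ρ θ := by
        rw [Complex.polarCoord_symm_apply, circleMap, Complex.exp_mul_I]
        push_cast; rfl
      have hn : ‖circleMap a ρ θ - a‖ = ρ := by
        simp [circleMap, abs_of_pos hρ0]
      simp only [e]
      by_cases hρr : ρ < r
      · rw [Set.indicator_of_mem (show (ρ, θ) ∈ Set.Ioo 0 r ×ˢ Set.Ioo (-Real.pi) Real.pi from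
          ⟨⟨hρ0, hρr⟩, hθ⟩), hf, Set.indicator_of_mem (by rwa [mem_ball, dist_eq_norm, hn]), hn,
          Complex.real_smul]
        push_cast; ring
      · rw [Set.indicator_of_notMem (fun h : (ρ, θ) ∈ Set.Ioo 0 r ×ˢ _ => hρr h.1.2), hf,
          Set.indicator_of_notMem (by rwa [mem_ball, dist_eq_norm, hn]), smul_zero]
    rw [setIntegral_congr_fun (measurableSet_Ioi.prod measurableSet_Ioo) e,
      setIntegral_indicator (measurableSet_Ioo.prod measurableSet_Ioo)]
    congr 2
    exact Set.inter_eq_right.2 (Set.prod_mono_left Set.Ioo_subset_Ioi_self)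
  have hcont : ContinuousOn (fun p : ℝ × ℝ => ((p.1 ^ (k + 1) : ℝ) : ℂ) * F (circleMap a p.1 p.2))
      (Set.Icc 0 r ×ˢ Set.Icc (-Real.pi) Real.pi) := by
    refine ContinuousOn.mul (by fun_prop) (hF.continuousOn.comp ?_ ?_)
    · unfold circleMap; fun_prop
    · rintro ⟨ρ, θ⟩ ⟨hρ, -⟩
      have := circleMap_mem_sphere a hρ.1 θ
      rw [mem_ball, mem_sphere.1 this]
      exact hρ.2.trans_lt hR
  have hint : IntegrableOn (fun p : ℝ × ℝ => ((p.1 ^ (k + 1) : ℝ) : ℂ) * F (circleMap a p.1 p.2))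
      (Set.Ioo 0 r ×ˢ Set.Ioo (-Real.pi) Real.pi) (volume.prod volume) :=
    (hcont.integrableOn_compact (isCompact_Icc.prod isCompact_Icc)).mono_set
      (Set.prod_mono Set.Ioo_subset_Icc_self Set.Ioo_subset_Icc_self)
  rw [hsplit, Measure.volume_eq_prod, setIntegral_prod _ hint]
  have e2 : ∀ ρ ∈ Set.Ioo (0 : ℝ) r, ∫ θ in Set.Ioo (-Real.pi) Real.pi,
      ((ρ ^ (k + 1) : ℝ) : ℂ) * F (circleMap a ρ θ) =
      ((ρ ^ (k + 1) : ℝ) : ℂ) * ((2 * Real.pi : ℝ) * F a) := by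
    intro ρ hρ
    rw [integral_const_mul, integral_circleMap_eq hρ.1.le (hρ.2.trans hR) hF]
  rw [setIntegral_congr_fun measurableSet_Ioo e2, integral_mul_const, integral_complex_ofReal,
    ← integral_Ioc_eq_integral_Ioo, ← intervalIntegral.integral_of_le hr.le, integral_pow]
  push_cast
  rw [zero_pow (by omega)]
  ring

end BergmanWeight

namespace BergmanWeight

/-! ### Weighted bounds for the Bergman projection and admissibility of Bloch symbols -/

variable {ω : BergmanWeight}

theorem aestronglyMeasurable_of_continuousOn {V : Type*} [TopologicalSpace V]
    [TopologicalSpace.PseudoMetrizableSpace V] [SecondCountableTopologyEither ℂ V] {f : ℂ → V}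
    (hf : ContinuousOn f (ball 0 1)) : AEStronglyMeasurable f ω.measure :=
  (hf.aestronglyMeasurable measurableSet_ball).mono_ac (withDensity_absolutelyContinuous _ _)

theorem integrable_L2_sq (x : ω.L2) : Integrable (fun z => ‖x z‖ ^ 2) ω.measure :=
  (Lp.memLp x).integrable_norm_pow (p := 2) two_ne_zero

theorem integrable_mul_L2_sq {w : ℂ → ℝ} (hw : ContinuousOn w (ball 0 1)) {B : ℝ}
    (hB : ∀ z ∈ ball (0 : ℂ) 1, |w z| ≤ B) (x : ω.L2) :
    Integrable (fun z => w z * ‖x z‖ ^ 2) ω.measure := by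
  refine (integrable_L2_sq x).bdd_mul (c := B) (aestronglyMeasurable_of_continuousOn hw) ?_
  filter_upwards [ω.ae_mem_ball] with z hz using hB z hz

theorem re_inner_le_integral {x y : ω.L2} {h : ℂ → ℝ} (hh : Integrable h ω.measure)
    (hxy : ∀ᵐ z ∂ω.measure, ‖x z‖ * ‖y z‖ ≤ h z) : (⟪x, y⟫_ℂ).re ≤ ∫ z, h z ∂ω.measure := by
  refine (Complex.re_le_norm _).trans ?_
  rw [ω.inner_eq_integral (EventuallyEq.refl _ _) (EventuallyEq.refl _ _)]
  refine norm_integral_le_of_norm_le hh ?_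
  filter_upwards [hxy] with z hz
  rwa [norm_mul, RCLike.norm_conj]

theorem integral_linear_combination {f g : ℂ → ℝ} (hf : Integrable f ω.measure)
    (hg : Integrable g ω.measure) (a b : ℝ) :
    Integrable (fun z => a * f z + b * g z) ω.measure ∧
      ∫ z, (a * f z + b * g z) ∂ω.measure =
        a * ∫ z, f z ∂ω.measure + b * ∫ z, g z ∂ω.measure := by
  refine ⟨(hf.const_mul a).add (hg.const_mul b), ?_⟩
  rw [integral_add (hf.const_mul a) (hg.const_mul b), integral_const_mul, integral_const_mul]

theorem norm_mul_dz_sq_le {M w : ℂ → ℝ} {k : ℝ} {z : ℂ}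
    (hdw : ‖dz (fun z => (w z : ℂ)) z‖ ^ 2 ≤ k * (M z * w z ^ 2)) (c : ℂ) :
    ‖c * dz (fun z => (w z : ℂ)) z‖ ^ 2 ≤ k * (M z * ‖(w z : ℂ) * c‖ ^ 2) := by
  rw [norm_mul, norm_mul, mul_pow, mul_pow, Complex.norm_real, Real.norm_eq_abs, sq_abs]
  nlinarith [sq_nonneg ‖c‖]

/-- The a priori estimate with a slowly varying weight. -/
theorem integral_weight_apriori (hω : ContDiffOn ℝ 2 ω.potential (ball 0 1))
    {M : ℂ → ℝ} (hMc : ContinuousOn M (ball 0 1)) (hM : ∀ z ∈ ball (0 : ℂ) 1, 0 < M z)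
    {A : ℝ} (hA : 0 < A)
    (hap : ∀ α, IsTest α →
      ∫ z, M z * ‖α z‖ ^ 2 ∂ω.measure ≤ A * ∫ z, ‖ω.dstar α z‖ ^ 2 ∂ω.measure)
    {w : ℂ → ℝ} (hw : ContDiffOn ℝ 2 w (ball 0 1)) {k : ℝ} (hk : 320 * (k * A) ≤ 1)
    (hdw : ∀ z ∈ ball (0 : ℂ) 1, ‖dz (fun z => (w z : ℂ)) z‖ ^ 2 ≤ k * (M z * w z ^ 2))
    {α : ℂ → ℂ} (hα : IsTest α) :
    ∫ z, M z * ‖(w z : ℂ) * α z‖ ^ 2 ∂ω.measure ≤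
      4 * A * ∫ z, ‖(w z : ℂ) * ω.dstar α z‖ ^ 2 ∂ω.measure := by
  have hD := hα.compactlySupported_dstar hω
  have hwc : ContDiffOn ℝ 2 (fun z => (w z : ℂ)) (ball 0 1) := contDiffOn_ofReal hw
  set X := ∫ z, ‖(w z : ℂ) * ω.dstar α z‖ ^ 2 ∂ω.measure with hX
  set Y := ∫ z, M z * ‖(w z : ℂ) * α z‖ ^ 2 ∂ω.measure with hY
  have hwα : IsTest fun z => (w z : ℂ) * α z := hα.mul hwc
  have iX : Integrable (fun z => ‖(w z : ℂ) * ω.dstar α z‖ ^ 2) ω.measure :=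
    (hD.mul hwc.continuousOn).integrable_sq ω
  have iY : Integrable (fun z => M z * ‖(w z : ℂ) * α z‖ ^ 2) ω.measure :=
    hwα.compactlySupported.integrable_mul_sq ω hMc
  have hX0 : 0 ≤ X := integral_nonneg fun z => by positivity
  have h1 := hap _ hwα
  have h2 : ∫ z, ‖ω.dstar (fun z => (w z : ℂ) * α z) z‖ ^ 2 ∂ω.measure ≤
      2 * X + (2 * k) * Y := by
    rw [← (integral_linear_combination iX iY _ _).2]
    refine integral_mono_ae ((hwα.compactlySupported_dstar hω).integrable_sq ω)
      (integral_linear_combination iX iY _ _).1 ?_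
    filter_upwards [ω.ae_mem_ball] with z hz
    rw [ω.dstar_mul hα hwc, sub_eq_add_neg]
    refine (norm_add_sq_le one_pos).trans ?_
    rw [norm_neg]
    have := norm_mul_dz_sq_le (hdw z hz) (α z)
    linarith
  have h3 : A * ∫ z, ‖ω.dstar (fun z => (w z : ℂ) * α z) z‖ ^ 2 ∂ω.measure ≤
      A * (2 * X + 2 * k * Y) := by gcongr
  have hY0 : 0 ≤ Y := integral_nonneg_of_ae (by
    filter_upwards [ω.ae_mem_ball] with z hz
    have := hM z hz
    positivity)
  -- From `Y ≤ A(2X + 2kY)` and `2kA ≤ 1/160` the `Y` term is absorbed, leaving room to spare in the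
  -- constant `4A`.
  nlinarith [mul_le_mul_of_nonneg_right hk hY0]

/-- The projection onto `(A²_ω)ᗮ` is bounded, uniformly, with respect to slowly varying weights. -/
theorem integral_weight_sub_starProjection_le (hω : ContDiffOn ℝ 2 ω.potential (ball 0 1))
    {M : ℂ → ℝ} (hMc : ContinuousOn M (ball 0 1)) (hM : ∀ z ∈ ball (0 : ℂ) 1, 0 < M z)
    {A : ℝ} (hA : 0 < A)
    (hap : ∀ α, IsTest α →
      ∫ z, M z * ‖α z‖ ^ 2 ∂ω.measure ≤ A * ∫ z, ‖ω.dstar α z‖ ^ 2 ∂ω.measure)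
    {w : ℂ → ℝ} (hw : ContDiffOn ℝ 2 w (ball 0 1)) (hw0 : ∀ z ∈ ball (0 : ℂ) 1, 0 ≤ w z) {B : ℝ}
    (hB : ∀ z ∈ ball (0 : ℂ) 1, w z ≤ B) {k : ℝ} (hk0 : 0 ≤ k) (hk : 320 * (k * A) ≤ 1)
    (hdw : ∀ z ∈ ball (0 : ℂ) 1, ‖dz (fun z => (w z : ℂ)) z‖ ^ 2 ≤ k * (M z * w z ^ 2))
    (g : ω.L2) :
    ∫ z, w z ^ 2 * ‖(g - ω.A2.starProjection g : ω.L2) z‖ ^ 2 ∂ω.measure ≤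
      16 * ∫ z, w z ^ 2 * ‖g z‖ ^ 2 ∂ω.measure := by
  set u : ω.L2 := g - ω.A2.starProjection g with hu
  have huo : u ∈ ω.A2ᗮ := Submodule.sub_starProjection_mem_orthogonal g
  have hwc : ContDiffOn ℝ 2 (fun z => (w z : ℂ)) (ball 0 1) := contDiffOn_ofReal hw
  have hw2 : ContinuousOn (fun z => w z ^ 2) (ball 0 1) := hw.continuousOn.pow 2
  have hB2 : ∀ z ∈ ball (0 : ℂ) 1, |w z ^ 2| ≤ B ^ 2 := fun z hz => by
    have := hw0 z hz
    rw [abs_of_nonneg (by positivity)]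
    exact pow_le_pow_left₀ this (hB z hz) 2
  have iw : ∀ x : ω.L2, Integrable (fun z => w z ^ 2 * ‖x z‖ ^ 2) ω.measure := fun x =>
    integrable_mul_L2_sq hw2 hB2 x
  set G := ∫ z, w z ^ 2 * ‖g z‖ ^ 2 ∂ω.measure with hG
  set U := ∫ z, w z ^ 2 * ‖u z‖ ^ 2 ∂ω.measure with hU
  -- The bound `B` occurs only in an error term that vanishes as `x → u`; the final constant `16`
  -- does not depend on it, which is what later permits the removal of the truncation.
  have key : ∀ x ∈ ω.dstarRange, U ≤ 16 * G + 18 * (B ^ 2 * ‖x - u‖ ^ 2) := by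
    rintro x ⟨α, hα, hx⟩
    have hD := hα.compactlySupported_dstar hω
    set e : ω.L2 := x - u with he
    have hee : e =ᵐ[ω.measure] fun z => ω.dstar α z - u z := by
      filter_upwards [Lp.coeFn_sub x u, hx] with z h1 h2
      rw [h1, Pi.sub_apply, h2]
    set E := ∫ z, w z ^ 2 * ‖e z‖ ^ 2 ∂ω.measure with hE
    set X := ∫ z, ‖(w z : ℂ) * ω.dstar α z‖ ^ 2 ∂ω.measure with hX
    set Y := ∫ z, M z * ‖(w z : ℂ) * α z‖ ^ 2 ∂ω.measure with hY
    have hwα : IsTest fun z => (w z : ℂ) * α z := hα.mul hwc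
    have hwwα : IsTest fun z => ((w z : ℂ) * (w z : ℂ)) * α z := hα.mul (hwc.mul hwc)
    have iX : Integrable (fun z => ‖(w z : ℂ) * ω.dstar α z‖ ^ 2) ω.measure :=
      (hD.mul hwc.continuousOn).integrable_sq ω
    have iY : Integrable (fun z => M z * ‖(w z : ℂ) * α z‖ ^ 2) ω.measure :=
      hwα.compactlySupported.integrable_mul_sq ω hMc
    have hX0 : 0 ≤ X := integral_nonneg fun z => by positivity
    have hE0 : E ≤ B ^ 2 * ‖e‖ ^ 2 := by
      rw [ω.norm_sq_eq_integral (EventuallyEq.refl _ e), ← integral_const_mul]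
      refine integral_mono_ae (iw e) ((integrable_L2_sq e).const_mul _) ?_
      filter_upwards [ω.ae_mem_ball] with z hz
      have := (abs_le.1 (hB2 z hz)).2
      gcongr
    have hdw' := fun z hz => norm_mul_dz_sq_le (hdw z hz) (α z)
    have hYX : Y ≤ 4 * A * X := integral_weight_apriori hω hMc hM hA hap hw hk hdw hα
    have hXY := integral_linear_combination iX iY
    set T : ℂ → ℂ := ω.dstar fun z => ((w z : ℂ) * (w z : ℂ)) * α z with hT
    have hTm := (hwwα.compactlySupported_dstar hω).memLp ω
    set S : ℂ → ℂ := fun z => (2 * (w z : ℂ) * dz (fun z => (w z : ℂ)) z) * α z with hS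
    have hSm := (hα.compactlySupported.mul ((continuousOn_const.mul hwc.continuousOn).mul
      (continuousOn_dz hwc))).memLp ω (f := S)
    set y : ω.L2 := hTm.toLp T with hy
    set s : ω.L2 := hSm.toLp S with hs
    have hyT : y =ᵐ[ω.measure] T := hTm.coeFn_toLp
    have hsS : s =ᵐ[ω.measure] S := hSm.coeFn_toLp
    have hTS : ∀ z ∈ ball (0 : ℂ) 1, T z + S z = (w z : ℂ) * ((w z : ℂ) * ω.dstar α z) ∧
        T z = (w z : ℂ) * ((w z : ℂ) * ω.dstar α z - 2 * (α z * dz (fun z => (w z : ℂ)) z)) := by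
      intro z hz
      have dw := (hwc.contDiffAt (isOpen_ball.mem_nhds hz)).differentiableAt (by norm_num)
      have : T z = (w z : ℂ) * ((w z : ℂ) * ω.dstar α z - 2 * (α z * dz (fun z => (w z : ℂ)) z)) := by
        rw [hT, ω.dstar_mul hα (hwc.mul hwc), dz_mul dw dw]; ring
      refine ⟨?_, this⟩
      rw [this, hS]; ring
    -- Here `X = ⟪x, w² x⟫` and `w² D α = y + s`, where `y = D(w² α)` is orthogonal to `A²_ω`, so
    -- `u` may be replaced by `g` when paired with `y`; `s` is the commutator.
    have hsum : X = (⟪e, y⟫_ℂ).re + (⟪g, y⟫_ℂ).re + (⟪x, s⟫_ℂ).re := by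
      have hyo : y ∈ ω.A2ᗮ := dstarRange_le hω ⟨_, hwwα, hyT⟩
      have h1 : ⟪u, y⟫_ℂ = ⟪g, y⟫_ℂ := by
        have h2 : ⟪ω.A2.starProjection g, y⟫_ℂ = 0 :=
          (Submodule.mem_orthogonal _ _).1 hyo _ (Submodule.starProjection_apply_mem _ g)
        rw [hu, inner_sub_left, h2, sub_zero]
      have h3 : ⟪e, y⟫_ℂ + ⟪g, y⟫_ℂ + ⟪x, s⟫_ℂ = ⟪x, y + s⟫_ℂ := by
        rw [← h1, he, inner_sub_left, inner_add_right]; ring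
      have hys : (y + s : ω.L2) =ᵐ[ω.measure]
          fun z => (w z : ℂ) * ((w z : ℂ) * ω.dstar α z) := by
        filter_upwards [Lp.coeFn_add y s, hyT, hsS, ω.ae_mem_ball] with z h1 h2 h3 hz
        rw [h1, Pi.add_apply, h2, h3, (hTS z hz).1]
      rw [← Complex.add_re, ← Complex.add_re, h3, ω.inner_eq_integral hx hys]
      have : ∀ z, conj (ω.dstar α z) * ((w z : ℂ) * ((w z : ℂ) * ω.dstar α z)) =
          ((‖(w z : ℂ) * ω.dstar α z‖ ^ 2 : ℝ) : ℂ) := by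
        intro z
        push_cast
        rw [← Complex.conj_mul', map_mul, Complex.conj_ofReal]; ring
      simp only [this]
      rw [integral_complex_ofReal, Complex.ofReal_re]
    have htest : ∀ v : ω.L2, (⟪v, y⟫_ℂ).re ≤ 2 * ∫ z, w z ^ 2 * ‖v z‖ ^ 2 ∂ω.measure +
        1 / 4 * X + k * Y := by
      intro v
      have hV := integral_linear_combination (iw v) (hXY (1 / 4) k).1 2 1
      rw [(hXY (1 / 4) k).2] at hV
      have := re_inner_le_integral (x := v) (y := y) hV.1 ?_
      · rw [hV.2] at this
        linarith
      · filter_upwards [hyT, ω.ae_mem_ball] with z h1 hz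
        rw [h1, (hTS z hz).2, norm_mul, Complex.norm_real, Real.norm_of_nonneg (hw0 z hz)]
        have h2 := norm_add_sq_le (a := (w z : ℂ) * ω.dstar α z)
          (b := -(2 * (α z * dz (fun z => (w z : ℂ)) z))) one_pos
        rw [← sub_eq_add_neg, norm_neg, norm_mul (2 : ℂ), mul_pow] at h2
        have h3 := hdw' z hz
        have h4 : ‖(2 : ℂ)‖ = 2 := by simp
        rw [h4] at h2
        nlinarith [sq_nonneg (4 * (w z * ‖v z‖) - ‖(w z : ℂ) * ω.dstar α z -
          2 * (α z * dz (fun z => (w z : ℂ)) z)‖)]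
    have hlast : (⟪x, s⟫_ℂ).re ≤ 1 / 8 * X + 8 * k * Y := by
      have hV := hXY (1 / 8) (8 * k)
      have := re_inner_le_integral (x := x) (y := s) hV.1 ?_
      · rwa [hV.2] at this
      · filter_upwards [hx, hsS, ω.ae_mem_ball] with z h1 h2 hz
        have h3 := hdw' z hz
        have h4 : ‖ω.dstar α z‖ * ‖S z‖ = 2 * (‖(w z : ℂ) * ω.dstar α z‖ *
            ‖α z * dz (fun z => (w z : ℂ)) z‖) := by
          simp only [hS, norm_mul, Complex.norm_ofNat]; ring
        rw [h1, h2, h4]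
        nlinarith [sq_nonneg (‖(w z : ℂ) * ω.dstar α z‖ -
          8 * ‖α z * dz (fun z => (w z : ℂ)) z‖)]
    have hUle : U ≤ 2 * X + 2 * E := by
      have hV := integral_linear_combination iX (iw e) 2 2
      rw [← hV.2]
      refine integral_mono_ae (iw u) hV.1 ?_
      filter_upwards [hee] with z h1
      have h2 : u z = ω.dstar α z + -e z := by rw [h1]; ring
      have h3 := norm_add_sq_le (a := ω.dstar α z) (b := -e z) one_pos
      rw [← h2, norm_neg] at h3
      rw [norm_mul, mul_pow, Complex.norm_real, Real.norm_eq_abs, sq_abs]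
      nlinarith [sq_nonneg (w z)]
    -- The source of `320 = 4 · 80`. The three pairings give `X ≤ 2E + 2G + (5/8) X + 10 kY`, so `10
    -- kY ≤ X/8` yields `X ≤ 8E + 8G`, and then `U ≤ 2X + 2E ≤ 16G + 18E`.
    have hkY : k * Y ≤ 1 / 80 * X := by
      have := mul_le_mul_of_nonneg_left hYX hk0
      nlinarith [mul_le_mul_of_nonneg_right hk hX0]
    have h1 := htest e
    have h2 := htest g
    linarith
  have hcl : IsClosed {x : ω.L2 | U ≤ 16 * G + 18 * (B ^ 2 * ‖x - u‖ ^ 2)} :=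
    isClosed_le continuous_const (by fun_prop)
  have hmem : U ≤ 16 * G + 18 * (B ^ 2 * ‖u - u‖ ^ 2) :=
    closure_minimal key hcl (orthogonal_A2_le hω huo)
  simpa using hmem

/-! ### Admissibility of symbols of Bloch type -/

/-- The bounded weights that exhaust `1 + σ |φ|²`. -/
noncomputable def blochWeight (φ : ℂ → ℂ) (σ ε : ℝ) (z : ℂ) : ℝ :=
  (1 + σ * ‖φ z‖ ^ 2) / (1 + ε * (σ * ‖φ z‖ ^ 2))

theorem contDiffOn_blochWeight {φ : ℂ → ℂ} (hφ : DifferentiableOn ℂ φ (ball 0 1)) {σ ε : ℝ}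
    (hσ : 0 < σ) (hε : 0 < ε) : ContDiffOn ℝ 2 (blochWeight φ σ ε) (ball 0 1) := by
  have h := (contDiffOn_of_differentiableOn hφ).norm_sq ℝ
  refine ContDiffOn.div (contDiffOn_const.add (contDiffOn_const.mul h))
    (contDiffOn_const.add (contDiffOn_const.mul (contDiffOn_const.mul h))) fun z _ => ?_
  positivity

theorem blochWeight_le {φ : ℂ → ℂ} {σ ε : ℝ} (hσ : 0 < σ) (hε : 0 < ε) (hε1 : ε ≤ 1) (z : ℂ) :
    blochWeight φ σ ε z ≤ 1 / ε := by
  unfold blochWeight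
  rw [div_le_div_iff₀ (by positivity) hε]
  nlinarith

theorem blochWeight_le_one_add {φ : ℂ → ℂ} {σ ε : ℝ} (hσ : 0 < σ) (hε : 0 < ε) (z : ℂ) :
    blochWeight φ σ ε z ≤ 1 + σ * ‖φ z‖ ^ 2 :=
  div_le_self (by positivity) (by
    have : 0 ≤ ε * (σ * ‖φ z‖ ^ 2) := by positivity
    linarith)

/-- The weight is slowly varying: its logarithmic derivative is at most `√σ |φ'| / 2`, whatever `ε`
is. When `|φ'|² ≤ Q M`, a small `σ` makes this admissible for the weighted projection bound. -/
theorem norm_dz_blochWeight_sq_le {φ : ℂ → ℂ} (hφ : DifferentiableOn ℂ φ (ball 0 1)) {σ ε : ℝ}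
    (hσ : 0 < σ) (hε : 0 < ε) (hε1 : ε ≤ 1) {z : ℂ} (hz : z ∈ ball (0 : ℂ) 1) :
    ‖dz (fun z => (blochWeight φ σ ε z : ℂ)) z‖ ^ 2 ≤
      σ / 4 * ‖deriv φ z‖ ^ 2 * blochWeight φ σ ε z ^ 2 := by
  have hn := isOpen_ball.mem_nhds hz
  have dφ := hφ.differentiableAt hn
  have dφr : DifferentiableAt ℝ φ z := dφ.restrictScalars ℝ
  have dcφ : DifferentiableAt ℝ (fun z => conj (φ z)) z :=
    Complex.conjCLE.differentiableAt.comp z dφr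
  set W : ℂ → ℂ := fun z => (blochWeight φ σ ε z : ℂ) with hW
  have dW : DifferentiableAt ℝ W z :=
    ((contDiffOn_ofReal (contDiffOn_blochWeight hφ hσ hε)).contDiffAt hn).differentiableAt
      (by norm_num)
  set N : ℂ → ℂ := fun z => φ z * conj (φ z) with hN
  have dN : DifferentiableAt ℝ N z := dφr.fun_mul dcφ
  have hNr : ∀ z, N z = ((‖φ z‖ ^ 2 : ℝ) : ℂ) := fun z => by
    rw [hN]; push_cast; exact Complex.mul_conj' _
  have hdN : dz N z = deriv φ z * conj (φ z) := by
    rw [hN, dz_mul dφr dcφ, dz_holomorphic dφ, dz_conj, dzb_holomorphic dφ]; simp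
  have hc : ∀ c : ℂ, dz (fun _ => c) z = 0 := fun c => by simp [dz]
  have hcN : ∀ c : ℂ, dz (fun z => 1 + c * N z) z = c * dz N z := fun c => by
    rw [dz_add (differentiableAt_const _) (dN.const_mul c), dz_mul (differentiableAt_const _) dN,
      hc, hc]
    ring
  -- Differentiating the product relation instead of the quotient gives `∂W` times the denominator
  -- in closed form.
  have hrel : (fun z => W z * (1 + (ε * σ : ℂ) * N z)) = fun z => 1 + (σ : ℂ) * N z := by
    ext z
    have h1 : (1 + ε * (σ * ‖φ z‖ ^ 2)) ≠ 0 := by positivity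
    have h2 : blochWeight φ σ ε z * (1 + ε * (σ * ‖φ z‖ ^ 2)) = 1 + σ * ‖φ z‖ ^ 2 :=
      div_mul_cancel₀ _ h1
    rw [hNr, hW]
    have := congrArg (fun x : ℝ => (x : ℂ)) h2
    push_cast at this ⊢
    rw [← this]; ring
  have hdrel : dz W z * (1 + (ε * σ : ℂ) * N z) + W z * ((ε * σ : ℂ) * dz N z) =
      (σ : ℂ) * dz N z := by
    have := congrArg (fun f => dz f z) hrel
    rwa [dz_mul dW ((differentiableAt_const _).fun_add (dN.const_mul _)), hcN, hcN] at this
  set t : ℝ := ‖φ z‖ with ht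
  set b := blochWeight φ σ ε z with hb
  set D : ℝ := 1 + ε * (σ * t ^ 2) with hD
  have hD0 : 0 < D := by positivity
  have hbD : b * D = 1 + σ * t ^ 2 := div_mul_cancel₀ _ hD0.ne'
  have hbε : ε * b ≤ 1 := by
    have := blochWeight_le (φ := φ) hσ hε hε1 z
    rwa [le_div_iff₀ hε, mul_comm] at this
  have hb0 : 0 < b := by
    have : 0 < b * D := by rw [hbD]; positivity
    exact pos_of_mul_pos_left this hD0.le
  have h1 : dz W z * (D : ℂ) = (σ * (1 - ε * b) : ℝ) * (deriv φ z * conj (φ z)) := by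
    have hDN : (1 + (ε * σ : ℂ) * N z) = (D : ℂ) := by rw [hNr, hD]; push_cast; ring
    rw [hDN, hdN] at hdrel
    have hWb : W z = (b : ℂ) := rfl
    rw [hWb] at hdrel
    push_cast
    linear_combination hdrel
  have h2 : ‖dz W z‖ * D = σ * (1 - ε * b) * (‖deriv φ z‖ * t) := by
    have := congrArg norm h1
    rwa [norm_mul, norm_mul, norm_mul, RCLike.norm_conj, Complex.norm_real, Complex.norm_real,
      Real.norm_of_nonneg hD0.le, Real.norm_of_nonneg (mul_nonneg hσ.le (by linarith))] at this
  have h3 : ‖dz W z‖ * D ≤ σ * (‖deriv φ z‖ * t) := by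
    rw [h2]
    have : 0 ≤ σ * (‖deriv φ z‖ * t) := by positivity
    nlinarith [mul_pos hε hb0]
  have h4 : (‖dz W z‖ * D) ^ 2 ≤ (σ * (‖deriv φ z‖ * t)) ^ 2 :=
    pow_le_pow_left₀ (by positivity) h3 2
  -- AM-GM, `4σt² ≤ (1 + σt²)²`: the origin of the factor `σ/4`.
  have h5 : 4 * (σ * t ^ 2) ≤ (b * D) ^ 2 := by rw [hbD]; nlinarith [sq_nonneg (1 - σ * t ^ 2)]
  have h6 : ‖dz W z‖ ^ 2 * D ^ 2 ≤ σ / 4 * ‖deriv φ z‖ ^ 2 * b ^ 2 * D ^ 2 := by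
    have : 0 ≤ σ * ‖deriv φ z‖ ^ 2 := by positivity
    nlinarith
  exact le_of_mul_le_mul_right h6 (by positivity)

/-- The weighted bound is applied to `blochWeight φ σ ε` with `ε = 1/(n+1)`. The right side stays
bounded because `φ` is bounded where `g` is nonzero (hypothesis `hC`), and Fatou's lemma gives `(1 +
σ|φ|²) u ∈ L²_ω`, which dominates `φ̄ u`. -/
theorem memLp_conj_mul_sub_starProjection (hω : ContDiffOn ℝ 2 ω.potential (ball 0 1))
    {M : ℂ → ℝ} (hMc : ContinuousOn M (ball 0 1)) (hM : ∀ z ∈ ball (0 : ℂ) 1, 0 < M z)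
    {A : ℝ} (hA : 0 < A)
    (hap : ∀ α, IsTest α →
      ∫ z, M z * ‖α z‖ ^ 2 ∂ω.measure ≤ A * ∫ z, ‖ω.dstar α z‖ ^ 2 ∂ω.measure)
    {φ : ℂ → ℂ} (hφ : DifferentiableOn ℂ φ (ball 0 1)) {Q : ℝ} (hQ0 : 0 ≤ Q)
    (hQ : ∀ z ∈ ball (0 : ℂ) 1, ‖deriv φ z‖ ^ 2 ≤ Q * M z) (g : ω.L2) {C : ℝ}
    (hC : ∀ᵐ z ∂ω.measure, ‖φ z‖ ^ 2 * ‖g z‖ ≤ C * ‖g z‖) :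
    MemLp (fun z => conj (φ z) * (g - ω.A2.starProjection g : ω.L2) z) 2 ω.measure := by
  set u : ω.L2 := g - ω.A2.starProjection g with hu
  -- The slow variation constant is `k = σQ/4`, and `320 kA = 80QAσ ≤ 1`; the added `1` avoids
  -- division by zero when `Q = 0`.
  set σ : ℝ := 1 / (80 * (Q * A) + 1) with hσ
  have hσ0 : 0 < σ := by positivity
  have hk : 320 * (σ / 4 * Q * A) ≤ 1 := by
    have : 320 * (σ / 4 * Q * A) = 80 * (Q * A) / (80 * (Q * A) + 1) := by rw [hσ]; ring
    rw [this, div_le_one (by positivity)]; linarith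
  set K : ℝ := 16 * ((1 + σ * C) ^ 2 * ‖g‖ ^ 2) with hK
  have hcφ : ContinuousOn (fun z => conj (φ z)) (ball 0 1) :=
    Complex.continuous_conj.comp_continuousOn hφ.continuousOn
  have hmeas : AEStronglyMeasurable (fun z => conj (φ z) * u z) ω.measure :=
    (aestronglyMeasurable_of_continuousOn hcφ).mul (Lp.aestronglyMeasurable u)
  have hbound : ∀ n : ℕ, ∫⁻ z, ENNReal.ofReal
      (blochWeight φ σ (1 / ((n : ℝ) + 1)) z ^ 2 * ‖u z‖ ^ 2) ∂ω.measure ≤ ENNReal.ofReal K := by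
    intro n
    set ε : ℝ := 1 / ((n : ℝ) + 1) with hε
    have hε0 : 0 < ε := by positivity
    have hε1 : ε ≤ 1 := by
      rw [hε, div_le_one (by positivity)]
      have : (0 : ℝ) ≤ n := n.cast_nonneg
      linarith
    have hw0 : ∀ z, 0 ≤ blochWeight φ σ ε z := fun z => by unfold blochWeight; positivity
    have h1 := integral_weight_sub_starProjection_le hω hMc hM hA hap
      (contDiffOn_blochWeight hφ hσ0 hε0) (fun z _ => hw0 z)
      (fun z _ => blochWeight_le hσ0 hε0 hε1 z) (k := σ / 4 * Q) (by positivity) hk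
      (fun z hz => (norm_dz_blochWeight_sq_le hφ hσ0 hε0 hε1 hz).trans (by
        have := hQ z hz
        have h2 : σ / 4 * Q * (M z * blochWeight φ σ ε z ^ 2) =
          σ / 4 * (Q * M z) * blochWeight φ σ ε z ^ 2 := by ring
        rw [h2]
        gcongr)) g
    have hwc : ContinuousOn (fun z => blochWeight φ σ ε z ^ 2) (ball 0 1) :=
      (contDiffOn_blochWeight hφ hσ0 hε0).continuousOn.pow 2
    have hwB : ∀ z ∈ ball (0 : ℂ) 1, |blochWeight φ σ ε z ^ 2| ≤ (1 / ε) ^ 2 := fun z _ => by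
      rw [abs_of_nonneg (by positivity)]
      exact pow_le_pow_left₀ (hw0 z) (blochWeight_le hσ0 hε0 hε1 z) 2
    rw [← ofReal_integral_eq_lintegral_ofReal (integrable_mul_L2_sq hwc hwB u)
      (Eventually.of_forall fun z => mul_nonneg (sq_nonneg _) (sq_nonneg _))]
    refine ENNReal.ofReal_le_ofReal (h1.trans ?_)
    rw [hK, ω.norm_sq_eq_integral (EventuallyEq.refl _ g),
      ← integral_const_mul ((1 + σ * C) ^ 2)]
    refine mul_le_mul_of_nonneg_left ?_ (by norm_num)
    refine integral_mono_ae (integrable_mul_L2_sq hwc hwB g) ((integrable_L2_sq g).const_mul _) ?_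
    filter_upwards [hC] with z hz
    have h3 := blochWeight_le_one_add (φ := φ) hσ0 hε0 z
    have h4 : blochWeight φ σ ε z * ‖g z‖ ≤ (1 + σ * C) * ‖g z‖ := by
      nlinarith [norm_nonneg (g z), mul_le_mul_of_nonneg_left hz hσ0.le]
    have h5 := pow_le_pow_left₀ (mul_nonneg (hw0 z) (norm_nonneg _)) h4 2
    rwa [mul_pow, mul_pow] at h5
  have hpt : ∀ z, Tendsto (fun n : ℕ => ENNReal.ofReal
      (blochWeight φ σ (1 / ((n : ℝ) + 1)) z ^ 2 * ‖u z‖ ^ 2)) atTop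
      (𝓝 (ENNReal.ofReal ((1 + σ * ‖φ z‖ ^ 2) ^ 2 * ‖u z‖ ^ 2))) := by
    intro z
    refine ENNReal.tendsto_ofReal (Tendsto.mul_const _ (Tendsto.pow ?_ 2))
    have h1 : Tendsto (fun n : ℕ => 1 / ((n : ℝ) + 1)) atTop (𝓝 0) :=
      tendsto_one_div_add_atTop_nhds_zero_nat
    have h2 : Tendsto (fun n : ℕ => 1 + 1 / ((n : ℝ) + 1) * (σ * ‖φ z‖ ^ 2)) atTop (𝓝 1) := by
      simpa using (h1.mul_const (σ * ‖φ z‖ ^ 2)).const_add 1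
    have h3 := h2.inv₀ one_ne_zero |>.const_mul (1 + σ * ‖φ z‖ ^ 2)
    simpa only [blochWeight, div_eq_mul_inv, inv_one, mul_one] using h3
  have hfatou : ∫⁻ z, ENNReal.ofReal ((1 + σ * ‖φ z‖ ^ 2) ^ 2 * ‖u z‖ ^ 2) ∂ω.measure ≤
      ENNReal.ofReal K := by
    have h1 : ∀ n : ℕ, AEMeasurable (fun z => ENNReal.ofReal
        (blochWeight φ σ (1 / ((n : ℝ) + 1)) z ^ 2 * ‖u z‖ ^ 2)) ω.measure := fun n =>
      ((aestronglyMeasurable_of_continuousOn ((contDiffOn_blochWeight hφ hσ0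
        (by positivity)).continuousOn.pow 2)).aemeasurable.mul
          (integrable_L2_sq u).1.aemeasurable).ennreal_ofReal
    have h2 := lintegral_liminf_le' (u := atTop) h1
    simp only [fun z => (hpt z).liminf_eq] at h2
    exact h2.trans (liminf_le_of_le (by isBoundedDefault) fun b hb =>
      let ⟨n, hn⟩ := hb.exists; hn.trans (hbound n))
  rw [memLp_two_iff_integrable_sq_norm hmeas]
  refine ⟨hmeas.norm.pow 2, ?_⟩
  have h1 : ∫⁻ z, ‖‖conj (φ z) * u z‖ ^ 2‖ₑ ∂ω.measure ≤
      ∫⁻ z, ENNReal.ofReal (1 / σ) *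
        ENNReal.ofReal ((1 + σ * ‖φ z‖ ^ 2) ^ 2 * ‖u z‖ ^ 2) ∂ω.measure := by
    refine lintegral_mono fun z => ?_
    rw [← ofReal_norm, ← ENNReal.ofReal_mul (by positivity), Real.norm_of_nonneg (by positivity),
      norm_mul, RCLike.norm_conj, mul_pow]
    refine ENNReal.ofReal_le_ofReal ?_
    rw [one_div, ← div_eq_inv_mul, le_div_iff₀ hσ0]
    have : 0 ≤ (1 + σ * ‖φ z‖ ^ 2 + (σ * ‖φ z‖ ^ 2) ^ 2) * ‖u z‖ ^ 2 := by positivity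
    nlinarith
  rw [lintegral_const_mul' _ _ ENNReal.ofReal_ne_top] at h1
  exact h1.trans_lt (ENNReal.mul_lt_top ENNReal.ofReal_lt_top
    (hfatou.trans_lt ENNReal.ofReal_lt_top))

/-! ### The reproducing kernel as a projection, and admissibility. -/

theorem kernelFun_inner (z : 𝔻) (f : ω.A2) : ⟪ω.kernelFun z, f⟫_ℂ = ω.rep f z := by
  rw [kernelFun, RKHS.kerFun_inner]
  have : f z = ω.rep f z := rfl
  rw [this]; simp

/-- The reproducing kernel is the projection of a bounded function with compact support. -/
theorem exists_starProjection_eq_kernelFun (hω : ContDiffOn ℝ 2 ω.potential (ball 0 1)) (z : 𝔻) :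
    ∃ g : ω.L2, ω.A2.starProjection g = ω.kernelFun z ∧
      ∃ r < 1, ∀ᵐ ζ ∂ω.measure, ζ ∉ closedBall (0 : ℂ) r → g ζ = 0 := by
  set r : ℝ := (1 - ‖(z : ℂ)‖) / 2 with hr
  have hz1 := z.norm_lt_one
  have hr0 : 0 < r := by linarith
  have hsub : ball (z : ℂ) r ⊆ closedBall 0 ((1 + ‖(z : ℂ)‖) / 2) := by
    refine ball_subset_closedBall.trans (closedBall_subset_closedBall' ?_)
    rw [dist_zero_right]; linarith
  have hsub1 : closedBall (0 : ℂ) ((1 + ‖(z : ℂ)‖) / 2) ⊆ ball 0 1 :=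
    closedBall_subset_ball (by linarith)
  set c : ℝ := 1 / (Real.pi * r ^ 2) with hc
  -- The factor `e^p` cancels the weight, so pairing with `G` is the plain area mean over the disc,
  -- which reproduces `f z`; `c` is the inverse area.
  set G : ℂ → ℂ := (ball (z : ℂ) r).indicator
    fun ζ => ((c * Real.exp (ω.potential ζ) : ℝ) : ℂ) with hG
  have hcont : ContinuousOn (fun ζ => ((c * Real.exp (ω.potential ζ) : ℝ) : ℂ)) (ball 0 1) :=
    Complex.continuous_ofReal.comp_continuousOn
      (continuousOn_const.mul (Real.continuous_exp.comp_continuousOn hω.continuousOn))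
  obtain ⟨B, hB⟩ := (isCompact_closedBall (0 : ℂ) ((1 + ‖(z : ℂ)‖) / 2)).exists_bound_of_continuousOn
    (hcont.mono hsub1)
  have hGm : MemLp G 2 ω.measure := by
    refine MemLp.of_bound ((aestronglyMeasurable_of_continuousOn hcont).indicator
      measurableSet_ball) (max B 0) (Eventually.of_forall fun ζ => ?_)
    by_cases hζ : ζ ∈ ball (z : ℂ) r
    · rw [hG, Set.indicator_of_mem hζ]
      exact (hB ζ (hsub hζ)).trans (le_max_left _ _)
    · rw [hG, Set.indicator_of_notMem hζ, norm_zero]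
      exact le_max_right _ _
  have hinner : ∀ f : ω.A2, ⟪hGm.toLp G, (f : ω.L2)⟫_ℂ = ω.rep f z := by
    intro f
    rw [ω.inner_eq_integral hGm.coeFn_toLp (ω.coe_ae_eq_rep f), ω.integral_measure]
    have e : ∀ ζ ∈ ball (0 : ℂ) 1, ω.toFun ζ • (conj (G ζ) * ω.rep f ζ) =
        (ball (z : ℂ) r).indicator (fun ζ => (c : ℂ) * (((‖ζ - z‖ ^ 0 : ℝ) : ℂ) * ω.rep f ζ)) ζ := by
      intro ζ hζ1
      by_cases hζ : ζ ∈ ball (z : ℂ) r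
      · have hone : (ω.toFun ζ : ℂ) * ((Real.exp (ω.potential ζ) : ℝ) : ℂ) = 1 := by
          rw [← ω.exp_neg_potential hζ1, ← Complex.ofReal_mul, ← Real.exp_add]; simp
        rw [hG, Set.indicator_of_mem hζ, Set.indicator_of_mem hζ, Complex.conj_ofReal,
          Complex.real_smul]
        push_cast at hone ⊢
        linear_combination (c * ω.rep f ζ : ℂ) * hone
      · rw [hG, Set.indicator_of_notMem hζ, Set.indicator_of_notMem hζ]; simp
    rw [setIntegral_congr_fun measurableSet_ball e, setIntegral_indicator measurableSet_ball,
      Set.inter_eq_right.2 (hsub.trans hsub1), integral_const_mul,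
      integral_ball_radial (R := 1 - ‖(z : ℂ)‖) hr0 (by linarith)
        ((ω.rep_differentiableOn f).mono (ball_subset_ball' (by rw [dist_zero_right]; linarith))) 0,
      ← mul_assoc, ← Complex.ofReal_mul]
    have : c * (2 * Real.pi * (r ^ (0 + 2) / ((0 : ℕ) + 2))) = 1 := by
      rw [hc]; have := Real.pi_pos; field_simp; simp [mul_comm]
    rw [this]; simp
  refine ⟨hGm.toLp G, ?_, (1 + ‖(z : ℂ)‖) / 2, by linarith, ?_⟩
  · refine Submodule.eq_starProjection_of_mem_of_inner_eq_zero (ω.kernelFun z).2 fun f hf => ?_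
    have h1 := hinner ⟨f, hf⟩
    have h2 := kernelFun_inner z ⟨f, hf⟩
    rw [inner_sub_left]
    exact sub_eq_zero.2 (h1.trans h2.symm)
  · filter_upwards [hGm.coeFn_toLp] with ζ hζ hn
    rw [hζ, hG, Set.indicator_of_notMem fun h => hn (hsub h)]

/-- Symbols of Bloch type are admissible. -/
theorem admissible_of_bounded (hω : ContDiffOn ℝ 2 ω.potential (ball 0 1))
    {M : ℂ → ℝ} (hMc : ContinuousOn M (ball 0 1)) (hM : ∀ z ∈ ball (0 : ℂ) 1, 0 < M z)
    {A : ℝ} (hA : 0 < A)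
    (hap : ∀ α, IsTest α →
      ∫ z, M z * ‖α z‖ ^ 2 ∂ω.measure ≤ A * ∫ z, ‖ω.dstar α z‖ ^ 2 ∂ω.measure)
    {φ : ℂ → ℂ} (hφ : DifferentiableOn ℂ φ (ball 0 1)) {Q : ℝ} (hQ0 : 0 ≤ Q)
    (hQ : ∀ z ∈ ball (0 : ℂ) 1, ‖deriv φ z‖ ^ 2 ≤ Q * M z) : ω.Admissible φ := by
  intro z
  obtain ⟨g, hg, r, hr, hgr⟩ := exists_starProjection_eq_kernelFun hω z
  have hcφ : ContinuousOn (fun z => conj (φ z)) (ball 0 1) :=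
    Complex.continuous_conj.comp_continuousOn hφ.continuousOn
  obtain ⟨B, hB⟩ := (isCompact_closedBall (0 : ℂ) r).exists_bound_of_continuousOn
    (hφ.continuousOn.mono (closedBall_subset_ball hr))
  have hbd : ∀ᵐ ζ ∂ω.measure, ‖φ ζ‖ * ‖g ζ‖ ≤ max B 0 * ‖g ζ‖ := by
    filter_upwards [hgr] with ζ hζ
    by_cases h : ζ ∈ closedBall (0 : ℂ) r
    · exact mul_le_mul_of_nonneg_right ((hB ζ h).trans (le_max_left _ _)) (norm_nonneg _)
    · simp [hζ h]
  have h1 := memLp_conj_mul_sub_starProjection hω hMc hM hA hap hφ hQ0 hQ g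
    (C := max B 0 ^ 2) (by
      filter_upwards [hbd] with ζ hζ
      have h0 : 0 ≤ max B 0 := le_max_right _ _
      nlinarith [norm_nonneg (φ ζ)])
  have h2 : MemLp (fun ζ => conj (φ ζ) * g ζ) 2 ω.measure := by
    refine (Lp.memLp g).of_le_mul (c := max B 0)
      ((aestronglyMeasurable_of_continuousOn hcφ).mul (Lp.aestronglyMeasurable g)) ?_
    filter_upwards [hbd] with ζ hζ
    rwa [norm_mul, RCLike.norm_conj]
  -- The decomposition `φ̄ K_z = φ̄ g - φ̄ (g - P_ω g)`.
  refine (h2.sub h1).ae_eq ?_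
  filter_upwards [Lp.coeFn_sub g (ω.A2.starProjection g)] with ζ hζ
  simp only [Pi.sub_apply]
  rw [hζ, Pi.sub_apply, hg]
  ring

/-! ### Compactness of Hankel operators with symbols of little Bloch type -/

/-- Near the boundary `τ_ω² |φ'|² < εδ ≤ ε τ_ω² M`, and `τ_ω²` cancels. -/
theorem exists_deriv_sq_le {M : ℂ → ℝ} {δ : ℝ} (hδ : 0 < δ)
    (hδM : ∀ z : 𝔻, δ ≤ ω.tau z ^ 2 * M z) {φ : ℂ → ℂ}
    (h : Tendsto (fun z : 𝔻 => ω.tau z * ‖deriv φ z‖) toBoundary (𝓝 0)) {ε : ℝ} (hε : 0 < ε) :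
    ∃ r < 1, ∀ z ∈ ball (0 : ℂ) 1, z ∉ closedBall (0 : ℂ) r → ‖deriv φ z‖ ^ 2 ≤ ε * M z := by
  have h1 := (h.pow 2).eventually_lt_const (u := ε * δ) (by simpa using mul_pos hε hδ)
  rw [toBoundary, eventually_comap, Metric.eventually_nhds_iff] at h1
  obtain ⟨s, hs, hr⟩ := h1
  refine ⟨1 - s, by linarith, fun z hz hzr => ?_⟩
  have hz1 : ‖z‖ < 1 := by simpa using hz
  have hzs : 1 - s < ‖z‖ := by simpa using hzr
  have h2 := hr (y := ‖z‖) (by rw [Real.dist_eq, abs_lt]; constructor <;> linarith)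
    (Complex.UnitDisc.mk z hz1) rfl
  have h3 := hδM (Complex.UnitDisc.mk z hz1)
  have h4 : (Complex.UnitDisc.mk z hz1 : ℂ) = z := rfl
  rw [h4] at h2 h3
  have ht : 0 < ω.tau (Complex.UnitDisc.mk z hz1) ^ 2 := by
    refine lt_of_le_of_ne (sq_nonneg _) fun h0 => ?_
    rw [← h0, zero_mul] at h3
    linarith
  rw [mul_pow] at h2
  nlinarith [mul_le_mul_of_nonneg_left h3 hε.le]

theorem exists_deriv_sq_le_mul {M : ℂ → ℝ} (hMc : ContinuousOn M (ball 0 1))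
    (hM : ∀ z ∈ ball (0 : ℂ) 1, 0 < M z) {φ : ℂ → ℂ} (hφ : DifferentiableOn ℂ φ (ball 0 1))
    {r : ℝ} (hr : r < 1)
    (h : ∀ z ∈ ball (0 : ℂ) 1, z ∉ closedBall (0 : ℂ) r → ‖deriv φ z‖ ^ 2 ≤ 1 * M z) :
    ∃ Q, 0 ≤ Q ∧ ∀ z ∈ ball (0 : ℂ) 1, ‖deriv φ z‖ ^ 2 ≤ Q * M z := by
  have hc : ContinuousOn (fun z => ‖deriv φ z‖ ^ 2 / M z) (ball 0 1) :=
    ((hφ.deriv isOpen_ball).continuousOn.norm.pow 2).div hMc fun z hz => (hM z hz).ne'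
  obtain ⟨B, hB⟩ := (isCompact_closedBall (0 : ℂ) r).exists_bound_of_continuousOn
    (hc.mono (closedBall_subset_ball hr))
  refine ⟨max 1 B, zero_le_one.trans (le_max_left _ _), fun z hz => ?_⟩
  by_cases hzr : z ∈ closedBall (0 : ℂ) r
  · rw [← div_le_iff₀ (hM z hz)]
    exact ((Real.le_norm_self _).trans (hB z hzr)).trans (le_max_right _ _)
  · exact (h z hz hzr).trans (mul_le_mul_of_nonneg_right (le_max_left _ _) (hM z hz).le)

/-- Cauchy's estimate on discs of radius `(1 - r)/2`, combined with the locally uniform bound on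
point evaluations. -/
theorem exists_lipschitz_rep (ω : BergmanWeight) {r : ℝ} (hr : r < 1) :
    ∃ L, 0 ≤ L ∧ ∀ f : ω.A2, ∀ z ∈ closedBall (0 : ℂ) r, ∀ w ∈ closedBall (0 : ℂ) r,
      ‖ω.rep f z - ω.rep f w‖ ≤ L * ‖f‖ * ‖z - w‖ := by
  obtain ⟨C, hC0, hC⟩ := ω.exists_norm_rep_le ((1 + r) / 2) (by linarith)
  have hs : 0 < (1 - r) / 2 := by linarith
  refine ⟨C / ((1 - r) / 2), by positivity, fun f z hz w hw => ?_⟩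
  have hsub : ∀ x ∈ closedBall (0 : ℂ) r,
      closedBall x ((1 - r) / 2) ⊆ closedBall 0 ((1 + r) / 2) := fun x hx =>
    closedBall_subset_closedBall' (by have := mem_closedBall.1 hx; linarith)
  have hsub1 : closedBall (0 : ℂ) ((1 + r) / 2) ⊆ ball 0 1 := closedBall_subset_ball (by linarith)
  refine Convex.norm_image_sub_le_of_norm_deriv_le (𝕜 := ℂ) (fun x hx =>
    (ω.rep_differentiableOn f).differentiableAt
      (isOpen_ball.mem_nhds (closedBall_subset_ball hr hx)))
    (fun x hx => ?_) (convex_closedBall (0 : ℂ) r) hw hz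
  rw [div_mul_eq_mul_div]
  refine Complex.norm_deriv_le_of_forall_mem_sphere_norm_le hs ?_ fun y hy =>
    hC f y (hsub x hx (sphere_subset_closedBall hy))
  exact ((ω.rep_differentiableOn f).mono ((hsub x hx).trans hsub1)).diffContOnCl_ball subset_rfl

/-- Outside the disc of radius `r` the factor `v` is small. Inside, `f` differs from its value at
the nearest point of a finite `d`-net by at most `L‖f‖d`, and `d` is chosen so that this also
contributes at most `ε‖f‖²`. -/
theorem exists_integral_le (ω : BergmanWeight) {v : ℂ → ℝ} (hv : ContinuousOn v (ball 0 1))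
    (hv0 : ∀ z ∈ ball (0 : ℂ) 1, 0 ≤ v z) {Q : ℝ} (hQ0 : 0 ≤ Q)
    (hQ : ∀ z ∈ ball (0 : ℂ) 1, v z ≤ Q) {r : ℝ} (hr : r < 1) {ε : ℝ} (hε : 0 < ε)
    (hvε : ∀ z ∈ ball (0 : ℂ) 1, z ∉ closedBall (0 : ℂ) r → v z ≤ ε) :
    ∃ Z : Finset ℂ, ↑Z ⊆ ball (0 : ℂ) 1 ∧ ∃ C, ∀ f : ω.A2,
      ∫ z, v z * ‖ω.rep f z‖ ^ 2 ∂ω.measure ≤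
        2 * ε * ‖f‖ ^ 2 + C * (∑ x ∈ Z, ‖ω.rep f x‖) ^ 2 := by
  obtain ⟨L, hL0, hL⟩ := ω.exists_lipschitz_rep hr
  set m : ℝ := ω.measure.real Set.univ with hm
  have hm0 : 0 ≤ m := measureReal_nonneg
  obtain ⟨d, hd, hdε⟩ : ∃ d > 0, 2 * (Q * m) * (L * d) ^ 2 ≤ ε := by
    have h0 : Tendsto (fun d : ℝ => 2 * (Q * m) * (L * d) ^ 2) (𝓝[>] 0) (𝓝 0) := by
      have : Continuous fun d : ℝ => 2 * (Q * m) * (L * d) ^ 2 := by fun_prop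
      simpa using (this.tendsto 0).mono_left nhdsWithin_le_nhds
    obtain ⟨d, hd, hd'⟩ := ((h0.eventually_le_const hε).and self_mem_nhdsWithin).exists
    exact ⟨d, hd', hd⟩
  obtain ⟨t, htr, htf, htc⟩ := finite_cover_balls_of_compact (isCompact_closedBall (0 : ℂ) r) hd
  refine ⟨htf.toFinset, by simpa using htr.trans (closedBall_subset_ball hr), 2 * (Q * m),
    fun f => ?_⟩
  set S : ℝ := ∑ x ∈ htf.toFinset, ‖ω.rep f x‖ with hS
  have hS0 : 0 ≤ S := Finset.sum_nonneg fun _ _ => norm_nonneg _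
  have hsup : ∀ z ∈ closedBall (0 : ℂ) r, ‖ω.rep f z‖ ≤ L * ‖f‖ * d + S := by
    intro z hz
    obtain ⟨x, hx, hzx⟩ := Set.mem_iUnion₂.1 (htc hz)
    have h1 := hL f z hz x (htr hx)
    have h2 : ‖ω.rep f x‖ ≤ S := Finset.single_le_sum (f := fun x => ‖ω.rep f x‖)
      (fun _ _ => norm_nonneg _) (htf.mem_toFinset.2 hx)
    have h3 : ‖z - x‖ ≤ d := by rw [← dist_eq_norm]; exact (mem_ball.1 hzx).le
    have h4 : ‖ω.rep f z‖ ≤ ‖ω.rep f z - ω.rep f x‖ + ‖ω.rep f x‖ := by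
      simpa using norm_add_le (ω.rep f z - ω.rep f x) (ω.rep f x)
    have h5 : L * ‖f‖ * ‖z - x‖ ≤ L * ‖f‖ * d := by gcongr
    linarith
  have hae := ω.coe_ae_eq_rep f
  have hint : Integrable (fun z => ‖ω.rep f z‖ ^ 2) ω.measure :=
    (integrable_L2_sq (f : ω.L2)).congr (by filter_upwards [hae] with z hz; rw [hz])
  have hintv : Integrable (fun z => v z * ‖ω.rep f z‖ ^ 2) ω.measure :=
    (integrable_mul_L2_sq hv (B := Q) (fun z hz => by
      rw [abs_of_nonneg (hv0 z hz)]; exact hQ z hz) (f : ω.L2)).congr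
      (by filter_upwards [hae] with z hz; rw [hz])
  have h1 : ∫ z, v z * ‖ω.rep f z‖ ^ 2 ∂ω.measure ≤
      ∫ z, (ε * ‖ω.rep f z‖ ^ 2 + Q * (L * ‖f‖ * d + S) ^ 2) ∂ω.measure := by
    refine integral_mono_ae hintv ((hint.const_mul ε).add (integrable_const _)) ?_
    filter_upwards [ω.ae_mem_ball] with z hz
    by_cases hzr : z ∈ closedBall (0 : ℂ) r
    · have h2 := pow_le_pow_left₀ (norm_nonneg _) (hsup z hzr) 2
      have h3 : v z * ‖ω.rep f z‖ ^ 2 ≤ Q * (L * ‖f‖ * d + S) ^ 2 :=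
        mul_le_mul (hQ z hz) h2 (by positivity) hQ0
      have : 0 ≤ ε * ‖ω.rep f z‖ ^ 2 := by positivity
      linarith
    · have h3 : v z * ‖ω.rep f z‖ ^ 2 ≤ ε * ‖ω.rep f z‖ ^ 2 :=
        mul_le_mul_of_nonneg_right (hvε z hz hzr) (by positivity)
      have : 0 ≤ Q * (L * ‖f‖ * d + S) ^ 2 := by positivity
      linarith
  have h2 : ∫ z, (ε * ‖ω.rep f z‖ ^ 2 + Q * (L * ‖f‖ * d + S) ^ 2) ∂ω.measure =
      ε * ‖f‖ ^ 2 + m * (Q * (L * ‖f‖ * d + S) ^ 2) := by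
    rw [integral_add (hint.const_mul ε) (integrable_const _), integral_const_mul, integral_const,
      ← ω.norm_sq_eq_integral hae, smul_eq_mul]
    rfl
  rw [h2] at h1
  refine h1.trans ?_
  have h3 : (L * ‖f‖ * d + S) ^ 2 ≤ 2 * (L * d) ^ 2 * ‖f‖ ^ 2 + 2 * S ^ 2 := by
    nlinarith [sq_nonneg (L * ‖f‖ * d - S)]
  have h4 := mul_le_mul_of_nonneg_left h3 (mul_nonneg hQ0 hm0)
  have h5 := mul_le_mul_of_nonneg_right hdε (sq_nonneg ‖f‖)
  linarith

/-! ### Density of the kernels, extension by continuity and a criterion for compactness. -/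

theorem topologicalClosure_kernelSpan (ω : BergmanWeight) :
    ω.kernelSpan.topologicalClosure = ⊤ := by
  refine Submodule.orthogonal_eq_bot_iff.1 ((Submodule.eq_bot_iff _).2 fun f hf => ?_)
  refine DFunLike.ext (F := ω.A2) f 0 fun z => ?_
  have h1 : ⟪ω.kernelFun z, f⟫_ℂ = 0 := Submodule.inner_right_of_mem_orthogonal
    (Submodule.le_topologicalClosure _ (Submodule.subset_span (Set.mem_range_self z))) hf
  rw [kernelFun_inner] at h1
  have h2 : (0 : ω.A2) z = 0 := by simp
  rw [h2]
  exact h1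

theorem denseRange_kernelSpan (ω : BergmanWeight) : DenseRange ω.kernelSpan.subtype := by
  rw [DenseRange, Submodule.coe_subtype, Subtype.range_coe]
  exact Submodule.dense_iff_topologicalClosure_eq_top.2 ω.topologicalClosure_kernelSpan

theorem hankel_apply {φ : ℂ → ℂ} (h : ω.Admissible φ) (f : (ω.hankel φ h).domain) :
    ∃ b : ω.L2, b =ᵐ[ω.measure] (fun z => conj (φ z) * (f : ω.A2).1 z) ∧
      ω.hankel φ h f = b - ω.A2.starProjection b :=
  ⟨_, MemLp.coeFn_toLp (memLp_of_mem (h.kernelSpan_le f.2)), rfl⟩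

theorem continuous_rep {x : ℂ} (hx : x ∈ ball (0 : ℂ) 1) : Continuous fun f : ω.A2 => ω.rep f x :=
  (ω.evalCLM (Complex.UnitDisc.mk x (by simpa using hx))).continuous

/-- An operator that is small on the functions vanishing at suitable finite sets is compact. -/
theorem isCompactOperator_of_norm_sq_le {T : ω.A2 →L[ℂ] ω.L2}
    (h : ∀ ε > 0, ∃ Z : Finset ℂ, ↑Z ⊆ ball (0 : ℂ) 1 ∧ ∃ C, ∀ f : ω.A2,
      ‖T f‖ ^ 2 ≤ ε * ‖f‖ ^ 2 + C * (∑ x ∈ Z, ‖ω.rep f x‖) ^ 2) : IsCompactOperator T := by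
  have hcl : T ∈ closure {f : ω.A2 →L[ℂ] ω.L2 | IsCompactOperator f} := by
    refine (SeminormedAddCommGroup.mem_closure_iff (E := ω.A2 →L[ℂ] ω.L2)).2 fun ε hε => ?_
    obtain ⟨Z, hZ, C, hC⟩ := h ((ε / 2) ^ 2) (by positivity)
    -- The orthogonal complement of this finite-dimensional span consists of the functions vanishing
    -- on `Z`, so `T` composed with the projection onto `S` is a finite rank operator within `ε/2`
    -- of `T`.
    set S : Submodule ℂ ω.A2 :=
      Submodule.span ℂ (ω.kernelFun '' ((fun z : 𝔻 => (z : ℂ)) ⁻¹' (Z : Set ℂ))) with hS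
    have hfin : ((fun z : 𝔻 => (z : ℂ)) ⁻¹' (Z : Set ℂ)).Finite :=
      Z.finite_toSet.preimage (Complex.UnitDisc.coe_injective.injOn)
    have : FiniteDimensional ℂ S := FiniteDimensional.span_of_finite ℂ (hfin.image _)
    refine ⟨T ∘L S.starProjection, ?_, ?_⟩
    · have : IsCompactOperator (S.orthogonalProjectionOnto : ω.A2 →L[ℂ] S) :=
        by
        have : ProperSpace S := FiniteDimensional.proper ℂ S
        exact isCompactOperator_of_locallyCompactSpace_dom _
      exact this.clm_comp (T ∘L S.subtypeL)
    · refine lt_of_le_of_lt (ContinuousLinearMap.opNorm_le_bound _ (M := ε / 2) (by positivity)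
        fun f => ?_) (by linarith : ε / 2 < ε)
      have h1 := hC (f - S.starProjection f)
      have h2 : ∑ x ∈ Z, ‖ω.rep (f - S.starProjection f) x‖ = 0 := by
        refine Finset.sum_eq_zero fun x hx => norm_eq_zero.2 ?_
        have hx1 : ‖x‖ < 1 := by simpa using hZ hx
        have h3 := kernelFun_inner (Complex.UnitDisc.mk x hx1) (f - S.starProjection f)
        refine h3.symm.trans ?_
        exact Submodule.inner_right_of_mem_orthogonal (K := S)
          (Submodule.subset_span ⟨_, hx, rfl⟩) (Submodule.sub_starProjection_mem_orthogonal f)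
      have h4 : ‖f - S.starProjection f‖ ≤ ‖f‖ := by
        rw [← Submodule.starProjection_orthogonal_val]
        exact Submodule.norm_starProjection_apply_le _ _
      rw [h2, zero_pow two_ne_zero, mul_zero, add_zero, ← mul_pow] at h1
      have h5 := (sq_le_sq₀ (norm_nonneg _) (by positivity)).1 h1
      simp only [sub_apply, ContinuousLinearMap.comp_apply, ← map_sub]
      exact h5.trans (by gcongr)
  exact isClosed_setOfPred_isCompactOperator.closure_subset hcl

theorem hankelCompact_of_littleBloch (hω : ω.ClassWStar) {φ : ℂ → ℂ} (hφ : φ ∈ ω.LittleBloch) :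
    ω.HankelCompact φ := by
  obtain ⟨hφ, hlim⟩ := hφ
  obtain ⟨M, hMc, hM, ⟨δ, hδ, hδM⟩, A, hA, hap⟩ := ω.exists_apriori hω
  have hcp := hω.contDiffOn_potential
  obtain ⟨r₁, hr₁, h₁⟩ := exists_deriv_sq_le hδ hδM hlim one_pos
  obtain ⟨Q, hQ0, hQ⟩ := exists_deriv_sq_le_mul hMc hM hφ hr₁ h₁
  have hadm := admissible_of_bounded hcp hMc hM hA hap hφ hQ0 hQ
  set v : ℂ → ℝ := fun z => ‖deriv φ z‖ ^ 2 / M z with hv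
  have hvc : ContinuousOn v (ball 0 1) :=
    ((hφ.deriv isOpen_ball).continuousOn.norm.pow 2).div hMc fun z hz => (hM z hz).ne'
  have hv0 : ∀ z ∈ ball (0 : ℂ) 1, 0 ≤ v z := fun z hz => div_nonneg (sq_nonneg _) (hM z hz).le
  have hvQ : ∀ z ∈ ball (0 : ℂ) 1, v z ≤ Q := fun z hz => (div_le_iff₀ (hM z hz)).2 (hQ z hz)
  have hint : ∀ f : ω.A2, Integrable (fun z => v z * ‖ω.rep f z‖ ^ 2) ω.measure := fun f =>
    (integrable_mul_L2_sq hvc (B := Q) (fun z hz => by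
      rw [abs_of_nonneg (hv0 z hz)]; exact hvQ z hz) (f : ω.L2)).congr
      (by filter_upwards [ω.coe_ae_eq_rep f] with z hz; rw [hz])
  have hH : ∀ f : (ω.hankel φ hadm).domain,
      ‖ω.hankel φ hadm f‖ ^ 2 ≤ A * ∫ z, v z * ‖ω.rep f z‖ ^ 2 ∂ω.measure := by
    intro f
    obtain ⟨b, hb, he⟩ := hankel_apply hadm f
    rw [he]
    exact norm_sub_starProjection_sq_le hcp hMc hM hA hap hφ f hb (hint f)
  have hbd : ∀ f : ω.A2, ∫ z, v z * ‖ω.rep f z‖ ^ 2 ∂ω.measure ≤ Q * ‖f‖ ^ 2 := by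
    intro f
    have h1 := ω.norm_sq_eq_integral (ω.coe_ae_eq_rep f)
    have h2 : ‖(f : ω.L2)‖ = ‖f‖ := rfl
    rw [← h2, h1, ← integral_const_mul]
    refine integral_mono_ae (hint f) (((integrable_L2_sq (f : ω.L2)).congr
      (by filter_upwards [ω.coe_ae_eq_rep f] with z hz; rw [hz])).const_mul Q) ?_
    filter_upwards [ω.ae_mem_ball] with z hz
    exact mul_le_mul_of_nonneg_right (hvQ z hz) (sq_nonneg _)
  have hnorm : ∀ f : ω.kernelSpan,
      ‖(ω.hankel φ hadm).toFun f‖ ≤ √(A * Q) * ‖ω.kernelSpan.subtype f‖ := by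
    intro f
    refine (sq_le_sq₀ (norm_nonneg _) (by positivity)).1 ?_
    rw [mul_pow, Real.sq_sqrt (by positivity), mul_assoc]
    exact (hH f).trans (mul_le_mul_of_nonneg_left (hbd f) hA.le)
  set T : ω.A2 →L[ℂ] ω.L2 :=
    LinearMap.extendOfNorm (ω.hankel φ hadm).toFun ω.kernelSpan.subtype with hT
  have hTH : ∀ f : ω.kernelSpan, T f = (ω.hankel φ hadm).toFun f := fun f =>
    LinearMap.extendOfNorm_eq ω.denseRange_kernelSpan ⟨_, hnorm⟩ f
  refine ⟨hadm, T, isCompactOperator_of_norm_sq_le fun ε hε => ?_, hTH⟩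
  obtain ⟨r, hr, h⟩ := exists_deriv_sq_le hδ hδM hlim (ε := ε / (2 * A)) (by positivity)
  obtain ⟨Z, hZ, C, hC⟩ := ω.exists_integral_le hvc hv0 hQ0 hvQ hr (ε := ε / (2 * A))
    (by positivity) fun z hz hzr => (div_le_iff₀ (hM z hz)).2 (h z hz hzr)
  refine ⟨Z, hZ, A * C, fun f => ?_⟩
  -- Both sides are continuous in `f`, since point evaluations are, so the estimate passes from the
  -- span of the kernels to `A²_ω`.
  refine isClosed_property ω.denseRange_kernelSpan (p := fun f => ‖T f‖ ^ 2 ≤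
    ε * ‖f‖ ^ 2 + A * C * (∑ x ∈ Z, ‖ω.rep f x‖) ^ 2) ?_ ?_ f
  · refine isClosed_le (by fun_prop) ((by fun_prop : Continuous fun f : ω.A2 => ε * ‖f‖ ^ 2).add
      (continuous_const.mul ((continuous_finsetSum _ fun x hx =>
        (continuous_rep (hZ hx)).norm).pow 2)))
  · intro f
    have h1 := (hH f).trans (mul_le_mul_of_nonneg_left (hC f) hA.le)
    have h2 : A * (2 * (ε / (2 * A)) * ‖(f : ω.A2)‖ ^ 2 + C * (∑ x ∈ Z, ‖ω.rep f x‖) ^ 2) =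
        ε * ‖(f : ω.A2)‖ ^ 2 + A * C * (∑ x ∈ Z, ‖ω.rep f x‖) ^ 2 := by
      field_simp
    rw [h2] at h1
    have h3 := hTH f
    rw [Submodule.subtype_apply, h3]
    exact h1

/-! ### Necessity: compact Hankel operators have symbols of little Bloch type -/

/-- Pairing `φ̄ - F` with `z - a` annihilates the holomorphic part, since `(conj (φ a) - F)(z - a)`
vanishes at `a`. What remains is the integral of `|z - a|²` times the conjugate of the difference
quotient, whose mean is `conj (φ' a)`. -/
theorem norm_deriv_sq_mul_le_integral {φ F : ℂ → ℂ} {a : ℂ} {r R : ℝ} (hr : 0 < r) (hR : r < R)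
    (hφ : DifferentiableOn ℂ φ (ball a R)) (hF : DifferentiableOn ℂ F (ball a R)) :
    ‖deriv φ a‖ ^ 2 * (Real.pi * r ^ 4 / 2) ≤ ∫ z in ball a r, ‖conj (φ z) - F z‖ ^ 2 := by
  have hint : ∀ {V : Type} [NormedAddCommGroup V] {f : ℂ → V}, ContinuousOn f (ball a R) →
      IntegrableOn f (ball a r) := fun hf =>
    ((hf.mono (closedBall_subset_ball hR)).integrableOn_compact
      (isCompact_closedBall a r)).mono_set ball_subset_closedBall
  have ha : a ∈ ball a R := mem_ball_self (hr.trans hR)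
  have hg : DifferentiableOn ℂ (dslope φ a) (ball a R) :=
    (Complex.differentiableOn_dslope (ball_mem_nhds a (hr.trans hR))).2 hφ
  set G : ℂ → ℂ := fun z => conj (φ z) - F z with hG
  have hGc : ContinuousOn G (ball a R) :=
    (Complex.continuous_conj.comp_continuousOn hφ.continuousOn).sub hF.continuousOn
  have hsub : Continuous fun z : ℂ => ‖z - a‖ := by fun_prop
  have hsq : ∫ z in ball a r, ‖z - a‖ ^ 2 = Real.pi * r ^ 4 / 2 := by
    have h := integral_ball_radial (a := a) hr hR (F := fun _ => 1) (differentiableOn_const _) 2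
    simp only [mul_one] at h
    rw [integral_complex_ofReal] at h
    rw [Complex.ofReal_injective h]
    push_cast; ring
  have hI : ∫ z in ball a r, G z * (z - a) =
      conj (((Real.pi * r ^ 4 / 2 : ℝ) : ℂ) * deriv φ a) := by
    have e : ∀ z, G z * (z - a) = ((‖z - a‖ ^ 0 : ℝ) : ℂ) * ((conj (φ a) - F z) * (z - a)) +
        conj (((‖z - a‖ ^ 2 : ℝ) : ℂ) * dslope φ a z) := by
      intro z
      have h1 : φ z = φ a + (z - a) * dslope φ a z := by
        rw [← smul_eq_mul, sub_smul_dslope]; ring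
      have h2 : ((‖z - a‖ ^ 2 : ℝ) : ℂ) = (z - a) * conj (z - a) := by
        rw [Complex.mul_conj']; push_cast; rfl
      rw [hG]
      simp only [h1, h2, map_add, map_mul, Complex.conj_conj, pow_zero, Complex.ofReal_one]
      ring
    have i1 : ContinuousOn (fun z => ((‖z - a‖ ^ 0 : ℝ) : ℂ) * ((conj (φ a) - F z) * (z - a)))
        (ball a R) := by
      simp only [pow_zero, Complex.ofReal_one, one_mul]
      exact (continuousOn_const.sub hF.continuousOn).mul (by fun_prop)
    have i2 : ContinuousOn (fun z => ((‖z - a‖ ^ 2 : ℝ) : ℂ) * dslope φ a z) (ball a R) :=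
      (Continuous.continuousOn (by fun_prop)).mul hg.continuousOn
    simp only [e]
    have i3 : ContinuousOn (fun z => conj (((‖z - a‖ ^ 2 : ℝ) : ℂ) * dslope φ a z)) (ball a R) :=
      Complex.continuous_conj.comp_continuousOn i2
    have dH : DifferentiableOn ℂ (fun z => (conj (φ a) - F z) * (z - a)) (ball a R) :=
      ((differentiableOn_const _).sub hF).mul (differentiableOn_id.sub (differentiableOn_const _))
    rw [integral_add (hint i1) (hint i3),
      integral_conj, integral_ball_radial hr hR hg 2, integral_ball_radial hr hR dH 0,
      dslope_same]
    simp only [sub_self, mul_zero, zero_add]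
    congr 2
    push_cast; ring
  set s : ℝ := ‖deriv φ a‖ with hs
  have hIn : Real.pi * r ^ 4 / 2 * s ≤ ∫ z in ball a r, ‖G z‖ * ‖z - a‖ := by
    have h := norm_integral_le_integral_norm (μ := volume.restrict (ball a r))
      fun z => G z * (z - a)
    rw [hI, RCLike.norm_conj, norm_mul, Complex.norm_real,
      Real.norm_of_nonneg (by positivity)] at h
    simpa only [norm_mul] using h
  have j1 : IntegrableOn (fun z => ‖G z‖ * ‖z - a‖) (ball a r) :=
    hint (hGc.norm.mul hsub.continuousOn)
  have j2 : IntegrableOn (fun z => ‖z - a‖ ^ 2) (ball a r) := hint (hsub.pow 2).continuousOn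
  -- Cauchy–Schwarz in pointwise form: expand `(|G| - s|z - a|)² ≥ 0` with the optimal `s =
  -- |φ'(a)|`.
  have hmono : ∫ z in ball a r, (2 * s * (‖G z‖ * ‖z - a‖) - s ^ 2 * ‖z - a‖ ^ 2) ≤
      ∫ z in ball a r, ‖G z‖ ^ 2 :=
    integral_mono ((j1.const_mul _).sub (j2.const_mul _)) (hint (hGc.norm.pow 2)) fun z => by
      simp only
      nlinarith [sq_nonneg (‖G z‖ - s * ‖z - a‖)]
  rw [integral_sub (j1.const_mul _) (j2.const_mul _), integral_const_mul, integral_const_mul,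
    hsq] at hmono
  have := mul_le_mul_of_nonneg_left hIn (show 0 ≤ 2 * s by positivity)
  linarith

/-! ### Lower bound for the Hankel operator on a kernel. -/

theorem kernelFun_ne_zero (z : 𝔻) : ω.kernelFun z ≠ 0 := by
  intro h0
  have h1 : MemLp (fun _ : ℂ => (1 : ℂ)) 2 ω.measure := memLp_const 1
  have hm : h1.toLp _ ∈ ω.A2 := ⟨fun _ => 1, differentiableOn_const 1, h1.coeFn_toLp⟩
  have h2 : ω.rep ⟨_, hm⟩ z = 1 :=
    ω.rep_eqOn ⟨_, hm⟩ (differentiableOn_const 1) h1.coeFn_toLp (mem_ball_coe z)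
  have h3 := kernelFun_inner z ⟨_, hm⟩
  rw [h0, h2] at h3
  exact zero_ne_one ((inner_zero_left _).symm.trans h3)

theorem tau_pos (z : 𝔻) : 0 < ω.tau z := by
  have h1 := norm_pos_iff.2 (kernelFun_ne_zero (ω := ω) z)
  have h2 := Real.sqrt_pos.2 (ω.pos z (mem_ball_coe z))
  rw [tau]; positivity

theorem toFun_mul_norm_kernelFun_sq (z : 𝔻) :
    ω.toFun z * ‖ω.kernelFun z‖ ^ 2 * ω.tau z ^ 2 = 1 := by
  have h1 := norm_pos_iff.2 (kernelFun_ne_zero (ω := ω) z)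
  have h2 := ω.pos z (mem_ball_coe z)
  have h3 := Real.sqrt_pos.2 h2
  rw [tau, div_pow, mul_pow, Real.sq_sqrt h2.le]
  field_simp

/-- Restrict `φ̄ K_z - P_ω(φ̄ K_z)` to a disc of radius `r = κ τ_ω(z)`, divide by the zero-free
function `K_z`, and apply the local bound. With `ω|K_z|² ≥ ‖K_z‖²/(C⁴τ²)`, the product of that
factor and `π r⁴/2` gives the constant `πκ⁴/(2C⁴)`. -/
theorem exists_tau_sq_mul_le (hω : ω.ClassW) : ∃ c > 0, ∀ φ : ℂ → ℂ,
    DifferentiableOn ℂ φ (ball 0 1) → ∀ (z : 𝔻) (b : ω.L2),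
      b =ᵐ[ω.measure] (fun ζ => conj (φ ζ) * (ω.kernelFun z : ω.L2) ζ) →
        c * (ω.tau z * ‖deriv φ z‖ * ‖ω.kernelFun z‖) ^ 2 ≤ ‖b - ω.A2.starProjection b‖ ^ 2 := by
  obtain ⟨C₁, hC₁⟩ := hω.tau_le
  obtain ⟨η, hη, C, hC⟩ := hω.local_comparison
  have hC₁0 : 0 < C₁ := by
    have h1 := hC₁ 0
    have h2 := tau_pos (ω := ω) 0
    simp at h1
    linarith
  have hC0 : 0 < C := by
    have h1 := (hC 0 0 (by simpa using mul_nonneg hη.le (tau_pos (ω := ω) 0).le)).1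
    exact pos_of_mul_pos_left ((tau_pos (ω := ω) 0).trans_le h1) (tau_pos (ω := ω) 0).le
  -- The first bound keeps the disc of radius `2r` in the range of the local comparison; the second,
  -- through `τ_ω ≤ C₁(1 - |z|)`, keeps it inside the unit disc.
  set κ : ℝ := min (η / 2) (1 / (4 * C₁)) with hκ
  have hκ0 : 0 < κ := by positivity
  refine ⟨Real.pi * κ ^ 4 / (2 * C ^ 4), by positivity, fun φ hφ z b hb => ?_⟩
  set t := ω.tau z with ht
  have ht0 : 0 < t := tau_pos z
  set r : ℝ := κ * t with hr
  have hr0 : 0 < r := by positivity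
  have h2rη : 2 * r ≤ η * t := by
    have : κ ≤ η / 2 := min_le_left _ _
    rw [hr]; nlinarith
  have h2r1 : 2 * r < 1 - ‖(z : ℂ)‖ := by
    have h1 : κ * (4 * C₁) ≤ 1 := (le_div_iff₀ (by positivity)).1 (min_le_right _ _)
    have h2 := hC₁ z
    have h3 := z.norm_lt_one
    have h4 : κ * t ≤ κ * (C₁ * (1 - ‖(z : ℂ)‖)) := mul_le_mul_of_nonneg_left h2 hκ0.le
    nlinarith
  have hball : ball (z : ℂ) (2 * r) ⊆ ball 0 1 :=
    ball_subset_ball' (by rw [dist_zero_right]; linarith)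
  set k : ℂ → ℂ := ω.rep (ω.kernelFun z) with hk
  set N : ℝ := ‖ω.kernelFun z‖ with hN
  have hN0 : 0 < N := norm_pos_iff.2 (kernelFun_ne_zero z)
  have hlow : ∀ ζ ∈ ball (z : ℂ) (2 * r), N ^ 2 / (C ^ 4 * t ^ 2) ≤ ω.toFun ζ * ‖k ζ‖ ^ 2 := by
    intro ζ hζ
    set ζ' : 𝔻 := Complex.UnitDisc.mk ζ (by simpa using hball hζ) with hζ'
    have hcoe : (ζ' : ℂ) = ζ := rfl
    obtain ⟨-, h1, h2⟩ := hC z ζ' (by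
      rw [hcoe, ← dist_eq_norm, dist_comm]; exact (mem_ball.1 hζ).le.trans h2rη)
    have h3 : (ω.kernelFun z) ζ' = k ζ := rfl
    have h4 := toFun_mul_norm_kernelFun_sq (ω := ω) ζ'
    rw [hcoe] at h4
    rw [h3] at h2
    have hw := ω.pos ζ (hball hζ)
    set t' := ω.tau ζ' with ht'
    have ht'0 : 0 < t' := tau_pos ζ'
    set N' := ‖ω.kernelFun ζ'‖ with hN'
    have hN'0 : 0 ≤ N' := norm_nonneg _
    have h5 : (N * N') ^ 2 ≤ (C * ‖k ζ‖) ^ 2 := pow_le_pow_left₀ (by positivity) h2 2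
    have h6 : t' ^ 2 ≤ (C * t) ^ 2 := pow_le_pow_left₀ ht'0.le h1 2
    rw [div_le_iff₀ (by positivity)]
    -- The factor `ω(ζ) ‖K_ζ‖² τ_ω(ζ)² = 1` is inserted, then `‖K_z‖‖K_ζ‖` is replaced by
    -- `C|K(ζ,z)|` and `τ_ω(ζ)` by `C τ_ω(z)`.
    calc N ^ 2 = N ^ 2 * (ω.toFun ζ * N' ^ 2 * t' ^ 2) := by rw [h4, mul_one]
      _ = ω.toFun ζ * (N * N') ^ 2 * t' ^ 2 := by ring
      _ ≤ ω.toFun ζ * (C * ‖k ζ‖) ^ 2 * (C * t) ^ 2 := by gcongr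
      _ = ω.toFun ζ * ‖k ζ‖ ^ 2 * (C ^ 4 * t ^ 2) := by ring
  have hm0 : 0 < N ^ 2 / (C ^ 4 * t ^ 2) := by positivity
  set m := N ^ 2 / (C ^ 4 * t ^ 2) with hm
  have hk0 : ∀ ζ ∈ ball (z : ℂ) (2 * r), k ζ ≠ 0 := fun ζ hζ h0 => by
    have := hlow ζ hζ
    rw [h0] at this
    simp at this
    linarith
  set h : ω.A2 := ⟨ω.A2.starProjection b, Submodule.starProjection_apply_mem _ _⟩ with hh
  set F : ℂ → ℂ := fun ζ => ω.rep h ζ / k ζ with hF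
  have hFd : DifferentiableOn ℂ F (ball (z : ℂ) (2 * r)) :=
    ((ω.rep_differentiableOn h).mono hball).div ((ω.rep_differentiableOn _).mono hball) hk0
  have hφd : DifferentiableOn ℂ φ (ball (z : ℂ) (2 * r)) := hφ.mono hball
  have hloc := norm_deriv_sq_mul_le_integral hr0 (by linarith : r < 2 * r) hφd hFd
  set u : ω.L2 := b - ω.A2.starProjection b with hu
  have hue : u =ᵐ[ω.measure] fun ζ => conj (φ ζ) * k ζ - ω.rep h ζ := by
    filter_upwards [Lp.coeFn_sub b (ω.A2.starProjection b), hb, ω.coe_ae_eq_rep h,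
      ω.coe_ae_eq_rep (ω.kernelFun z)] with ζ h1 h2 h3 h4
    rw [hu, h1, Pi.sub_apply, h2, ← h3, h4]
  have hsub : ball (z : ℂ) r ⊆ ball (z : ℂ) (2 * r) := ball_subset_ball (by linarith)
  have hGint : IntegrableOn (fun ζ => m * ‖conj (φ ζ) - F ζ‖ ^ 2) (ball (z : ℂ) r) := by
    have : ContinuousOn (fun ζ => m * ‖conj (φ ζ) - F ζ‖ ^ 2) (ball (z : ℂ) (2 * r)) :=
      continuousOn_const.mul (((Complex.continuous_conj.comp_continuousOn hφd.continuousOn).sub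
        hFd.continuousOn).norm.pow 2)
    exact ((this.mono (closedBall_subset_ball (by linarith))).integrableOn_compact
      (isCompact_closedBall (z : ℂ) r)).mono_set ball_subset_closedBall
  have hmain : ∫ ζ in ball (z : ℂ) r, m * ‖conj (φ ζ) - F ζ‖ ^ 2 ≤ ‖u‖ ^ 2 := by
    have hint : Integrable (fun ζ => ‖conj (φ ζ) * k ζ - ω.rep h ζ‖ ^ 2) ω.measure :=
      (integrable_L2_sq u).congr (by filter_upwards [hue] with ζ hζ; rw [hζ])
    rw [← ENNReal.ofReal_le_ofReal_iff (sq_nonneg _), ω.norm_sq_eq_integral hue,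
      ofReal_integral_eq_lintegral_ofReal hint (Eventually.of_forall fun ζ => sq_nonneg _),
      ω.lintegral_measure, ofReal_integral_eq_lintegral_ofReal hGint
        (Eventually.of_forall fun ζ => mul_nonneg hm0.le (sq_nonneg _))]
    refine (setLIntegral_mono' measurableSet_ball fun ζ hζ => ?_).trans
      (lintegral_mono_set (hsub.trans hball))
    rw [← ENNReal.ofReal_mul (ω.pos ζ (hball (hsub hζ))).le]
    refine ENNReal.ofReal_le_ofReal ?_
    have e : conj (φ ζ) * k ζ - ω.rep h ζ = k ζ * (conj (φ ζ) - F ζ) := by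
      rw [hF, mul_sub, mul_div_cancel₀ _ (hk0 ζ (hsub hζ)), mul_comm]
    rw [e, norm_mul, mul_pow, ← mul_assoc]
    exact mul_le_mul_of_nonneg_right (hlow ζ (hsub hζ)) (sq_nonneg _)
  rw [integral_const_mul] at hmain
  refine le_trans (le_of_eq ?_) ((mul_le_mul_of_nonneg_left hloc hm0.le).trans hmain)
  rw [hm, hr]
  field_simp

/-- Compact operators send bounded weakly null families to norm null ones, here along an arbitrary
filter. The images stay in a compact set, and a cluster point `y` satisfies `⟪y, y⟫ = 0` because
`⟪y, T u⟫ = ⟪T* y, u⟫` tends to zero. -/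
theorem tendsto_of_isCompactOperator {E F ι : Type*} [NormedAddCommGroup E]
    [InnerProductSpace ℂ E] [CompleteSpace E] [NormedAddCommGroup F] [InnerProductSpace ℂ F]
    [CompleteSpace F] {T : E →L[ℂ] F} (hT : IsCompactOperator T) {l : Filter ι} {u : ι → E}
    (hu : ∀ i, ‖u i‖ ≤ 1) (h : ∀ f, Tendsto (fun i => ⟪f, u i⟫_ℂ) l (𝓝 0)) :
    Tendsto (fun i => T (u i)) l (𝓝 0) := by
  obtain ⟨K, hK, hKT⟩ := hT.image_closedBall_subset_compact (f := (T : E →ₗ[ℂ] F)) 1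
  refine hK.tendsto_nhds_of_unique_mapClusterPt
    (Eventually.of_forall fun i => hKT ⟨u i, by simpa using hu i, rfl⟩) fun y _ hy => ?_
  have h1 : MapClusterPt ⟪y, y⟫_ℂ l fun i => ⟪y, T (u i)⟫_ℂ :=
    hy.continuousAt_comp (f := fun x => ⟪y, x⟫_ℂ) (Continuous.continuousAt (by fun_prop))
  have h2 : Tendsto (fun i => ⟪y, T (u i)⟫_ℂ) l (𝓝 0) := by
    simpa only [ContinuousLinearMap.adjoint_inner_left] using h (T.adjoint y)
  have h3 : (𝓝 ⟪y, y⟫_ℂ ⊓ 𝓝 0).NeBot := NeBot.mono h1 (inf_le_inf_left _ h2)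
  exact inner_self_eq_zero.1 (eq_of_nhds_neBot h3)

/-- The normalized reproducing kernel. -/
noncomputable def normalizedKernel (ω : BergmanWeight) (z : 𝔻) : ω.A2 :=
  ((‖ω.kernelFun z‖⁻¹ : ℝ) : ℂ) • ω.kernelFun z

theorem norm_normalizedKernel_le (z : 𝔻) : ‖ω.normalizedKernel z‖ ≤ 1 := by
  rw [normalizedKernel, norm_smul, Complex.norm_real, norm_inv, norm_norm]
  exact inv_mul_le_one

theorem tendsto_inner_of_dense {E ι κ : Type*} [NormedAddCommGroup E] [InnerProductSpace ℂ E]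
    {K : κ → E} (hK : Dense (Submodule.span ℂ (Set.range K) : Set E)) {l : Filter ι} {u : ι → E}
    (hu : ∀ i, ‖u i‖ ≤ 1) (h : ∀ ζ, Tendsto (fun i => ⟪K ζ, u i⟫_ℂ) l (𝓝 0)) (f : E) :
    Tendsto (fun i => ⟪f, u i⟫_ℂ) l (𝓝 0) := by
  have hspan : ∀ g ∈ Submodule.span ℂ (Set.range K),
      Tendsto (fun i => ⟪g, u i⟫_ℂ) l (𝓝 0) := by
    intro g hg
    refine Submodule.span_induction ?_ ?_ ?_ ?_ hg
    · rintro _ ⟨ζ, rfl⟩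
      exact h ζ
    · simpa only [inner_zero_left] using tendsto_const_nhds
    · intro x y _ _ hx hy
      simpa only [inner_add_left, add_zero] using hx.add hy
    · intro c x _ hx
      simpa only [inner_smul_left, mul_zero] using hx.const_mul (conj c)
  rw [Metric.tendsto_nhds]
  intro ε hε
  obtain ⟨g, hg, hfg⟩ := hK.exists_dist_lt f (half_pos hε)
  filter_upwards [Metric.tendsto_nhds.1 (hspan g hg) (ε / 2) (half_pos hε)] with i hi
  rw [dist_zero_right] at hi ⊢
  have h1 : ⟪f, u i⟫_ℂ = ⟪f - g, u i⟫_ℂ + ⟪g, u i⟫_ℂ := by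
    rw [← inner_add_left, sub_add_cancel]
  have h2 : ‖⟪f - g, u i⟫_ℂ‖ ≤ ‖f - g‖ * 1 :=
    (norm_inner_le_norm _ _).trans (mul_le_mul_of_nonneg_left (hu i) (norm_nonneg _))
  have h3 : ‖f - g‖ < ε / 2 := by rw [← dist_eq_norm]; exact hfg
  rw [h1]
  exact (norm_add_le _ _).trans_lt (by linarith)

/-- Tested on `K_ζ`, weak convergence is the condition `K(ζ, z) = o(‖K_z‖)`; density of the kernels
and the bound on the norms give the general case. -/
theorem tendsto_inner_normalizedKernel (hω : ω.ClassW) (f : ω.A2) :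
    Tendsto (fun z => ⟪f, ω.normalizedKernel z⟫_ℂ) toBoundary (𝓝 0) := by
  refine tendsto_inner_of_dense (K := ω.kernelFun)
    (Submodule.dense_iff_topologicalClosure_eq_top.2 ω.topologicalClosure_kernelSpan)
    norm_normalizedKernel_le (fun ζ => ?_) f
  refine (hω.kernel_isLittleO ζ).tendsto_inv_smul_nhds_zero.congr fun z => ?_
  have h1 : ⟪ω.kernelFun ζ, ω.normalizedKernel z⟫_ℂ =
      ((‖ω.kernelFun z‖⁻¹ : ℝ) : ℂ) * ⟪ω.kernelFun ζ, ω.kernelFun z⟫_ℂ :=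
    inner_smul_right (𝕜 := ℂ) (E := ω.A2) _ _ _
  rw [h1, kernelFun_inner, ← smul_eq_mul, Complex.coe_smul]
  rfl

theorem littleBloch_of_hankelCompact (hω : ω.ClassW) {φ : ℂ → ℂ}
    (hφ : DifferentiableOn ℂ φ (ball 0 1)) (h : ω.HankelCompact φ) : φ ∈ ω.LittleBloch := by
  obtain ⟨hadm, T, hT, hTH⟩ := h
  obtain ⟨c, hc, hlow⟩ := exists_tau_sq_mul_le hω
  have hlim := (tendsto_of_isCompactOperator hT norm_normalizedKernel_le
    (tendsto_inner_normalizedKernel hω)).norm.const_mul (√c)⁻¹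
  rw [norm_zero, mul_zero] at hlim
  refine ⟨hφ, squeeze_zero (fun z => mul_nonneg (tau_pos z).le (norm_nonneg _)) (fun z => ?_) hlim⟩
  obtain ⟨b, hb, he⟩ := hankel_apply hadm ⟨ω.kernelFun z, Submodule.subset_span ⟨z, rfl⟩⟩
  have h1 := hlow φ hφ z b hb
  rw [← he, ← hTH] at h1
  have hN : 0 < ‖ω.kernelFun z‖ := norm_pos_iff.2 (kernelFun_ne_zero z)
  have h2 : ‖T (ω.normalizedKernel z)‖ = ‖ω.kernelFun z‖⁻¹ * ‖T (ω.kernelFun z)‖ := by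
    rw [normalizedKernel, map_smul, norm_smul, Complex.norm_real, norm_inv, norm_norm]
  have h3 : √c * (ω.tau z * ‖deriv φ z‖ * ‖ω.kernelFun z‖) ≤ ‖T (ω.kernelFun z)‖ := by
    refine (abs_le_of_sq_le_sq' ?_ (norm_nonneg _)).2
    rwa [mul_pow, Real.sq_sqrt hc.le]
  rw [h2, ← div_eq_inv_mul, ← div_eq_inv_mul, le_div_iff₀ (Real.sqrt_pos.2 hc), le_div_iff₀ hN]
  linarith

end BergmanWeight

theorem mainTheorem5 (ω : BergmanWeight) (hω : ω.ClassWStar) (φ : ℂ → ℂ)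
    (hφ : DifferentiableOn ℂ φ (Metric.ball 0 1)) :
    ω.HankelCompact φ ↔ φ ∈ ω.LittleBloch :=
  ⟨BergmanWeight.littleBloch_of_hankelCompact hω.toClassW hφ,
    BergmanWeight.hankelCompact_of_littleBloch hω⟩
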